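/- There is an absolute constant $C>0$ such that the following holds. Let $d,s,G\in\mathbb{N}$ with $d,s,G\ge 1$, let $\Gamma\subset\mathbb{Z}^d$ be finite, let $\delta\in(0,1)$, and put $N_\Gamma:=\max\bigl(1,\max_{j=1,\dots,d}\{\max_{k\in\Gamma}k_j-\min_{l\in\Gamma}l_j\}\bigr)$ (the inner maximum being $0$ if $\Gamma=\emptyset$). Then there are parameters of the sampling strategy (a local sparsity $s_{\mathrm{local}}\ge s$, a number $r$ of detection iterations, numbers of random rank-1 lattices and their prime sizes), depending only on $d,s,G,\Gamma,\delta$, for which the random set $S\subset\mathbb{T}^d$ of sampling locations, built from uniformly random points of $\mathbb{T}^d$ and from rank-1 lattices $\{\tfrac iM z \bmod 1: i=0,\dots,M-1\}$ with uniformly random generating vectors $z\in\{0,\dots,M-1\}^d$, always satisfies $$|S|\le C\Bigl(d\,s\,\max(s,N_\Gamma)\,\log^2\frac{3\,d\,s\,G\,N_\Gamma}{\delta}+\max(sG,N_\Gamma)\,\log\frac{3\,d\,s\,G}{\delta}\Bigr),$$ and the following is true for the uniform sparse FFT (usFFT), that is, the dimension-incremental method which (1) determines the active frequency components in each single coordinate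 from one-dimensional FFTs along $r$ random lines parallel to that coordinate axis; (2) for $t=2,\dots,d$, identifies the active frequencies in the first $t$ coordinates, out of all combinations of the frequencies already found in the first $t-1$ coordinates with the components found in coordinate $t$ that belong to the projection of $\Gamma$, by FFTs along several random rank-1 lattices in the first $t$ coordinates whose results are combined by a majority vote ($r$ repetitions with random values of the remaining coordinates if $t<d$, one repetition if $t=d$), the sets found for the $G$ functions being united in each step; (3) computes the Fourier coefficients for the frequencies found, by FFTs along several random rank-1 lattices in all coordinates. In the first two steps, only the $s_{\mathrm{local}}$ (for $t=d\ge 2$ in step (2): the $s$) largest coefficients that are larger than a threshold $\theta$ in absolute value are kept for each function. The output of the usFFT depends on the $G$ given functions only through their values at the locations in $S$. Let $p^{(g)}(x)=\sum_{k\in I_g}\hat p^{(g)}_k\,\mathrm{e}^{2\pi\mathrm{i}k\cdot x}$, $g=1,\dots,G$, be arbitrary trigonometric polynomials with $I_g\subset\Gamma$, $|I_g|\le s$ and $|\hat p^{(g)}_k|>0$ for all $k\in I_g$, and let the threshold satisfy $\theta\ge 0$ and $3\theta\le|\hat p_k^{(g)}|$ for all $g$ and all $k\in I_g$ (for instance $\theta=0$).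 Then with probability at least $1-\delta$ both of the following hold: - the usFFT recovers all frequencies and Fourier coefficients: for every $g$, the pairs of a frequency and a nonzero coefficient in its output are exactly the pairs $(k,\hat p^{(g)}_k)$, $k\in I_g$; - its arithmetic cost is at most $C\,d^2s^2G^2N_\Gamma\log^3\frac{3\,d\,s\,G\,N_\Gamma}{\delta}$. In the worst case, that is, for all values of the random numbers, its arithmetic cost is at most $C\,d^2s^3G^2N_\Gamma\log^3\frac{3\,d\,s\,G\,N_\Gamma}{\delta}$. Here the arithmetic cost is the number of elementary operations (arithmetic operations on numbers, comparisons, evaluations of $\mathrm{e}^{2\pi\mathrm{i}a/n}$ and of absolute values, random numbers drawn, array accesses, samples read), where $\Gamma$ is given by its sorted one-dimensional projections and by membership queries for its projections to the first $t$ coordinates. -/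

import Mathlib

open MeasureTheory

noncomputable section

namespace USFFT

/-! ### Step counting

Algorithms are written in a monad that records the number of elementary operations they perform.
The unit-cost model is the usual one for arithmetic complexity: one elementary operation is one
arithmetic operation on (complex, real or integer) numbers, one comparison, one evaluation of
`exp (2 π i a / n)` or of an absolute value, one random number, one access to an array cell, or one
call of the black box that provides the sample of a trigonometric polynomial at a node.
`charge n v` computes `v` by at most `n` elementary operations; all loops are built from the
combinators below, which add one operation per pass for the loop itself. An array is a function on
`ℕ`, of which an initial segment is used. -/

/-- A computed value together with the number of elementary operations spent on it. -/
structure Timed (α : Type) where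
  val : α
  cost : ℕ

namespace Timed

variable {α β : Type}

instance : Monad Timed where
  pure a := ⟨a, 0⟩
  bind x f := ⟨(f x.val).val, x.cost + (f x.val).cost⟩

/-- Return `a`, at the price of `n` elementary operations. -/
def charge (n : ℕ) (a : α) : Timed α := ⟨a, n⟩

/-- Fill an array of length `n`. -/
def tabulate [Inhabited α] (n : ℕ) (f : ℕ → Timed α) : Timed (ℕ → α) :=
  ⟨fun i => if i < n then (f i).val else default, ∑ i ∈ Finset.range n, ((f i).cost + 1)⟩

/-- Fill an array indexed by `Fin n`. -/
def tabulateFin {n : ℕ} (f : Fin n → Timed α) : Timed (Fin n → α) :=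
  ⟨fun i => (f i).val, ∑ i, ((f i).cost + 1)⟩

/-- Apply `f` to all entries of a list. -/
def mapT (l : List α) (f : α → Timed β) : Timed (List β) :=
  ⟨l.map fun a => (f a).val, (l.map fun a => (f a).cost + 1).sum⟩

/-- Keep the entries of a list that pass a test. -/
def filterT (l : List α) (f : α → Timed Bool) : Timed (List α) :=
  ⟨l.filter fun a => (f a).val, (l.map fun a => (f a).cost + 1).sum⟩

/-- Concatenate the lists `f a`, for `a` in a list. -/
def flatMapT (l : List α) (f : α → Timed (List β)) : Timed (List β) :=
  ⟨l.flatMap fun a => (f a).val, (l.map fun a => (f a).cost + (f a).val.length + 1).sum⟩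

/-- Run through a list from left to right, updating a state. -/
def foldT : List α → β → (β → α → Timed β) → Timed β
  | [], b, _ => ⟨b, 0⟩
  | a :: l, b, f =>
    ⟨(foldT l (f b a).val f).val, (f b a).cost + (foldT l (f b a).val f).cost + 1⟩

end Timed

open Timed

/-! ### Fast Fourier transform -/

/-- `exp (2 π i a / n)`. -/
def cis (a : ℤ) (n : ℕ) : ℂ := Complex.exp (2 * Real.pi * Complex.I * a / n)

/-- Radix-2 FFT: from `a 0, …, a (2 ^ b - 1)` compute `∑ j < 2 ^ b, a j * exp (-2 π i j k / 2 ^ b)`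
for `k < 2 ^ b`. -/
def radix2FFT : ℕ → (ℕ → ℂ) → Timed (ℕ → ℂ)
  | 0, a => tabulate 1 fun k => charge 2 (a k)
  | b + 1, a => do
    let ev ← tabulate (2 ^ b) fun j => charge 4 (a (2 * j))
    let od ← tabulate (2 ^ b) fun j => charge 4 (a (2 * j + 1))
    let E ← radix2FFT b ev
    let O ← radix2FFT b od
    tabulate (2 ^ (b + 1)) fun k =>
      charge 10 (E (k % 2 ^ b) + cis (-k) (2 ^ (b + 1)) * O (k % 2 ^ b))

/-- FFT of arbitrary length `n` (chirp transform, that is Bluestein's algorithm), normalised as for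
Fourier coefficients: compute `1 / n * ∑ j < n, a j * exp (-2 π i j k / n)` for `k < n`. -/
def fft (n : ℕ) (a : ℕ → ℂ) : Timed (ℕ → ℂ) := do
  let b ← charge (2 * n + 2) (Nat.clog 2 (2 * n))
  let m ← charge (2 * n + 2) (2 ^ b)
  let u ← tabulate m fun j =>
    charge 10 (if j < n then a j * cis (-(j : ℤ) ^ 2) (2 * n) else 0)
  let v ← tabulate m fun j =>
    charge 14 (if j < n then cis ((j : ℤ) ^ 2) (2 * n)
      else if m < j + n then cis (((m : ℤ) - j) ^ 2) (2 * n) else 0)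
  let U ← radix2FFT b u
  let V ← radix2FFT b v
  let W ← tabulate m fun j => charge 5 (U j * V j)
  let w ← radix2FFT b W
  tabulate n fun k =>
    charge 14 (cis (-(k : ℤ) ^ 2) (2 * n) * w ((m - k) % m) / m / n)

/-! ### Selection of the largest coefficients -/

open Classical in
/-- Merge two lists of (label, coefficient) pairs that are sorted by decreasing absolute value of
the coefficient. -/
def merge : List (ℕ × ℂ) → List (ℕ × ℂ) → Timed (List (ℕ × ℂ))
  | [], ys => charge 1 ys
  | x :: xs, [] => charge 1 (x :: xs)
  | x :: xs, y :: ys =>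
    if ‖y.2‖ ≤ ‖x.2‖ then do
      let l ← merge xs (y :: ys)
      charge 6 (x :: l)
    else do
      let l ← merge (x :: xs) ys
      charge 6 (y :: l)
termination_by xs ys => xs.length + ys.length

/-- Merge sort by decreasing absolute value of the coefficient; the first argument bounds the depth
of the recursion. -/
def mergeSort : ℕ → List (ℕ × ℂ) → Timed (List (ℕ × ℂ))
  | 0, l => charge 1 l
  | n + 1, l =>
    if l.length ≤ 1 then charge 2 l
    else do
      let h ← charge (l.length + 2) (l.length / 2)
      let p ← charge (l.length + 2) (l.take h, l.drop h)
      let l₁ ← mergeSort n p.1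
      let l₂ ← mergeSort n p.2
      merge l₁ l₂

open Classical in
/-- The labels of the at most `m` largest coefficients, among those larger than `θ` in absolute
value. -/
def largest (m : ℕ) (θ : ℝ) (l : List (ℕ × ℂ)) : Timed (List ℕ) := do
  let l₁ ← filterT l fun x => charge 4 (decide (θ < ‖x.2‖))
  let l₂ ← mergeSort l₁.length l₁
  mapT (l₂.take m) fun x => charge 2 x.1

open Classical in
/-- Majority vote: if more than half of the entries of a list agree, return their common value. -/
def majority (l : List ℂ) : Timed ℂ := do
  let c ← foldT l ((0 : ℂ), (0 : ℕ)) fun c v =>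
    charge 6 (if c.2 = 0 then (v, 1) else if v = c.1 then (c.1, c.2 + 1) else (c.1, c.2 - 1))
  charge 1 c.1

/-- Mark labels in an array of flags. -/
def mark (sel : List ℕ) (flags : ℕ → Bool) : Timed (ℕ → Bool) :=
  foldT sel flags fun fl j => charge 2 (Function.update fl j true)

/-- The entries of a list whose positions are marked. -/
def marked {α : Type} (l : List α) (flags : ℕ → Bool) : Timed (List α) := do
  let kept ← filterT l.zipIdx fun x => charge 3 (flags x.2)
  mapT kept fun x => charge 2 x.1

/-! ### Frequencies, trigonometric polynomials, rank-1 lattices -/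

variable {d G : ℕ}

/-- The trigonometric polynomial `∑ k ∈ I, c k * exp (2 π i k · x)` on the torus. -/
def trigPoly (I : Finset (Fin d → ℤ)) (c : (Fin d → ℤ) → ℂ) (x : UnitAddTorus (Fin d)) : ℂ :=
  ∑ k ∈ I, c k * UnitAddTorus.mFourier k x

/-- `max k_t - min l_t` over `k, l ∈ Γ`, for one coordinate `t` (zero if `Γ` is empty). -/
def width (Γ : Finset (Fin d → ℤ)) (t : Fin d) : ℕ :=
  Γ.sup fun k => Γ.sup fun l => (k t - l t).toNat

/-- `N_Γ`, the largest width of `Γ` over all coordinates. -/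
def maxWidth (Γ : Finset (Fin d → ℤ)) : ℕ :=
  Finset.univ.sup fun t => width Γ t

/-- The projection of a frequency to its coordinates up to `t` (inclusive). Elements of the
projected space are written as vectors of full length whose coordinates after `t` are zero. -/
def proj (t : Fin d) (k : Fin d → ℤ) : Fin d → ℤ := fun j => if j ≤ t then k j else 0

/-- The one-dimensional projection of `Γ` to the coordinate `t`, as a list. -/
def projCoord (Γ : Finset (Fin d → ℤ)) (t : Fin d) : List ℤ :=
  (Γ.image fun k => k t).sort (· ≤ ·)

/-- The point number `n` of the rank-1 lattice with generating vector `z` and size `M`. -/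
def latticePoint {M : ℕ} (z : Fin d → Fin M) (n : ℕ) : UnitAddTorus (Fin d) :=
  fun j => (((n : ℝ) * (z j : ℕ) / M : ℝ) : UnitAddCircle)

/-- `k · z mod M`. -/
def residue {M : ℕ} (k : Fin d → ℤ) (z : Fin d → Fin M) : ℕ :=
  ((∑ j, k j * ((z j : ℕ) : ℤ)) % (M : ℤ)).toNat

/-! ### The randomized sampling strategy -/

/-- The parameters of the sampling strategy. -/
structure Params where
  /-- local sparsity parameter -/
  sLoc : ℕ
  /-- number of detection iterations -/
  r : ℕ
  /-- number of random rank-1 lattices in each detection -/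
  L : ℕ
  /-- size of each of these lattices -/
  M : ℕ
  M_prime : M.Prime
  /-- number of random rank-1 lattices for the final computation of the Fourier coefficients -/
  Lfin : ℕ
  /-- size of each of these lattices -/
  Mfin : ℕ
  Mfin_prime : Mfin.Prime

/-- The random numbers that the sampling strategy draws: the points `x'` of the one-dimensional
detections, the points `x'` of the coupling detections, the generating vectors of the random
rank-1 lattices of the coupling detections, and the generating vectors of the final lattices. -/
abbrev Randomness (d : ℕ) (P : Params) : Type :=
  (Fin d → Fin P.r → UnitAddTorus (Fin d)) ×
  (Fin d → Fin P.r → UnitAddTorus (Fin d)) ×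
  (Fin d → Fin P.r → Fin P.L → Fin d → Fin P.M) ×
  (Fin P.Lfin → Fin d → Fin P.Mfin)

/-- The uniform distribution on the torus. -/
def torusLaw (d : ℕ) : Measure (UnitAddTorus (Fin d)) :=
  Measure.pi fun _ => AddCircle.haarAddCircle

/-- All the random numbers are drawn independently and uniformly. -/
def law (d : ℕ) (P : Params) : Measure (Randomness d P) :=
  (Measure.pi fun _ => Measure.pi fun _ => torusLaw d).prod
    ((Measure.pi fun _ => Measure.pi fun _ => torusLaw d).prod
      ((ProbabilityTheory.uniformOn Set.univ).prod (ProbabilityTheory.uniformOn Set.univ)))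

/-- A node of the one-dimensional detections for the coordinate `t`: that coordinate is `n / K`, the
others are those of `x`. -/
def coordNode (x : UnitAddTorus (Fin d)) (t : Fin d) (K n : ℕ) : UnitAddTorus (Fin d) :=
  Function.update x t (((n : ℝ) / K : ℝ) : UnitAddCircle)

/-- A node of the coupling detections for the coordinates up to `t`: these are taken from the
lattice point number `n`, the others are those of `x`. -/
def prefixNode {M : ℕ} (x : UnitAddTorus (Fin d)) (t : Fin d) (z : Fin d → Fin M) (n : ℕ) :
    UnitAddTorus (Fin d) :=
  fun j => if j ≤ t then latticePoint z n j else x j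

/-- The detection iterations for the coupling of the coordinates up to `t`: all `r` of them if `t`
is not the last coordinate, otherwise one. -/
def iterations (P : Params) (t : Fin d) : List (Fin P.r) :=
  (List.finRange P.r).take (if (t : ℕ) + 1 < d then P.r else 1)

open Classical in
/-- The set of sampling locations. -/
def samplingSet (Γ : Finset (Fin d → ℤ)) (P : Params) (ω : Randomness d P) :
    Finset (UnitAddTorus (Fin d)) :=
  (Finset.univ.biUnion fun t : Fin d => Finset.univ.biUnion fun i : Fin P.r =>
    (Finset.range (width Γ t + 1)).image fun n => coordNode (ω.1 t i) t (width Γ t + 1) n) ∪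
  ((Finset.univ.filter fun t : Fin d => 0 < (t : ℕ)).biUnion fun t =>
    (iterations P t).toFinset.biUnion fun i => Finset.univ.biUnion fun l : Fin P.L =>
      (Finset.range P.M).image fun n => prefixNode (ω.2.1 t i) t (ω.2.2.1 t i l) n) ∪
  (Finset.univ.biUnion fun l : Fin P.Lfin =>
    (Finset.range P.Mfin).image fun n => latticePoint (ω.2.2.2 l) n)

/-! ### The uniform sparse fast Fourier transform

The search space `Γ` is accessed only through its one-dimensional projections, given as lists, and
through membership queries for its projections to the first coordinates. `f g` is the black box for
the polynomial number `g`. -/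

/-- Identification of the frequency components in the coordinate `t`. -/
def singleComponent (Γ : Finset (Fin d → ℤ)) (θ : ℝ) (P : Params) (ω : Randomness d P)
    (f : Fin G → UnitAddTorus (Fin d) → ℂ) (t : Fin d) : Timed (List ℤ) := do
  let K := width Γ t + 1
  let cand := projCoord Γ t
  let flags ← foldT (List.finRange P.r) (fun _ : ℕ => false) fun flags i => do
    let x ← charge d (ω.1 t i)
    let X ← tabulate K fun n => charge (d + 4) (coordNode x t K n)
    foldT (List.finRange G) flags fun flags g => do
      let y ← tabulate K fun n => charge 3 (f g (X n))
      let c ← fft K y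
      let est ← mapT cand.zipIdx fun k => charge 6 (k.2, c (k.1 % (K : ℤ)).toNat)
      let sel ← largest P.sLoc θ est
      mark sel flags
  marked cand flags

open Classical in
/-- The candidate set for the coordinates up to `t`: the combinations of a frequency in `I`, known
up to the coordinate before `t`, and a component in `A`, that belong to the projection of `Γ`. -/
def candidates (Γ : Finset (Fin d → ℤ)) (t : Fin d) (I : List (Fin d → ℤ)) (A : List ℤ) :
    Timed (List (Fin d → ℤ)) := do
  let prod ← flatMapT I fun k => mapT A fun a => charge (d + 2) (Function.update k t a)
  filterT prod fun k => charge (d + 1) (decide (k ∈ Γ.image (proj t)))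

/-- The random rank-1 lattice method: from the samples along the lattices with the generating
vectors `z` listed in `lat`, determine the positions in the candidate list `J` of the at most `m`
frequencies with the largest coefficients, each larger than `θ` in absolute value. Every lattice
yields, by one FFT, an estimate of the coefficient of each candidate, and these are combined by a
majority vote. -/
def randomLattices {M : ℕ} (m : ℕ) (θ : ℝ) (J : List (Fin d → ℤ))
    (lat : List ((Fin d → Fin M) × (ℕ → ℂ))) : Timed (List ℕ) := do
  let F ← mapT lat fun a => do
    let c ← fft M a.2
    charge 2 (a.1, c)
  let est ← mapT J.zipIdx fun k => do
    let vals ← mapT F fun a => charge (2 * d + 4) (a.2 (residue k.1 a.1))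
    let c ← majority vals
    charge 2 (k.2, c)
  largest m θ est

/-- Identification of the frequencies in the coordinates up to `t`, out of the candidates `J`. -/
def couple (s : ℕ) (θ : ℝ) (P : Params) (ω : Randomness d P)
    (f : Fin G → UnitAddTorus (Fin d) → ℂ) (t : Fin d) (J : List (Fin d → ℤ)) :
    Timed (List (Fin d → ℤ)) := do
  let m := if (t : ℕ) + 1 < d then P.sLoc else s
  let flags ← foldT (iterations P t) (fun _ : ℕ => false) fun flags i => do
    let x ← charge d (ω.2.1 t i)
    let lat ← mapT (List.finRange P.L) fun l => do
      let z ← charge d (ω.2.2.1 t i l)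
      let X ← tabulate P.M fun n => charge (4 * d + 1) (prefixNode x t z n)
      charge 1 (z, X)
    foldT (List.finRange G) flags fun flags g => do
      let smp ← mapT lat fun a => do
        let y ← tabulate P.M fun n => charge 3 (f g (a.2 n))
        charge 1 (a.1, y)
      let sel ← randomLattices m θ J smp
      mark sel flags
  marked J flags

/-- Computation of the Fourier coefficients of all polynomials for the frequencies in `I`, from
samples along multiple rank-1 lattices. A lattice is used for those frequencies that do not alias
on it with another one in `I`; `cnt n` is the number of frequencies in `I` with residue `n`. -/
def coefficients (P : Params) (ω : Randomness d P) (f : Fin G → UnitAddTorus (Fin d) → ℂ)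
    (I : List (Fin d → ℤ)) : Timed (Fin G → List ((Fin d → ℤ) × ℂ)) := do
  let lat ← mapT (List.finRange P.Lfin) fun l => do
    let z ← charge d (ω.2.2.2 l)
    let X ← tabulate P.Mfin fun n => charge (3 * d + 1) (latticePoint z n)
    let cnt₀ ← tabulate P.Mfin fun _ => charge 1 (0 : ℕ)
    let cnt ← foldT I cnt₀ fun cnt k =>
      charge (2 * d + 6) (Function.update cnt (residue k z) (cnt (residue k z) + 1))
    charge 2 (z, X, cnt)
  tabulateFin fun g => do
    let F ← mapT lat fun a => do
      let y ← tabulate P.Mfin fun n => charge 3 (f g (a.2.1 n))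
      let c ← fft P.Mfin y
      charge 2 (a.1, c, a.2.2)
    mapT I fun k => do
      let v ← foldT F 0 fun v a =>
        charge (2 * d + 6) (if a.2.2 (residue k a.1) = 1 then a.2.1 (residue k a.1) else v)
      charge 2 (k, v)

/-- The uniform sparse FFT. Its output consists, for each of the `G` polynomials, of the list of the
detected frequencies (the same for all polynomials), each together with the computed Fourier
coefficient. -/
def usFFT (Γ : Finset (Fin d → ℤ)) (s : ℕ) (θ : ℝ) (P : Params) (ω : Randomness d P)
    (f : Fin G → UnitAddTorus (Fin d) → ℂ) : Timed (Fin G → List ((Fin d → ℤ) × ℂ)) := do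
  let comps ← mapT (List.finRange d) fun t => do
    let A ← singleComponent Γ θ P ω f t
    charge 1 (t, A)
  let I ← foldT comps [(0 : Fin d → ℤ)] fun I a => do
    let J ← candidates Γ a.1 I a.2
    if (a.1 : ℕ) = 0 then pure J else couple s θ P ω f a.1 J
  coefficients P ω f I

end USFFT

end

/-!
# Exact recovery and arithmetic cost of the uniform sparse FFT

The randomness enters only through four deterministic requirements, collected in `USFFT.Good`; on
this event the method is exact, so it remains to bound its probability and to count operations.

*Exactness.* Bluestein's FFT computes the discrete Fourier transform exactly (`USFFT.val_fft`).
Hence the transform along a line parallel to axis `t`, whose length exceeds the width of `Γ` in that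
direction, yields exactly the coefficients `q` of the restriction of a polynomial to this line
(`USFFT.coordEstimate_eq`), while the transform along a rank-1 lattice yields the coefficient of a
frequency `h` plus those of the frequencies that have the residue of `h`, that is, alias with `h`
(`USFFT.val_fft_prefixNode`). If fewer than half of the lattices alias, then the majority vote is
exact (`USFFT.mem_randomLattices`). At most `s` of the coefficients of a function are nonzero, so
keeping the `s` largest ones above the threshold discards none above it, and nothing spurious is
kept. If every frequency is moreover visible above the threshold in some detection iteration, then
after coordinate `t` the list consists precisely of the projections of all frequencies
(`USFFT.loopInvariant_extend`), and a final lattice on which a frequency is isolated gives its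
coefficients (`USFFT.val_coefficients`).

*Visibility.* At a random point the coefficient `q` in question is itself a trigonometric polynomial
with at most `s` terms, and `c`, the largest of its coefficients in absolute value, satisfies
`3 θ ≤ |c|`. As `|q| ≤ s |c|`, one has `|c| ≤ ∫ |q| ≤ θ + s |c| μ {θ < |q|}`, so that `θ < |q|` with
probability at least `2 / (3 s)` (`USFFT.torusLaw_norm_le_threshold`).

*Aliasing.* If the prime `M` exceeds the width of `Γ`, two frequencies have equal residues with
probability at most `1 / M`. With `M ≥ 16 s`, a lattice aliases with probability at most `1 / 16`
(`USFFT.uniformOn_alias_le`), and at least half of `L` lattices do so with probability at most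
`2 ^ (-L)` (`USFFT.pi_majority_le`).

*Parameters.* With `l = ⌈log (3 d s G / δ)⌉`, `r = 3 s l` detection iterations and `L = 9 l`
lattices of prime sizes between `16 max(s, N)` and `32 max(s, N)` in the coupling step, and between
`16 max(s G, N)` and `32 max(s G, N)` in the last step (`USFFT.Admissible`), the union bound
`USFFT.law_not_good_le` stays below `δ`.

*Cost.* The cost of one pass is linear in the number of frequencies found before, up to logarithms
(`USFFT.cost_usFFT_le`). This number is at most `s G` on the good event, since all frequencies found
are projections of true ones, and at most `r s G` in any case, since each selection keeps at most
`s` candidates. The part of the cost that depends on it thus grows by a factor `3 s l` in the worst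
case. As this part has only two logarithms on the good event, against three in the cost of the FFTs,
both totals contain the third power of the logarithm.
-/

namespace USFFT

open Timed

namespace Timed
variable {α β : Type}

@[simp] lemma val_bind (x : Timed α) (f : α → Timed β) : (x >>= f).val = (f x.val).val := rfl
@[simp] lemma cost_bind (x : Timed α) (f : α → Timed β) :
    (x >>= f).cost = x.cost + (f x.val).cost := rfl
@[simp] lemma val_charge (n : ℕ) (a : α) : (charge n a).val = a := rfl
@[simp] lemma cost_charge (n : ℕ) (a : α) : (charge n a).cost = n := rfl

lemma val_tabulate [Inhabited α] (n : ℕ) (f : ℕ → Timed α) {i : ℕ} (hi : i < n) :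
    (tabulate n f).val i = (f i).val := if_pos hi

@[simp] lemma cost_tabulate_charge [Inhabited α] (n c : ℕ) (f : ℕ → α) :
    (tabulate n fun i => charge c (f i)).cost = n * (c + 1) := by
  simp [tabulate]

@[simp] lemma val_tabulateFin {n : ℕ} (f : Fin n → Timed α) (i : Fin n) :
    (tabulateFin f).val i = (f i).val := rfl

lemma cost_tabulateFin_le {n : ℕ} {f : Fin n → Timed α} {c : ℕ} (h : ∀ i, (f i).cost ≤ c) :
    (tabulateFin f).cost ≤ n * (c + 1) := by
  have := Finset.sum_le_card_nsmul (Finset.univ : Finset (Fin n)) (fun i => (f i).cost + 1) (c + 1)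
    fun i _ => Nat.succ_le_succ (h i)
  simpa [tabulateFin] using this

@[simp] lemma val_mapT (l : List α) (f : α → Timed β) :
    (mapT l f).val = l.map fun a => (f a).val := rfl

lemma sum_map_le_of_forall {l : List α} {f : α → ℕ} {c : ℕ} (h : ∀ a ∈ l, f a ≤ c) :
    (l.map f).sum ≤ l.length * c := by
  simpa using List.sum_le_card_nsmul (l.map f) c (by simpa using h)

lemma cost_mapT_le {l : List α} {f : α → Timed β} {c : ℕ} (h : ∀ a ∈ l, (f a).cost ≤ c) :
    (mapT l f).cost ≤ l.length * (c + 1) :=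
  sum_map_le_of_forall fun a ha => Nat.succ_le_succ (h a ha)

@[simp] lemma cost_mapT_charge (l : List α) (c : ℕ) (f : α → β) :
    (mapT l fun a => charge c (f a)).cost = l.length * (c + 1) := by
  simp [mapT]

@[simp] lemma val_filterT (l : List α) (f : α → Timed Bool) :
    (filterT l f).val = l.filter fun a => (f a).val := rfl

@[simp] lemma cost_filterT_charge (l : List α) (c : ℕ) (f : α → Bool) :
    (filterT l fun a => charge c (f a)).cost = l.length * (c + 1) := by
  simp [filterT]

@[simp] lemma val_flatMapT (l : List α) (f : α → Timed (List β)) :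
    (flatMapT l f).val = l.flatMap fun a => (f a).val := rfl

lemma val_foldT (l : List α) (b : β) (f : β → α → Timed β) :
    (foldT l b f).val = l.foldl (fun b a => (f b a).val) b := by
  induction l generalizing b with
  | nil => rfl
  | cons a l ih => exact ih _

lemma cost_foldT_le {l : List α} {f : β → α → Timed β} {c : ℕ}
    (h : ∀ b, ∀ a ∈ l, (f b a).cost ≤ c) (b : β) : (foldT l b f).cost ≤ l.length * (c + 1) := by
  induction l generalizing b with
  | nil => simp [foldT]
  | cons a l ih =>
    have h1 := ih (fun b a ha => h b a (List.mem_cons_of_mem _ ha)) (f b a).val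
    have h2 := h b a List.mem_cons_self
    simp only [foldT, List.length_cons]
    linarith

@[simp] lemma cost_foldT_charge (l : List α) (c : ℕ) (f : β → α → β) (b : β) :
    (foldT l b fun b a => charge c (f b a)).cost = l.length * (c + 1) := by
  induction l generalizing b with
  | nil => simp [foldT]
  | cons a l ih => simp [foldT, ih]; ring

lemma tabulate_congr [Inhabited α] {n : ℕ} {f f' : ℕ → Timed α} (h : ∀ i < n, f i = f' i) :
    tabulate n f = tabulate n f' := by
  unfold tabulate
  congr 1
  · funext i
    split_ifs with hi
    · rw [h i hi]
    · rfl
  · exact Finset.sum_congr rfl fun i hi => by rw [h i (Finset.mem_range.1 hi)]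

lemma mapT_congr {l : List α} {f f' : α → Timed β} (h : ∀ a ∈ l, f a = f' a) :
    mapT l f = mapT l f' := by
  unfold mapT
  rw [List.map_congr_left fun a ha => by rw [h a ha],
    List.map_congr_left (f := fun a => (f a).cost + 1) fun a ha => by rw [h a ha]]

lemma foldT_congr {l : List α} {f f' : β → α → Timed β} (h : ∀ b, ∀ a ∈ l, f b a = f' b a) (b : β) :
    foldT l b f = foldT l b f' := by
  induction l generalizing b with
  | nil => rfl
  | cons a l ih =>
    simp only [foldT, h b a List.mem_cons_self,
      ih fun b a ha => h b a (List.mem_cons_of_mem _ ha)]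

/-- An invariant `Q` of a loop over `Fin d`, whose passes may depend on the state in their cost. -/
lemma foldT_finRange_invariant {d : ℕ} (A : Fin d → α) (f : β → Fin d × α → Timed β)
    (Q : ℕ → β → Prop) (c : ℕ) {b : β} (h0 : Q 0 b)
    (hstep : ∀ (t : Fin d) (b : β), Q t b →
      Q (t + 1) (f b (t, A t)).val ∧ (f b (t, A t)).cost ≤ c) :
    Q d (foldT ((List.finRange d).map fun t => (t, A t)) b f).val ∧
      (foldT ((List.finRange d).map fun t => (t, A t)) b f).cost ≤ d * (c + 1) := by
  induction d generalizing b Q with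
  | zero => simpa [foldT] using h0
  | succ d ih =>
    have hz := hstep 0 b h0
    have := ih (fun t => A t.succ) (fun b a => f b (a.1.succ, a.2)) (fun n b => Q (n + 1) b)
      (b := (f b (0, A 0)).val) (by simpa using hz.1)
      (fun t b hb => by simpa using hstep t.succ b (by simpa using hb))
    have key : ∀ (l : List (Fin d)) (b : β),
        foldT ((l.map Fin.succ).map fun t => (t, A t)) b f =
          foldT (l.map fun t => (t, A t.succ)) b (fun b a => f b (a.1.succ, a.2)) := by
      intro l
      induction l with
      | nil => intro b; rfl
      | cons a l ihl => intro b; simp only [List.map_cons, foldT, ihl]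
    rw [List.finRange_succ, List.map_cons]
    simp only [foldT, key]
    refine ⟨this.1, ?_⟩
    have h1 := this.2
    have h2 := hz.2
    linarith

end Timed

/-! ### The fast Fourier transform -/

lemma cis_add (a b : ℤ) (n : ℕ) : cis (a + b) n = cis a n * cis b n := by
  rw [cis, cis, cis, ← Complex.exp_add]
  push_cast
  ring_nf

lemma cis_zero (n : ℕ) : cis 0 n = 1 := by simp [cis]

lemma cis_mul_mul (a : ℤ) {c : ℕ} (hc : c ≠ 0) (n : ℕ) : cis (c * a) (c * n) = cis a n := by
  have : (c : ℂ) ≠ 0 := Nat.cast_ne_zero.2 hc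
  rcases Nat.eq_zero_or_pos n with rfl | hn
  · simp [cis]
  have hn' : (n : ℂ) ≠ 0 := Nat.cast_ne_zero.2 hn.ne'
  rw [cis, cis]
  congr 1
  push_cast
  field_simp

lemma cis_self_mul (a : ℤ) (n : ℕ) : cis (n * a) n = 1 := by
  rcases Nat.eq_zero_or_pos n with rfl | hn
  · simp [cis]
  have hn' : (n : ℂ) ≠ 0 := Nat.cast_ne_zero.2 hn.ne'
  rw [cis, ← Complex.exp_int_mul_two_pi_mul_I a]
  congr 1
  push_cast
  field_simp

lemma cis_congr {a b : ℤ} {n : ℕ} (h : a ≡ b [ZMOD n]) : cis a n = cis b n := by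
  obtain ⟨c, hc⟩ := h.symm.dvd
  rw [show a = b + n * c by linarith, cis_add, cis_self_mul, mul_one]

lemma cis_pow (a : ℤ) (n k : ℕ) : cis a n ^ k = cis (a * k) n := by
  rw [cis, cis, ← Complex.exp_nat_mul]
  push_cast
  ring_nf

lemma cis_eq_one_iff {a : ℤ} {n : ℕ} (hn : n ≠ 0) : cis a n = 1 ↔ (n : ℤ) ∣ a := by
  have hn' : (n : ℂ) ≠ 0 := Nat.cast_ne_zero.2 hn
  constructor
  · intro h
    obtain ⟨m, hm⟩ := Complex.exp_eq_one_iff.1 h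
    refine ⟨m, ?_⟩
    have h2 : (2 * Real.pi * Complex.I : ℂ) ≠ 0 := Complex.two_pi_I_ne_zero
    have : (a : ℂ) = n * m := by
      field_simp at hm
      exact hm
    exact_mod_cast this
  · rintro ⟨m, rfl⟩
    exact cis_self_mul m n

/-- Orthogonality of the characters of `ℤ / n`. -/
lemma sum_cis {n : ℕ} (hn : n ≠ 0) (a : ℤ) :
    ∑ j ∈ Finset.range n, cis (a * j) n = if (n : ℤ) ∣ a then (n : ℂ) else 0 := by
  simp_rw [← cis_pow]
  split_ifs with h
  · rw [(cis_eq_one_iff hn).2 h]; simp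
  · have h1 : cis a n ≠ 1 := fun h' => h ((cis_eq_one_iff hn).1 h')
    rw [geom_sum_eq h1, cis_pow, mul_comm, cis_self_mul, sub_self, zero_div]

lemma sum_range_two_mul (n : ℕ) (f : ℕ → ℂ) :
    ∑ j ∈ Finset.range (2 * n), f j =
      ∑ j ∈ Finset.range n, f (2 * j) + ∑ j ∈ Finset.range n, f (2 * j + 1) := by
  induction n with
  | zero => simp
  | succ n ih =>
    rw [show 2 * (n + 1) = 2 * n + 1 + 1 by ring, Finset.sum_range_succ, Finset.sum_range_succ, ih,
      Finset.sum_range_succ, Finset.sum_range_succ]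
    ring

lemma val_radix2FFT (b : ℕ) (a : ℕ → ℂ) {k : ℕ} (hk : k < 2 ^ b) :
    (radix2FFT b a).val k =
      ∑ j ∈ Finset.range (2 ^ b), a j * cis (-((j : ℤ) * k)) (2 ^ b) := by
  induction b generalizing a k with
  | zero =>
    have : k = 0 := by simpa using hk
    subst this
    simp [radix2FFT, tabulate, cis]
  | succ b ih =>
    have hpos : 0 < 2 ^ b := by positivity
    have hmod : k % 2 ^ b < 2 ^ b := Nat.mod_lt _ hpos
    have hcis : ∀ j : ℕ, cis (-((j : ℤ) * ((k % 2 ^ b : ℕ) : ℤ))) (2 ^ b) =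
        cis (-(((2 * j : ℕ) : ℤ) * k)) (2 ^ (b + 1)) := by
      intro j
      rw [show (-(((2 * j : ℕ) : ℤ) * k)) = (2 : ℕ) * (-((j : ℤ) * k)) by push_cast; ring,
        show 2 ^ (b + 1) = 2 * 2 ^ b by ring, cis_mul_mul _ two_ne_zero]
      refine cis_congr (Int.ModEq.neg (Int.ModEq.mul_left _ ?_))
      push_cast
      exact Int.mod_modEq _ _
    simp only [radix2FFT, val_bind]
    rw [val_tabulate _ _ hk, val_charge, ih _ hmod, ih _ hmod,
      show 2 ^ (b + 1) = 2 * 2 ^ b by ring, sum_range_two_mul, Finset.mul_sum]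
    rw [show 2 * 2 ^ b = 2 ^ (b + 1) by ring]
    congr 1
    · refine Finset.sum_congr rfl fun j hj => ?_
      rw [val_tabulate _ _ (Finset.mem_range.1 hj), val_charge, hcis]
    · refine Finset.sum_congr rfl fun j hj => ?_
      rw [val_tabulate _ _ (Finset.mem_range.1 hj), val_charge, hcis,
        show (-(((2 * j + 1 : ℕ) : ℤ) * k)) = -(k : ℤ) + -(((2 * j : ℕ) : ℤ) * k) by
          push_cast; ring,
        cis_add]
      ring

lemma cost_radix2FFT (b : ℕ) (a : ℕ → ℂ) : (radix2FFT b a).cost = 2 ^ b * (16 * b + 3) := by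
  induction b generalizing a with
  | zero => simp [radix2FFT]
  | succ b ih =>
    simp only [radix2FFT, cost_bind, cost_tabulate_charge, ih]
    ring

/-- A radix-2 FFT, read backwards, inverts the discrete Fourier transform of length `2 ^ b`. So
multiplying two transforms pointwise gives a cyclic convolution. -/
lemma radix2FFT_convolution (b : ℕ) (u v W : ℕ → ℂ)
    (hW : ∀ j < 2 ^ b, W j = (radix2FFT b u).val j * (radix2FFT b v).val j) {k : ℕ}
    (hk : k < 2 ^ b) :
    (radix2FFT b W).val ((2 ^ b - k) % 2 ^ b) / (2 ^ b : ℕ) =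
      ∑ p ∈ Finset.range (2 ^ b), u p * v ((k + 2 ^ b - p) % 2 ^ b) := by
  set m := 2 ^ b with hm
  have hpos : 0 < m := by positivity
  have hm0 : (m : ℂ) ≠ 0 := Nat.cast_ne_zero.2 hpos.ne'
  rw [val_radix2FFT b _ (Nat.mod_lt _ hpos), ← hm]
  have h1 : ∀ j ∈ Finset.range m, W j * cis (-((j : ℤ) * (((m - k) % m : ℕ) : ℤ))) m =
      ∑ p ∈ Finset.range m, ∑ q ∈ Finset.range m,
        u p * v q * cis (((k : ℤ) - p - q) * j) m := by
    intro j hj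
    have hj := Finset.mem_range.1 hj
    rw [hW j hj, val_radix2FFT b _ hj, val_radix2FFT b _ hj, ← hm, Finset.sum_mul_sum,
      Finset.sum_mul]
    refine Finset.sum_congr rfl fun p _ => ?_
    rw [Finset.sum_mul]
    refine Finset.sum_congr rfl fun q _ => ?_
    have : cis (-((j : ℤ) * (((m - k) % m : ℕ) : ℤ))) m = cis (k * j) m := by
      refine cis_congr ?_
      have h2 : (((m - k) % m : ℕ) : ℤ) ≡ -(k : ℤ) [ZMOD m] := by
        rw [Int.natCast_mod, Nat.cast_sub hk.le]
        refine (Int.mod_modEq _ _).trans ?_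
        rw [Int.modEq_iff_dvd]
        exact ⟨-1, by ring⟩
      calc -((j : ℤ) * (((m - k) % m : ℕ) : ℤ)) ≡ -((j : ℤ) * -(k : ℤ)) [ZMOD m] :=
            (h2.mul_left _).neg
        _ = k * j := by ring
    rw [this, show ((k : ℤ) - p - q) * j = k * j + -((p : ℤ) * j) + -((q : ℤ) * j) by
      ring, cis_add, cis_add, mul_comm (p : ℤ), mul_comm (q : ℤ)]
    ring_nf
  rw [Finset.sum_congr rfl h1, Finset.sum_comm, Finset.sum_div]
  refine Finset.sum_congr rfl fun p hp => ?_
  have hp := Finset.mem_range.1 hp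
  rw [Finset.sum_comm]
  simp_rw [← Finset.mul_sum, sum_cis hpos.ne']
  rw [Finset.sum_eq_single ((k + m - p) % m)]
  · rw [if_pos, mul_div_assoc, div_self hm0, mul_one]
    rw [Int.natCast_mod, Nat.cast_sub (by omega)]
    push_cast
    have h := Int.emod_add_mul_ediv ((k : ℤ) + m - p) m
    exact ⟨((k : ℤ) + m - p) / m - 1, by linear_combination -h⟩
  · intro q hq hne
    rw [if_neg, mul_zero]
    rintro ⟨c, hc⟩
    apply hne
    have : (q : ℤ) = ((k + m - p : ℕ) : ℤ) % m := by
      rw [Nat.cast_sub (by omega)]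
      push_cast
      rw [show (k : ℤ) + m - p = q + m * (c + 1) by linear_combination hc,
        Int.add_mul_emod_self_left, Int.emod_eq_of_lt (by positivity)
        (by exact_mod_cast Finset.mem_range.1 hq)]
    exact_mod_cast this
  · intro h
    exact absurd (Finset.mem_range.2 (Nat.mod_lt _ hpos)) h

/-- Bluestein's algorithm computes the discrete Fourier transform: as `- 2 j k` equals
`(k - j) ^ 2 - k ^ 2 - j ^ 2`, the transform is a convolution with the chirp
`exp (π i j ^ 2 / n)`. -/
lemma val_fft {n : ℕ} (a : ℕ → ℂ) {k : ℕ} (hk : k < n) :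
    (fft n a).val k = (∑ j ∈ Finset.range n, a j * cis (-((j : ℤ) * k)) n) / n := by
  have hclog : 2 * n ≤ 2 ^ Nat.clog 2 (2 * n) := Nat.le_pow_clog one_lt_two _
  simp only [fft, val_bind, val_charge]
  rw [val_tabulate _ _ hk, val_charge]
  set b := Nat.clog 2 (2 * n) with hb
  set m := 2 ^ b with hm
  congr 1
  rw [mul_div_assoc, radix2FFT_convolution b _ _ _ (fun j hj => by
    rw [val_tabulate _ _ hj, val_charge]) (by omega), ← hm]
  have hsub : Finset.range n ⊆ Finset.range m := by
    intro x hx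
    simp only [Finset.mem_range] at hx ⊢
    omega
  rw [← Finset.sum_subset hsub, Finset.mul_sum]
  · refine Finset.sum_congr rfl fun p hp => ?_
    have hp := Finset.mem_range.1 hp
    rw [val_tabulate _ _ (by omega), val_charge, if_pos hp,
      val_tabulate _ _ (Nat.mod_lt _ (by omega)), val_charge]
    -- the chirp identity `(k - p) ^ 2 - k ^ 2 - p ^ 2 = - 2 * p * k`
    have hchirp : cis (-(k : ℤ) ^ 2) (2 * n) * (a p * cis (-(p : ℤ) ^ 2) (2 * n) *
        cis (((k : ℤ) - p) ^ 2) (2 * n)) = a p * cis (-((p : ℤ) * k)) n := by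
      have : cis (-((p : ℤ) * k)) n = cis (-(k : ℤ) ^ 2) (2 * n) * cis (-(p : ℤ) ^ 2) (2 * n) *
        cis (((k : ℤ) - p) ^ 2) (2 * n) := by
        rw [← cis_add, ← cis_add, ← cis_mul_mul (-((p : ℤ) * k)) two_ne_zero]
        congr 1
        push_cast
        ring
      rw [this]
      ring
    rw [← hchirp]
    congr 2
    rcases le_or_gt p k with h | h
    · have : (k + m - p) % m = k - p := by
        rw [show k + m - p = k - p + m by omega, Nat.add_mod_right, Nat.mod_eq_of_lt (by omega)]
      rw [this, if_pos (by omega), Nat.cast_sub h]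
    -- a negative `k - p` is represented by `k - p + m`, at the end of the chirp array
    · have : (k + m - p) % m = k + m - p := Nat.mod_eq_of_lt (by omega)
      rw [this, if_neg (by omega)]
      refine (if_pos (by omega)).trans ?_
      rw [Nat.cast_sub (by omega)]
      push_cast
      congr 1
      ring
  · intro x hx hx'
    rw [val_tabulate _ _ (Finset.mem_range.1 hx), val_charge,
      if_neg (by simpa using hx'), zero_mul]

lemma cost_fft_le {n : ℕ} (hn : 1 ≤ n) (a : ℕ → ℂ) :
    (fft n a).cost ≤ 400 * n * Nat.clog 2 (2 * n) := by
  set b := Nat.clog 2 (2 * n) with hb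
  have h1 : 1 ≤ b := Nat.clog_pos one_lt_two (by omega)
  have h2 : 2 ^ b ≤ 4 * n := by
    have := Nat.pow_pred_clog_lt_self one_lt_two (x := 2 * n) (by omega)
    rw [← hb] at this
    obtain ⟨c, hc⟩ : ∃ c, b = c + 1 := ⟨b - 1, by omega⟩
    rw [hc] at this ⊢
    rw [pow_succ]
    simp at this
    omega
  have h3 : (fft n a).cost = 4 * n + 4 + 2 ^ b * 41 + 48 * (2 ^ b * b) + n * 15 := by
    simp only [fft, cost_bind, cost_charge, cost_tabulate_charge, val_charge, cost_radix2FFT, ← hb]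
    ring
  have h4 : 2 ^ b * b ≤ 4 * n * b := Nat.mul_le_mul_right _ h2
  have h5 : n ≤ n * b := Nat.le_mul_of_pos_right _ h1
  rw [h3, mul_assoc]
  rw [mul_assoc] at h4
  omega

/-- The estimate of a Fourier coefficient from equidistant samples of a sum of exponentials with
frequencies `a k` is the sum of the coefficients of all frequencies that alias. -/
lemma val_fft_of_expansion {ι : Type*} {n : ℕ} (hn : n ≠ 0) (S : Finset ι) (w : ι → ℂ)
    (a : ι → ℤ) (y : ℕ → ℂ)
    (hy : ∀ j < n, y j = ∑ i ∈ S, w i * cis (a i * j) n) (m : ℤ) :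
    (fft n y).val (m % (n : ℤ)).toNat =
      ∑ i ∈ S.filter (fun i => m % (n : ℤ) = a i % (n : ℤ)), w i := by
  have hn0 : (n : ℂ) ≠ 0 := Nat.cast_ne_zero.2 hn
  have hnn : 0 ≤ m % (n : ℤ) := Int.emod_nonneg _ (by omega)
  have hlt : (m % (n : ℤ)).toNat < n := by
    have := Int.emod_lt_of_pos m (b := n) (by omega)
    omega
  rw [val_fft _ hlt]
  have h1 : ∀ j ∈ Finset.range n, y j * cis (-((j : ℤ) * ((m % (n : ℤ)).toNat : ℤ))) n =
      ∑ i ∈ S, w i * cis ((a i - m) * j) n := by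
    intro j hj
    rw [hy j (Finset.mem_range.1 hj), Finset.sum_mul]
    refine Finset.sum_congr rfl fun i _ => ?_
    rw [mul_assoc, ← cis_add, Int.toNat_of_nonneg hnn]
    congr 1
    refine cis_congr ?_
    calc a i * j + -(j * (m % (n : ℤ))) ≡ a i * j + -(j * m) [ZMOD n] :=
          ((Int.mod_modEq m n).mul_left _).neg.add_left _
      _ = (a i - m) * j := by ring
  rw [Finset.sum_congr rfl h1, Finset.sum_comm]
  simp_rw [← Finset.mul_sum, sum_cis hn, mul_ite, mul_zero]
  rw [← Finset.sum_filter, ← Finset.sum_mul, mul_div_assoc, div_self hn0, mul_one]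
  refine Finset.sum_congr (Finset.filter_congr fun i _ => ?_) fun _ _ => rfl
  rw [← Int.modEq_iff_dvd]
  rfl

end USFFT

/-! ### Selection, majority vote and marking -/

namespace USFFT

open Timed

lemma merge_perm_and_cost (n : ℕ) (xs ys : List (ℕ × ℂ)) (hn : xs.length + ys.length = n) :
    (merge xs ys).val.Perm (xs ++ ys) ∧ (merge xs ys).cost ≤ 6 * n + 1 := by
  induction n generalizing xs ys with
  | zero =>
    have h1 : xs = [] := List.eq_nil_of_length_eq_zero (by omega)
    subst h1
    rw [merge]
    exact ⟨List.Perm.refl _, by simp⟩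
  | succ n ih =>
    match xs, ys with
    | [], ys => rw [merge]; exact ⟨List.Perm.refl _, by simp⟩
    | x :: xs, [] => rw [merge]; exact ⟨by simp, by simp⟩
    | x :: xs, y :: ys =>
      rw [merge]
      simp only [List.length_cons] at hn
      split_ifs with h
      · obtain ⟨h1, h2⟩ := ih xs (y :: ys) (by simp only [List.length_cons]; omega)
        simp only [val_bind, val_charge, cost_bind, cost_charge]
        exact ⟨h1.cons x, by omega⟩
      · obtain ⟨h1, h2⟩ := ih (x :: xs) ys (by simp only [List.length_cons]; omega)
        simp only [val_bind, val_charge, cost_bind, cost_charge]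
        exact ⟨(h1.cons y).trans List.perm_middle.symm, by omega⟩

lemma mergeSort_perm (n : ℕ) (l : List (ℕ × ℂ)) : (mergeSort n l).val.Perm l := by
  induction n generalizing l with
  | zero => exact List.Perm.refl _
  | succ n ih =>
    rw [mergeSort]
    split_ifs with h
    · exact List.Perm.refl _
    · simp only [val_bind, val_charge]
      refine (merge_perm_and_cost _ _ _ rfl).1.trans ?_
      refine ((ih _).append (ih _)).trans ?_
      rw [List.take_append_drop]

lemma cost_mergeSort_le (n : ℕ) (l : List (ℕ × ℂ)) :
    (mergeSort n l).cost ≤ 20 * l.length * Nat.clog 2 l.length + 2 := by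
  induction n generalizing l with
  | zero => simp [mergeSort]
  | succ n ih =>
    rw [mergeSort]
    split_ifs with h
    · simp
    · push Not at h
      simp only [val_charge, cost_bind, cost_charge]
      have h1 := ih (l.take (l.length / 2))
      have h2 := ih (l.drop (l.length / 2))
      have h3 := (merge_perm_and_cost _ (mergeSort n (l.take (l.length / 2))).val
        (mergeSort n (l.drop (l.length / 2))).val rfl).2
      rw [(mergeSort_perm _ _).length_eq, (mergeSort_perm _ _).length_eq] at h3
      simp only [List.length_take, List.length_drop] at h1 h2 h3
      rw [min_eq_left (Nat.div_le_self _ _)] at h1 h3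
      set N := l.length with hN
      have hc : Nat.clog 2 N = Nat.clog 2 (N - N / 2) + 1 := by
        rw [Nat.clog_of_two_le one_lt_two h]
        congr 2
        omega
      have hc' : Nat.clog 2 (N / 2) ≤ Nat.clog 2 (N - N / 2) := Nat.clog_mono_right _ (by omega)
      rw [hc]
      set c := Nat.clog 2 (N - N / 2)
      have h4 : 20 * (N / 2) * Nat.clog 2 (N / 2) ≤ 20 * (N / 2) * c := Nat.mul_le_mul_left _ hc'
      have h5 : 20 * (N / 2) * c + 20 * (N - N / 2) * c = 20 * N * c := by
        rw [← add_mul, ← mul_add, Nat.add_sub_cancel' (Nat.div_le_self _ _)]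
      have h6 : 20 * N * (c + 1) = 20 * N * c + 20 * N := by ring
      omega

lemma length_largest_le (m : ℕ) (θ : ℝ) (l : List (ℕ × ℂ)) :
    (largest m θ l).val.length ≤ min m l.length := by
  simp only [largest, val_bind, val_mapT, List.length_map, List.length_take]
  refine min_le_min le_rfl ?_
  rw [(mergeSort_perm _ _).length_eq]
  exact List.length_filter_le _ _

lemma cost_largest_le (m : ℕ) (θ : ℝ) (l : List (ℕ × ℂ)) :
    (largest m θ l).cost ≤ 20 * l.length * Nat.clog 2 l.length + 8 * l.length + 2 := by
  simp only [largest, cost_bind, cost_filterT_charge, cost_mapT_charge]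
  set l₁ := (filterT l fun x => charge 4 (decide (θ < ‖x.2‖))).val with hl₁
  have h1 : l₁.length ≤ l.length := List.length_filter_le _ _
  have h2 := cost_mergeSort_le l₁.length l₁
  have h3 : ((mergeSort l₁.length l₁).val.take m).length ≤ l.length :=
    (List.length_take_le' _ _).trans ((mergeSort_perm _ _).length_eq.trans_le h1)
  have h4 : 20 * l₁.length * Nat.clog 2 l₁.length ≤ 20 * l.length * Nat.clog 2 l.length := by
    gcongr
  omega

lemma mem_largest {m : ℕ} {θ : ℝ} {l : List (ℕ × ℂ)}
    (h : (l.filter fun x => decide (θ < ‖x.2‖)).length ≤ m) (j : ℕ) :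
    j ∈ (largest m θ l).val ↔ ∃ c, (j, c) ∈ l ∧ θ < ‖c‖ := by
  simp only [largest, val_bind, val_mapT, val_charge]
  rw [List.take_of_length_le]
  · rw [List.mem_map]
    constructor
    · rintro ⟨⟨j', c⟩, h1, rfl⟩
      have := (mergeSort_perm _ _).subset h1
      simp only [val_filterT, val_charge, List.mem_filter, decide_eq_true_eq] at this
      exact ⟨c, this⟩
    · rintro ⟨c, h1, h2⟩
      refine ⟨(j, c), (mergeSort_perm _ _).symm.subset ?_, rfl⟩
      simp only [val_filterT, val_charge, List.mem_filter, decide_eq_true_eq]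
      exact ⟨h1, h2⟩
  · rw [(mergeSort_perm _ _).length_eq]
    exact h

/-- If at most `m` of the labelled coefficients are nonzero, the selection keeps exactly those
above the threshold. -/
lemma mem_largest_zipIdx {α : Type} {m : ℕ} {θ : ℝ} (hθ : 0 ≤ θ) {l : List α} (hl : l.Nodup)
    (v : α → ℂ) (T : Finset α) (hT : ∀ a ∈ l, v a ≠ 0 → a ∈ T) (hcard : T.card ≤ m) (j : ℕ) :
    j ∈ (largest m θ (l.zipIdx.map fun k => (k.2, v k.1))).val ↔
      ∃ a, (a, j) ∈ l.zipIdx ∧ θ < ‖v a‖ := by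
  classical
  rw [mem_largest]
  · constructor
    · rintro ⟨c, h1, h2⟩
      obtain ⟨⟨a, i⟩, h3, h4⟩ := List.mem_map.1 h1
      simp only [Prod.mk.injEq] at h4
      obtain ⟨rfl, rfl⟩ := h4
      exact ⟨a, h3, h2⟩
    · rintro ⟨a, h1, h2⟩
      exact ⟨v a, List.mem_map.2 ⟨(a, j), h1, rfl⟩, h2⟩
  · have h1 : ((l.zipIdx.map fun k => (k.2, v k.1)).filter fun x => decide (θ < ‖x.2‖)).length =
        (l.filter fun a => decide (θ < ‖v a‖)).length := by
      conv_rhs => rw [← List.zipIdx_map_fst 0 l]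
      rw [List.filter_map, List.filter_map, List.length_map, List.length_map]
      rfl
    rw [h1, ← List.toFinset_card_of_nodup (hl.filter _)]
    refine (Finset.card_le_card fun a ha => ?_).trans hcard
    simp only [List.mem_toFinset, List.mem_filter, decide_eq_true_eq] at ha
    exact hT a ha.1 (norm_pos_iff.1 (hθ.trans_lt ha.2))

lemma cost_majority (l : List ℂ) : (majority l).cost = l.length * 7 + 1 := by
  simp only [majority, cost_bind, cost_foldT_charge, cost_charge]

open Classical in
/-- The Boyer–Moore vote is correct whenever there is a majority. -/
lemma val_majority {l : List ℂ} {v : ℂ} (h : 2 * l.countP (fun c => decide (c ≠ v)) < l.length) :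
    (majority l).val = v := by
  simp only [majority, val_bind, val_charge, val_foldT]
  -- the counter stands for that many unmatched votes for the current candidate `c.1`, and `v` keeps
  -- a strict majority among these and the votes still to be read
  have key : ∀ (l : List ℂ) (c : ℂ × ℕ),
      (l.length : ℤ) <
        2 * (l.countP fun x => decide (x = v)) + (if c.1 = v then (c.2 : ℤ) else -c.2) →
      (l.foldl (fun (c : ℂ × ℕ) w =>
        if c.2 = 0 then (w, 1)
        else if w = c.1 then (c.1, c.2 + 1) else (c.1, c.2 - 1)) c).1 = v := by
    intro l
    induction l with
    | nil =>
      intro c hc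
      simp only [List.length_nil, List.countP_nil, List.foldl_nil] at hc ⊢
      by_contra hcv
      rw [if_neg hcv] at hc
      omega
    | cons w l ih =>
      intro c hc
      rw [List.foldl_cons]
      apply ih
      simp only [List.length_cons, List.countP_cons, decide_eq_true_eq] at hc
      by_cases h0 : c.2 = 0
      · simp only [h0, if_true] at hc ⊢
        split_ifs at hc ⊢ <;> push_cast at hc ⊢ <;> omega
      · simp only [h0, if_false]
        by_cases hw : w = c.1
        · simp only [hw, if_true] at hc ⊢
          split_ifs at hc ⊢ <;> push_cast at hc ⊢ <;> omega
        · simp only [hw, if_false]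
          by_cases hcv : c.1 = v
          · have : w ≠ v := fun h => hw (h.trans hcv.symm)
            simp only [hcv, this, if_true, if_false] at hc ⊢
            push_cast at hc ⊢
            omega
          · simp only [hcv, if_false] at hc ⊢
            split_ifs at hc <;> push_cast at hc ⊢ <;> omega
  have h2 : l.length = l.countP (fun c => decide (c = v)) + l.countP fun c => decide (c ≠ v) := by
    rw [List.length_eq_countP_add_countP (fun c => decide (c = v))]
    congr 1
    exact List.countP_congr (by simp)
  have := key l (0, 0) (by
    simp only [Nat.cast_zero, neg_zero, ite_self, add_zero]
    omega)
  convert this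

lemma cost_mark (sel : List ℕ) (fl : ℕ → Bool) : (mark sel fl).cost = sel.length * 3 :=
  cost_foldT_charge _ _ _ _

lemma val_mark (sel : List ℕ) (fl : ℕ → Bool) (j : ℕ) :
    (mark sel fl).val j = true ↔ fl j = true ∨ j ∈ sel := by
  simp only [mark, val_foldT, val_charge]
  induction sel generalizing fl with
  | nil => simp
  | cons i sel ih =>
    rw [List.foldl_cons, ih, List.mem_cons, Function.update_apply]
    split_ifs with h
    · simp [h]
    · simp [h]

lemma val_foldT_flags {α : Type} (l : List α) {step : (ℕ → Bool) → α → Timed (ℕ → Bool)}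
    {S : α → ℕ → Prop}
    (h : ∀ fl, ∀ a ∈ l, ∀ j, (step fl a).val j = true ↔ fl j = true ∨ S a j) (fl : ℕ → Bool)
    (j : ℕ) : (foldT l fl step).val j = true ↔ fl j = true ∨ ∃ a ∈ l, S a j := by
  induction l generalizing fl with
  | nil => simp [foldT]
  | cons a l ih =>
    simp only [foldT]
    rw [ih (fun fl a ha => h fl a (List.mem_cons_of_mem _ ha)), h fl a List.mem_cons_self]
    simp [or_assoc]

section marked
variable {α : Type} (l : List α) (fl : ℕ → Bool)

lemma val_marked : (marked l fl).val = (l.zipIdx.filter fun x => fl x.2).map Prod.fst := rfl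

lemma marked_sublist : (marked l fl).val.Sublist l := by
  rw [val_marked]
  conv_rhs => rw [← List.zipIdx_map_fst 0 l]
  exact List.filter_sublist.map _

lemma cost_marked_le : (marked l fl).cost ≤ 7 * l.length := by
  simp only [marked, cost_bind, cost_filterT_charge, cost_mapT_charge, List.length_zipIdx]
  have : (filterT l.zipIdx fun x => charge 3 (fl x.2)).val.length ≤ l.length :=
    (List.length_filter_le _ _).trans_eq (List.length_zipIdx)
  omega

lemma length_marked_le {T : Finset ℕ} (hT : ∀ j, fl j = true → j ∈ T) :
    (marked l fl).val.length ≤ T.card := by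
  classical
  have h1 : (marked l fl).val.length = ((l.zipIdx.map Prod.snd).filter fl).length := by
    rw [val_marked, List.length_map, List.filter_map, List.length_map]
    rfl
  rw [h1, List.zipIdx_map_snd,
    ← List.toFinset_card_of_nodup ((List.nodup_range' (n := l.length) 1).filter fl)]
  refine Finset.card_le_card fun j hj => hT j ?_
  simpa using (List.mem_filter.1 (List.mem_toFinset.1 hj)).2

lemma mem_marked {l : List α} {fl : ℕ → Bool} {p : α → Prop}
    (h : ∀ j, fl j = true ↔ ∃ a, (a, j) ∈ l.zipIdx ∧ p a) (a : α) :
    a ∈ (marked l fl).val ↔ a ∈ l ∧ p a := by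
  rw [val_marked, List.mem_map]
  constructor
  · rintro ⟨⟨a', j⟩, h1, rfl⟩
    obtain ⟨h2, h3⟩ := List.mem_filter.1 h1
    obtain ⟨b, h4, h5⟩ := (h j).1 h3
    have : a' = b := by
      have e1 := List.mk_mem_zipIdx_iff_getElem?.1 h2
      have e2 := List.mk_mem_zipIdx_iff_getElem?.1 h4
      exact Option.some.inj (e1.symm.trans e2)
    subst this
    refine ⟨?_, h5⟩
    rw [← List.zipIdx_map_fst 0 l]
    exact List.mem_map.2 ⟨_, h2, rfl⟩
  · rintro ⟨h1, h2⟩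
    rw [← List.zipIdx_map_fst 0 l] at h1
    obtain ⟨⟨a', j⟩, h3, rfl⟩ := List.mem_map.1 h1
    exact ⟨(a', j), List.mem_filter.2 ⟨h3, (h j).2 ⟨a', h3, h2⟩⟩, rfl⟩

end marked

end USFFT

/-! ### Dependence on the samples only -/

namespace USFFT

open Timed

namespace Timed
variable {α β : Type}

lemma bind_congr_val {x : Timed α} {f f' : α → Timed β} (h : f x.val = f' x.val) :
    x >>= f = x >>= f' := by
  change (⟨_, _⟩ : Timed β) = ⟨_, _⟩
  rw [h]

lemma tabulateFin_congr {n : ℕ} {f f' : Fin n → Timed α} (h : ∀ i, f i = f' i) :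
    tabulateFin f = tabulateFin f' := by
  rw [funext h]

end Timed

variable {d G : ℕ}

/-- One pass of the dimension-incremental loop of the usFFT: from the frequencies `I` in the
coordinates before `a.1` and the components `a.2` in the coordinate `a.1`, find the frequencies in
the coordinates up to `a.1`. -/
noncomputable def extend (Γ : Finset (Fin d → ℤ)) (s : ℕ) (θ : ℝ) (P : Params)
    (ω : Randomness d P) (f : Fin G → UnitAddTorus (Fin d) → ℂ) (I : List (Fin d → ℤ))
    (a : Fin d × List ℤ) : Timed (List (Fin d → ℤ)) := do
  let J ← candidates Γ a.1 I a.2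
  if (a.1 : ℕ) = 0 then pure J else couple s θ P ω f a.1 J

lemma usFFT_eq (Γ : Finset (Fin d → ℤ)) (s : ℕ) (θ : ℝ) (P : Params)
    (ω : Randomness d P) (f : Fin G → UnitAddTorus (Fin d) → ℂ) :
    usFFT Γ s θ P ω f =
      (mapT (List.finRange d) fun t => do
        let A ← singleComponent Γ θ P ω f t
        charge 1 (t, A)) >>= fun comps =>
      foldT comps [(0 : Fin d → ℤ)] (extend Γ s θ P ω f) >>= fun I =>
      coefficients P ω f I := rfl

variable {Γ : Finset (Fin d → ℤ)} {P : Params} {ω : Randomness d P}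
  {f f' : Fin G → UnitAddTorus (Fin d) → ℂ}

lemma singleComponent_congr (θ : ℝ) {t : Fin d}
    (h : ∀ g i, ∀ n < width Γ t + 1, f g (coordNode (ω.1 t i) t (width Γ t + 1) n) =
      f' g (coordNode (ω.1 t i) t (width Γ t + 1) n)) :
    singleComponent Γ θ P ω f t = singleComponent Γ θ P ω f' t := by
  unfold singleComponent
  refine congrArg (· >>= _) ?_
  refine foldT_congr (fun fl i _ => ?_) _
  refine bind_congr_val (bind_congr_val ?_)
  refine foldT_congr (fun fl g _ => ?_) _
  refine congrArg (· >>= _) ?_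
  refine tabulate_congr fun n hn => ?_
  rw [val_tabulate _ _ hn, val_charge, val_charge, h g i n hn]

lemma couple_congr (s : ℕ) (θ : ℝ) {t : Fin d} (J : List (Fin d → ℤ))
    (h : ∀ g, ∀ i ∈ iterations P t, ∀ l, ∀ n < P.M,
      f g (prefixNode (ω.2.1 t i) t (ω.2.2.1 t i l) n) =
        f' g (prefixNode (ω.2.1 t i) t (ω.2.2.1 t i l) n)) :
    couple s θ P ω f t J = couple s θ P ω f' t J := by
  unfold couple
  refine congrArg (· >>= _) ?_
  refine foldT_congr (fun fl i hi => ?_) _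
  refine bind_congr_val (bind_congr_val ?_)
  refine foldT_congr (fun fl g _ => ?_) _
  refine congrArg (· >>= _) ?_
  refine mapT_congr fun a ha => ?_
  simp only [val_mapT, val_bind, val_charge, List.mem_map] at ha
  obtain ⟨l, -, rfl⟩ := ha
  refine congrArg (· >>= _) ?_
  refine tabulate_congr fun n hn => ?_
  dsimp only
  rw [val_tabulate _ _ hn, val_charge, h g i hi l n hn]

lemma coefficients_congr (I : List (Fin d → ℤ))
    (h : ∀ g l, ∀ n < P.Mfin, f g (latticePoint (ω.2.2.2 l) n) =
      f' g (latticePoint (ω.2.2.2 l) n)) :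
    coefficients P ω f I = coefficients P ω f' I := by
  unfold coefficients
  refine bind_congr_val ?_
  refine tabulateFin_congr fun g => ?_
  refine congrArg (· >>= _) ?_
  refine mapT_congr fun a ha => ?_
  simp only [val_mapT, val_bind, val_charge, List.mem_map] at ha
  obtain ⟨l, -, rfl⟩ := ha
  refine congrArg (· >>= _) ?_
  refine tabulate_congr fun n hn => ?_
  dsimp only
  rw [val_tabulate _ _ hn, val_charge, h g l n hn]

/-- The output of the usFFT and its cost depend on the polynomials only through the samples. -/
lemma usFFT_congr (s : ℕ) (θ : ℝ) (h : ∀ g, ∀ x ∈ samplingSet Γ P ω, f g x = f' g x) :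
    usFFT Γ s θ P ω f = usFFT Γ s θ P ω f' := by
  classical
  have h1 : (mapT (List.finRange d) fun t => do
        let A ← singleComponent Γ θ P ω f t
        charge 1 (t, A)) = (mapT (List.finRange d) fun t => do
        let A ← singleComponent Γ θ P ω f' t
        charge 1 (t, A)) := by
    refine mapT_congr fun t _ => ?_
    rw [singleComponent_congr]
    intro g i n hn
    refine h g _ ?_
    simp only [samplingSet, Finset.mem_union, Finset.mem_biUnion, Finset.mem_image,
      Finset.mem_univ, true_and, Finset.mem_range]
    exact Or.inl (Or.inl ⟨t, i, n, hn, rfl⟩)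
  have h2 : extend Γ s θ P ω f = extend Γ s θ P ω f' := by
    funext I a
    unfold extend
    refine bind_congr_val ?_
    split_ifs with ha
    · rfl
    refine couple_congr _ _ _ fun g i hi l n hn => h g _ ?_
    simp only [samplingSet, Finset.mem_union, Finset.mem_biUnion, Finset.mem_image,
      Finset.mem_univ, true_and, Finset.mem_range, Finset.mem_filter, List.mem_toFinset]
    exact Or.inl (Or.inr ⟨a.1, Nat.pos_of_ne_zero ha, i, hi, l, n, hn, rfl⟩)
  have h3 : coefficients P ω f = coefficients P ω f' := by
    funext I
    refine coefficients_congr _ fun g l n hn => h g _ ?_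
    simp only [samplingSet, Finset.mem_union, Finset.mem_biUnion, Finset.mem_image,
      Finset.mem_univ, true_and, Finset.mem_range]
    exact Or.inr ⟨l, n, hn, rfl⟩
  rw [usFFT_eq, usFFT_eq, h1, h2, h3]

end USFFT

/-! ### Arithmetic cost -/

namespace USFFT

open Timed

variable {d G : ℕ} {Γ : Finset (Fin d → ℤ)} {P : Params} {ω : Randomness d P}
  {f : Fin G → UnitAddTorus (Fin d) → ℂ}

lemma sub_le_width {k l : Fin d → ℤ} (hk : k ∈ Γ) (hl : l ∈ Γ) (t : Fin d) :
    k t - l t ≤ width Γ t := by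
  have h1 : (k t - l t).toNat ≤ Γ.sup fun l => (k t - l t).toNat :=
    Finset.le_sup (f := fun l => (k t - l t).toNat) hl
  have h2 : (Γ.sup fun l => (k t - l t).toNat) ≤ width Γ t :=
    Finset.le_sup (f := fun k => Γ.sup fun l => (k t - l t).toNat) hk
  have h3 := Int.self_le_toNat (k t - l t)
  omega

lemma width_le_maxWidth (Γ : Finset (Fin d → ℤ)) (t : Fin d) : width Γ t ≤ maxWidth Γ :=
  Finset.le_sup (f := fun t => width Γ t) (Finset.mem_univ t)

lemma mem_projCoord {t : Fin d} {a : ℤ} : a ∈ projCoord Γ t ↔ ∃ k ∈ Γ, k t = a := by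
  simp [projCoord]

lemma nodup_projCoord (Γ : Finset (Fin d → ℤ)) (t : Fin d) : (projCoord Γ t).Nodup :=
  Finset.sort_nodup _ _

lemma length_projCoord_le (Γ : Finset (Fin d → ℤ)) (t : Fin d) :
    (projCoord Γ t).length ≤ width Γ t + 1 := by
  rw [projCoord, Finset.length_sort]
  rcases Γ.eq_empty_or_nonempty with rfl | hΓ
  · simp
  obtain ⟨l, hl, hmin⟩ := Γ.exists_min_image (fun k => k t) hΓ
  have : Γ.image (fun k => k t) ⊆ Finset.Icc (l t) (l t + width Γ t) := by
    intro a ha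
    obtain ⟨k, hk, rfl⟩ := Finset.mem_image.1 ha
    rw [Finset.mem_Icc]
    have := sub_le_width hk hl t
    exact ⟨hmin k hk, by omega⟩
  refine (Finset.card_le_card this).trans ?_
  rw [Int.card_Icc]
  omega

lemma length_singleComponent_le (θ : ℝ) (t : Fin d) :
    (singleComponent Γ θ P ω f t).val.length ≤ width Γ t + 1 :=
  (marked_sublist _ _).length_le.trans (length_projCoord_le Γ t)

lemma cost_singleComponent_le (θ : ℝ) (t : Fin d) {c : ℕ} (hd : 1 ≤ d) (hG : 1 ≤ G)
    (hr : 1 ≤ P.r) (hc : Nat.clog 2 (2 * (width Γ t + 1)) ≤ c) :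
    (singleComponent Γ θ P ω f t).cost ≤ 470 * (P.r * G * (width Γ t + 1) * c * d) := by
  set K := width Γ t + 1 with hK
  have hK1 : 1 ≤ K := by omega
  have hcand : (projCoord Γ t).length ≤ K := length_projCoord_le Γ t
  have hc1 : 1 ≤ c := (Nat.clog_pos one_lt_two (by omega)).trans_le hc
  have hc2 : Nat.clog 2 (projCoord Γ t).length ≤ c :=
    (Nat.clog_mono_right 2 (by omega)).trans hc
  have hKc : K ≤ K * c := Nat.le_mul_of_pos_right _ hc1
  unfold singleComponent
  rw [cost_bind]
  have hm := fun fl => cost_marked_le (projCoord Γ t) fl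
  have hfold : ∀ b : ℕ → Bool, _ ≤ (List.finRange P.r).length * ((d + K * (d + 5) +
      G * (450 * (K * c) + 1)) + 1) := cost_foldT_le (f := fun flags i => do
    let x ← charge d (ω.1 t i)
    let X ← tabulate K fun n => charge (d + 4) (coordNode x t K n)
    foldT (List.finRange G) flags fun flags g => do
      let y ← tabulate K fun n => charge 3 (f g (X n))
      let c ← fft K y
      let est ← mapT (projCoord Γ t).zipIdx fun k =>
        charge 6 (k.2, c (k.1 % (K : ℤ)).toNat)
      let sel ← largest P.sLoc θ est
      mark sel flags) (c := d + K * (d + 5) + G * (450 * (K * c) + 1)) fun fl i _ => by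
    simp only [cost_bind, cost_charge, val_charge, cost_tabulate_charge]
    have := cost_foldT_le (l := List.finRange G) (c := 450 * (K * c)) (f := fun flags g => do
      let y ← tabulate K fun n => charge 3 (f g ((tabulate K fun n =>
        charge (d + 4) (coordNode (ω.1 t i) t K n)).val n))
      let c ← fft K y
      let est ← mapT (projCoord Γ t).zipIdx fun k =>
        charge 6 (k.2, c (k.1 % (K : ℤ)).toNat)
      let sel ← largest P.sLoc θ est
      mark sel flags) (fun fl g _ => by
        simp only [cost_bind, cost_tabulate_charge, cost_mapT_charge, List.length_zipIdx,
          cost_mark]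
        refine (Nat.add_le_add_left (Nat.add_le_add (cost_fft_le hK1 _) (Nat.add_le_add_left
          (Nat.add_le_add (cost_largest_le _ _ _) (Nat.mul_le_mul_right _
            (length_largest_le _ _ _))) _)) _).trans ?_
        simp only [val_mapT, List.length_map, List.length_zipIdx]
        have e1 : 400 * K * Nat.clog 2 (2 * K) ≤ 400 * K * c := Nat.mul_le_mul_left _ hc
        have e2 : 20 * (projCoord Γ t).length * Nat.clog 2 (projCoord Γ t).length ≤ 20 * K * c := by
          gcongr
        have e3 : min P.sLoc (projCoord Γ t).length ≤ K := (min_le_right _ _).trans hcand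
        have e4 : 20 * K * c = 20 * (K * c) := mul_assoc _ _ _
        have e5 : 400 * K * c = 400 * (K * c) := mul_assoc _ _ _
        omega) fl
    rw [List.length_finRange] at this
    rw [add_assoc d (K * (d + 5))]
    exact Nat.add_le_add_left (Nat.add_le_add_left this _) _
  refine (Nat.add_le_add (hfold _) (hm _)).trans ?_
  rw [List.length_finRange]
  have hGd : 1 ≤ G * d := Nat.mul_pos hG hd
  have hX : K * c ≤ G * (K * c) * d := by nlinarith
  have e1 : d ≤ G * (K * c) * d := Nat.le_mul_of_pos_left _ (by positivity)
  have e2 : K * d ≤ G * (K * c) * d := by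
    refine Nat.mul_le_mul_right _ (hKc.trans ?_)
    exact Nat.le_mul_of_pos_left _ hG
  have e3 : K ≤ K * d := Nat.le_mul_of_pos_right _ hd
  have e4 : G * (K * c) ≤ G * (K * c) * d := Nat.le_mul_of_pos_right _ hd
  have e5 : G ≤ G * (K * c) := Nat.le_mul_of_pos_right _ (by positivity)
  have e6 : d + K * (d + 5) + G * (450 * (K * c) + 1) + 1 + 7 * K ≤ 470 * (G * (K * c) * d) := by
    have : K * (d + 5) = K * d + 5 * K := by ring
    have : G * (450 * (K * c) + 1) = 450 * (G * (K * c)) + G := by ring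
    omega
  have e7 : 7 * (projCoord Γ t).length ≤ P.r * (7 * K) :=
    (Nat.mul_le_mul_left 7 hcand).trans (Nat.le_mul_of_pos_left _ hr)
  calc _ ≤ P.r * (d + K * (d + 5) + G * (450 * (K * c) + 1) + 1 + 7 * K) := by
        rw [mul_add P.r _ (7 * K)]; omega
    _ ≤ P.r * (470 * (G * (K * c) * d)) := Nat.mul_le_mul_left _ e6
    _ = _ := by ring

lemma cost_candidates_le (t : Fin d) (I : List (Fin d → ℤ)) (A : List ℤ) {R K : ℕ}
    (hI : I.length ≤ R) (hA : A.length ≤ K) (hK : 1 ≤ K) (hd : 1 ≤ d) :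
    (candidates Γ t I A).cost ≤ 8 * (d * R * K) + R * K := by
  have h1 : (flatMapT I fun k => mapT A fun a => charge (d + 2) (Function.update k t a)).val.length
      = I.length * A.length := by
    simp [List.length_flatMap]
  have h2 : (flatMapT I fun k => mapT A fun a => charge (d + 2) (Function.update k t a)).cost =
      I.length * (A.length * (d + 3) + A.length + 1) := by
    simp [flatMapT, mapT]
  unfold candidates
  rw [cost_bind, cost_filterT_charge, h1, h2]
  have e1 : I.length * A.length ≤ R * K := Nat.mul_le_mul hI hA
  have e2 : I.length ≤ R * K := hI.trans (Nat.le_mul_of_pos_right _ hK)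
  have e3 : I.length * A.length * d ≤ R * K * d := Nat.mul_le_mul_right _ e1
  have e4 : R * K ≤ R * K * d := Nat.le_mul_of_pos_right _ hd
  have e5 : d * R * K = R * K * d := by ring
  have e6 : I.length * (A.length * (d + 3) + A.length + 1) + I.length * A.length * (d + 1 + 1) =
      2 * (I.length * A.length * d) + 6 * (I.length * A.length) + I.length := by ring
  omega

lemma length_candidates_le (t : Fin d) (I : List (Fin d → ℤ)) (A : List ℤ) :
    (candidates Γ t I A).val.length ≤ I.length * A.length := by
  refine (List.length_filter_le _ _).trans_eq ?_
  simp [List.length_flatMap]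

lemma cost_randomLattices_le {M c : ℕ} (m : ℕ) (θ : ℝ) (J : List (Fin d → ℤ))
    (lat : List ((Fin d → Fin M) × (ℕ → ℂ))) (hd : 1 ≤ d) (hL : 1 ≤ lat.length) (hM : 1 ≤ M)
    (hc : Nat.clog 2 (2 * M) ≤ c) (hc' : Nat.clog 2 J.length ≤ c) :
    (randomLattices m θ J lat).cost ≤
      405 * (lat.length * (M * c)) + 48 * (J.length * (lat.length * d + c)) := by
  have hc1 : 1 ≤ c := (Nat.clog_pos one_lt_two (by omega)).trans_le hc
  unfold randomLattices
  rw [cost_bind, cost_bind]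
  have h1 := cost_mapT_le (l := lat) (c := 400 * (M * c) + 2) (f := fun a => do
    let c ← fft M a.2
    charge 2 (a.1, c)) (fun a _ => by
      rw [cost_bind, cost_charge]
      have := cost_fft_le hM a.2
      have e1 : 400 * M * Nat.clog 2 (2 * M) ≤ 400 * M * c := Nat.mul_le_mul_left _ hc
      rw [mul_assoc 400 M c] at e1
      omega)
  set F := (mapT lat fun a => do
    let c ← fft M a.2
    charge 2 (a.1, c)) with hF
  have hFl : F.val.length = lat.length := by simp [hF]
  have h2 := cost_mapT_le (l := J.zipIdx) (c := lat.length * (2 * d + 12) + 3) (f := fun k => do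
    let vals ← mapT F.val fun a => charge (2 * d + 4) (a.2 (residue k.1 a.1))
    let c ← majority vals
    charge 2 (k.2, c)) (fun k _ => by
      simp only [cost_bind, cost_charge, cost_mapT_charge, cost_majority, val_mapT, List.length_map,
        hFl]
      have : lat.length * (2 * d + 12) = lat.length * (2 * d + 4 + 1) + lat.length * 7 := by ring
      omega)
  refine (Nat.add_le_add h1 (Nat.add_le_add h2 (cost_largest_le _ _ _))).trans ?_
  simp only [val_mapT, List.length_map, List.length_zipIdx]
  set L := lat.length
  set j := J.length
  have e1 : 20 * j * Nat.clog 2 j ≤ 20 * j * c := Nat.mul_le_mul_left _ hc'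
  have e2 : 1 ≤ M * c := Nat.mul_pos hM hc1
  have e3 : L ≤ L * (M * c) := Nat.le_mul_of_pos_right _ e2
  have e4 : L ≤ L * d := Nat.le_mul_of_pos_right _ hd
  have e5 : j * (L * (2 * d + 12) + 3 + 1) + 8 * j ≤ j * (26 * (L * d)) := by
    rw [mul_comm 8 j, ← mul_add]
    refine Nat.mul_le_mul_left _ ?_
    have : L * (2 * d + 12) = 2 * (L * d) + 12 * L := by ring
    omega
  have e6 : j * (26 * (L * d)) = 26 * (j * (L * d)) := by ring
  have e7 : 20 * j * c = 20 * (j * c) := mul_assoc _ _ _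
  have e8 : L * (400 * (M * c) + 2 + 1) = 400 * (L * (M * c)) + 3 * L := by ring
  have e9 : j * (L * d + c) = j * (L * d) + j * c := by ring
  omega

lemma length_iterations_le (P : Params) (t : Fin d) : (iterations P t).length ≤ P.r := by
  unfold iterations
  exact (List.length_take_le' _ _).trans_eq (List.length_finRange)

lemma cost_couple_le (s : ℕ) (θ : ℝ) (t : Fin d) (J : List (Fin d → ℤ)) {c : ℕ} (hd : 1 ≤ d)
    (hG : 1 ≤ G) (hr : 1 ≤ P.r) (hL : 1 ≤ P.L) (hc : Nat.clog 2 (2 * P.M) ≤ c)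
    (hc' : Nat.clog 2 J.length ≤ c) :
    (couple s θ P ω f t J).cost ≤
      P.r * G * (430 * (d * P.L * P.M * c) + 60 * (J.length * (P.L * d + c))) := by
  have hM : 1 ≤ P.M := P.M_prime.one_lt.le
  have hc1 : 1 ≤ c := (Nat.clog_pos one_lt_two (by omega)).trans_le hc
  set j := J.length with hj
  unfold couple
  rw [cost_bind]
  refine (Nat.add_le_add (cost_foldT_le (c := d + P.L * (d + P.M * (4 * d + 2) + 2) +
    G * (P.L * (P.M * 4 + 2) + (405 * (P.L * (P.M * c)) + 48 * (j * (P.L * d + c))) + 3 * j + 1))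
    (fun fl i _ => ?_) _) (cost_marked_le _ _)).trans ?_
  · rw [cost_bind, cost_bind, cost_charge, val_charge, add_assoc]
    refine Nat.add_le_add_left (Nat.add_le_add ?_ ?_) _
    · refine (cost_mapT_le (c := d + P.M * (4 * d + 2) + 1) fun l _ => ?_).trans ?_
      · simp only [cost_bind, cost_charge, val_charge, cost_tabulate_charge, add_assoc,
          Nat.reduceAdd]
        omega
      · rw [List.length_finRange]
    · refine (cost_foldT_le (c := P.L * (P.M * 4 + 2) + (405 * (P.L * (P.M * c)) +
        48 * (j * (P.L * d + c))) + 3 * j) (fun fl g _ => ?_) _).trans ?_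
      · rw [cost_bind, cost_bind, cost_mark, add_assoc]
        refine Nat.add_le_add ?_ (Nat.add_le_add ?_ ?_)
        · refine (cost_mapT_le (c := P.M * 4 + 1) fun l _ => ?_).trans ?_
          · simp only [cost_bind, cost_charge, cost_tabulate_charge]
            omega
          · simp
        · refine (cost_randomLattices_le _ _ _ _ hd ?_ hM hc hc').trans ?_
          · simpa using hL
          · simp [hj]
        · rw [mul_comm]
          refine Nat.mul_le_mul_left _ ?_
          unfold randomLattices
          rw [val_bind, val_bind]
          exact (length_largest_le _ _ _).trans ((min_le_right _ _).trans (by simp [hj]))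
      · rw [List.length_finRange]
  · set L := P.L
    set M := P.M
    have e0 := length_iterations_le P t
    have e1 : 7 * j ≤ P.r * (7 * j) := Nat.le_mul_of_pos_left _ hr
    refine (Nat.add_le_add (Nat.mul_le_mul_right _ e0) e1).trans ?_
    rw [← mul_add, mul_assoc]
    refine Nat.mul_le_mul_left _ ?_
    have hx : M ≤ M * c := Nat.le_mul_of_pos_right _ hc1
    have hy : L ≤ L * M := Nat.le_mul_of_pos_right _ hM
    have hz : L * M ≤ L * (M * c) := Nat.mul_le_mul_left _ hx
    have hw : L * (M * c) ≤ d * (L * (M * c)) := Nat.le_mul_of_pos_left _ hd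
    have h1 : d ≤ d * (L * M) := Nat.le_mul_of_pos_right _ (by positivity)
    have h2 : d * (L * M) ≤ d * (L * (M * c)) := Nat.mul_le_mul_left _ hz
    have h3 : L * d ≤ d * (L * M) := by rw [mul_comm]; exact Nat.mul_le_mul_left _ hy
    have h4 : d * (L * (M * c)) ≤ G * (d * (L * (M * c))) := Nat.le_mul_of_pos_left _ hG
    have h5 : j ≤ j * (L * d + c) := Nat.le_mul_of_pos_right _ (by omega)
    have h6 : j * (L * d + c) ≤ G * (j * (L * d + c)) := Nat.le_mul_of_pos_left _ hG
    have h7 : G * j ≤ G * (j * (L * d + c)) := Nat.mul_le_mul_left _ h5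
    have h8 : G * L ≤ G * (d * (L * (M * c))) := Nat.mul_le_mul_left _ (by omega)
    have h9 : G * (L * M) ≤ G * (d * (L * (M * c))) := Nat.mul_le_mul_left _ (by omega)
    have h10 : G * (L * (M * c)) ≤ G * (d * (L * (M * c))) := Nat.mul_le_mul_left _ (by omega)
    have h11 : G ≤ G * L := Nat.le_mul_of_pos_right _ hL
    have f1 : L * (d + M * (4 * d + 2) + 2) = L * d + 4 * (d * (L * M)) + 2 * (L * M) + 2 * L := by
      ring
    have f2 : G * (L * (M * 4 + 2) + (405 * (L * (M * c)) + 48 * (j * (L * d + c))) + 3 * j + 1) =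
      4 * (G * (L * M)) + 2 * (G * L) + 405 * (G * (L * (M * c))) + 48 * (G * (j * (L * d + c))) +
        3 * (G * j) + G := by ring
    have f3 : G * (430 * (d * L * M * c) + 60 * (j * (L * d + c))) =
      430 * (G * (d * (L * (M * c)))) + 60 * (G * (j * (L * d + c))) := by ring
    rw [f1, f2, f3]
    omega

lemma cost_coefficients_le (I : List (Fin d → ℤ)) {c : ℕ} (hd : 1 ≤ d) (hG : 1 ≤ G)
    (hL : 1 ≤ P.Lfin) (hc : Nat.clog 2 (2 * P.Mfin) ≤ c) :
    (coefficients P ω f I).cost ≤ 430 * (G * d * P.Lfin * (P.Mfin * c + I.length)) := by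
  have hM : 1 ≤ P.Mfin := P.Mfin_prime.one_lt.le
  have hc1 : 1 ≤ c := (Nat.clog_pos one_lt_two (by omega)).trans_le hc
  unfold coefficients
  rw [cost_bind]
  set L := P.Lfin with hLdef
  set M := P.Mfin with hMdef
  set n := I.length with hn
  refine (Nat.add_le_add (cost_mapT_le
    (c := d + M * (3 * d + 2) + 2 * M + n * (2 * d + 7) + 2) fun l _ => ?_)
    (cost_tabulateFin_le (c := L * (M * 4 + 400 * (M * c) + 3) + n * (L * (2 * d + 7) + 3))
      fun g => ?_)).trans ?_
  · simp only [cost_bind, cost_charge, val_charge, cost_tabulate_charge, cost_foldT_charge,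
      ← hMdef, ← hn, add_assoc, Nat.reduceAdd]
    omega
  · rw [cost_bind]
    refine Nat.add_le_add ((cost_mapT_le (c := M * 4 + 400 * (M * c) + 2) fun a _ => ?_).trans ?_)
      ((cost_mapT_le (c := L * (2 * d + 7) + 2) fun k _ => ?_).trans ?_)
    · simp only [cost_bind, cost_charge, cost_tabulate_charge, ← hMdef]
      have := cost_fft_le hM (tabulate M fun n => charge 3 (f g (a.2.1 n))).val
      have e1 : 400 * M * Nat.clog 2 (2 * M) ≤ 400 * M * c := Nat.mul_le_mul_left _ hc
      rw [mul_assoc 400 M c] at e1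
      omega
    · simp [hLdef]
    · simp only [cost_bind, cost_charge, cost_foldT_charge, val_mapT, List.length_map,
        List.length_finRange]
      rfl
    · rfl
  · rw [List.length_finRange]
    have hx : M ≤ M * c := Nat.le_mul_of_pos_right _ hc1
    have hy : L ≤ L * M := Nat.le_mul_of_pos_right _ hM
    have hz : L * M ≤ L * (M * c) := Nat.mul_le_mul_left _ hx
    have hw : L * (M * c) ≤ d * (L * (M * c)) := Nat.le_mul_of_pos_left _ hd
    have h2 : d * (L * M) ≤ d * (L * (M * c)) := Nat.mul_le_mul_left _ hz
    have h3 : d * L ≤ d * (L * M) := Nat.mul_le_mul_left _ hy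
    have h4 : d * (L * (M * c)) ≤ G * (d * (L * (M * c))) := Nat.le_mul_of_pos_left _ hG
    have h5 : L * n ≤ d * (L * n) := Nat.le_mul_of_pos_left _ hd
    have h6 : d * (L * n) ≤ G * (d * (L * n)) := Nat.le_mul_of_pos_left _ hG
    have h7 : G * (L * n) ≤ G * (d * (L * n)) := Nat.mul_le_mul_left _ h5
    have h8 : G * (L * M) ≤ G * (d * (L * (M * c))) := Nat.mul_le_mul_left _ (by omega)
    have h9 : G * (L * (M * c)) ≤ G * (d * (L * (M * c))) := Nat.mul_le_mul_left _ (by omega)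
    have h10 : G * L ≤ G * (L * M) := Nat.mul_le_mul_left _ hy
    have h11 : G ≤ G * L := Nat.le_mul_of_pos_right _ hL
    have h12 : G * n ≤ G * (L * n) := Nat.mul_le_mul_left _ (Nat.le_mul_of_pos_left _ hL)
    have f1 : L * (d + M * (3 * d + 2) + 2 * M + n * (2 * d + 7) + 2 + 1) =
      d * L + 3 * (d * (L * M)) + 4 * (L * M) + 2 * (d * (L * n)) + 7 * (L * n) + 3 * L := by ring
    have f2 : G * (L * (M * 4 + 400 * (M * c) + 3) + n * (L * (2 * d + 7) + 3) + 1) =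
      4 * (G * (L * M)) + 400 * (G * (L * (M * c))) + 3 * (G * L) + 2 * (G * (d * (L * n))) +
        7 * (G * (L * n)) + 3 * (G * n) + G := by ring
    have f3 : 430 * (G * d * L * (M * c + n)) =
      430 * (G * (d * (L * (M * c)))) + 430 * (G * (d * (L * n))) := by ring
    rw [f1, f2, f3]
    omega

end USFFT

namespace USFFT

open Timed

variable {d G : ℕ} {Γ : Finset (Fin d → ℤ)} {P : Params} {ω : Randomness d P}
  {f : Fin G → UnitAddTorus (Fin d) → ℂ}

/-- The labelled coefficient estimates of the candidates for the coordinate `t`, for the function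
number `g` in the detection iteration `i`. -/
noncomputable def coordEstimate (Γ : Finset (Fin d → ℤ)) (P : Params) (ω : Randomness d P)
    (f : Fin G → UnitAddTorus (Fin d) → ℂ) (t : Fin d) (i : Fin P.r) (g : Fin G) (a : ℤ) : ℂ :=
  (fft (width Γ t + 1) (tabulate (width Γ t + 1) fun n => charge 3 (f g
    ((tabulate (width Γ t + 1) fun n =>
      charge (d + 4) (coordNode (ω.1 t i) t (width Γ t + 1) n)).val n))).val).val
    (a % ((width Γ t + 1 : ℕ) : ℤ)).toNat

lemma singleComponent_eq_marked (θ : ℝ) (t : Fin d) :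
    ∃ fl : ℕ → Bool, (singleComponent Γ θ P ω f t).val = (marked (projCoord Γ t) fl).val ∧
      ∀ j, fl j = true ↔ ∃ i g, j ∈ (largest P.sLoc θ ((projCoord Γ t).zipIdx.map fun k =>
        (k.2, coordEstimate Γ P ω f t i g k.1))).val := by
  refine ⟨_, rfl, fun j => ?_⟩
  refine (val_foldT_flags (S := fun i j => ∃ g ∈ List.finRange G,
    j ∈ (largest P.sLoc θ ((projCoord Γ t).zipIdx.map fun k =>
        (k.2, coordEstimate Γ P ω f t i g k.1))).val) _ (fun fl i _ j => ?_) _ j).trans ?_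
  · refine val_foldT_flags (S := fun g j => j ∈ (largest P.sLoc θ
      ((projCoord Γ t).zipIdx.map fun k => (k.2, coordEstimate Γ P ω f t i g k.1))).val) _
      (fun fl g _ j => ?_) _ j
    exact val_mark _ _ _
  · simp

/-- The samples of the function number `g` along the lattices of the coupling detection number `i`
for the coordinates up to `t`, with the generating vectors. -/
noncomputable def latticeSamples (P : Params) (ω : Randomness d P)
    (f : Fin G → UnitAddTorus (Fin d) → ℂ) (t : Fin d) (i : Fin P.r) (g : Fin G) :
    List ((Fin d → Fin P.M) × (ℕ → ℂ)) :=
  (List.finRange P.L).map fun l => (ω.2.2.1 t i l, (tabulate P.M fun n => charge 3 (f g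
    ((tabulate P.M fun n =>
      charge (4 * d + 1) (prefixNode (ω.2.1 t i) t (ω.2.2.1 t i l) n)).val n))).val)

lemma couple_eq_marked (s : ℕ) (θ : ℝ) (t : Fin d) (J : List (Fin d → ℤ)) :
    ∃ fl : ℕ → Bool, (couple s θ P ω f t J).val = (marked J fl).val ∧
      ∀ j, fl j = true ↔ ∃ i ∈ iterations P t, ∃ g,
        j ∈ (randomLattices (if (t : ℕ) + 1 < d then P.sLoc else s) θ J
          (latticeSamples P ω f t i g)).val := by
  refine ⟨_, rfl, fun j => ?_⟩
  refine (val_foldT_flags (S := fun i j => ∃ g ∈ List.finRange G,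
    j ∈ (randomLattices (if (t : ℕ) + 1 < d then P.sLoc else s) θ J
          (latticeSamples P ω f t i g)).val) _ (fun fl i _ j => ?_) _ j).trans ?_
  · refine (val_foldT_flags (S := fun g j =>
      j ∈ (randomLattices (if (t : ℕ) + 1 < d then P.sLoc else s) θ J
          (latticeSamples P ω f t i g)).val) _ (fun fl g _ j => ?_) _ j)
    have h := val_mark (randomLattices (if (t : ℕ) + 1 < d then P.sLoc else s) θ J
          (latticeSamples P ω f t i g)).val fl j
    have hs : (mapT (mapT (List.finRange P.L) fun l => do
      let z ← charge d (ω.2.2.1 t i l)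
      let X ← tabulate P.M fun n => charge (4 * d + 1) (prefixNode (ω.2.1 t i) t z n)
      charge 1 (z, X)).val fun a => do
        let y ← tabulate P.M fun n => charge 3 (f g (a.2 n))
        charge 1 (a.1, y)).val = latticeSamples P ω f t i g := by
      simp only [latticeSamples, val_mapT, List.map_map]
      rfl
    rw [← hs] at h ⊢
    exact h
  · simp

/-! ### Lengths in the worst case -/

lemma length_marked_le_of_selections {ι κ : Type} [Fintype κ] (L : List ι) {α : Type} (l : List α)
    (fl : ℕ → Bool) (sel : ι → κ → List ℕ) {m : ℕ} (hm : ∀ i k, (sel i k).length ≤ m)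
    (h : ∀ j, fl j = true ↔ ∃ i ∈ L, ∃ k, j ∈ sel i k) :
    (marked l fl).val.length ≤ L.length * Fintype.card κ * m := by
  classical
  refine (length_marked_le l fl (T := L.toFinset.biUnion fun i => Finset.univ.biUnion fun k =>
    (sel i k).toFinset) fun j hj => ?_).trans ?_
  · simpa using (h j).1 hj
  · rw [mul_assoc]
    refine Finset.card_biUnion_le_card_mul _ _ _ (fun i _ => ?_) |>.trans
      (Nat.mul_le_mul_right _ (List.toFinset_card_le L))
    exact Finset.card_biUnion_le_card_mul _ _ _ fun k _ =>
      (List.toFinset_card_le _).trans (hm i k)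

lemma length_singleComponent_le_selections (θ : ℝ) (t : Fin d) :
    (singleComponent Γ θ P ω f t).val.length ≤ P.r * G * P.sLoc := by
  obtain ⟨fl, h1, h2⟩ := singleComponent_eq_marked (Γ := Γ) (P := P) (ω := ω) (f := f) θ t
  rw [h1]
  refine (length_marked_le_of_selections (List.finRange P.r) _ fl
    (fun i g => (largest P.sLoc θ ((projCoord Γ t).zipIdx.map fun k =>
        (k.2, coordEstimate Γ P ω f t i g k.1))).val) (m := P.sLoc)
    (fun i g => (length_largest_le _ _ _).trans (min_le_left _ _)) ?_).trans_eq (by simp)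
  simpa using h2

lemma length_couple_le {s : ℕ} (hs : s ≤ P.sLoc) (θ : ℝ) (t : Fin d) (J : List (Fin d → ℤ)) :
    (couple s θ P ω f t J).val.length ≤ P.r * G * P.sLoc := by
  obtain ⟨fl, h1, h2⟩ := couple_eq_marked (P := P) (ω := ω) (f := f) s θ t J
  rw [h1]
  refine (length_marked_le_of_selections (iterations P t) _ fl _ (m := P.sLoc)
    (fun i g => ?_) h2).trans ?_
  · unfold randomLattices
    rw [val_bind, val_bind]
    refine (length_largest_le _ _ _).trans ((min_le_left _ _).trans ?_)
    split_ifs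
    · rfl
    · exact hs
  · rw [Fintype.card_fin]
    gcongr
    exact length_iterations_le P t

/-! ### Total cost -/

/-- The cost of the usFFT, in terms of a bound `R` on the number of frequencies kept in each pass
of the dimension-incremental loop, derived from an invariant `Q` of that loop. -/
lemma cost_usFFT_le {s : ℕ} {θ : ℝ} {R N c : ℕ} (Q : ℕ → List (Fin d → ℤ) → Prop)
    (hQ0 : Q 0 [0])
    (hQ : ∀ (t : Fin d) I, Q t I →
      Q (t + 1) (extend Γ s θ P ω f I (t, (singleComponent Γ θ P ω f t).val)).val)
    (hlen : ∀ n I, Q n I → I.length ≤ R) (hN : ∀ t, width Γ t + 1 ≤ N) (hd : 1 ≤ d)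
    (hG : 1 ≤ G) (hr : 1 ≤ P.r) (hL : 1 ≤ P.L) (hLfin : 1 ≤ P.Lfin)
    (hcN : Nat.clog 2 (2 * N) ≤ c) (hcM : Nat.clog 2 (2 * P.M) ≤ c)
    (hcMfin : Nat.clog 2 (2 * P.Mfin) ≤ c) (hcJ : Nat.clog 2 (R * N) ≤ c) :
    (usFFT Γ s θ P ω f).cost ≤ d * (470 * (P.r * G * N * c * d) + 2) +
      d * (8 * (d * R * N) + R * N +
        P.r * G * (430 * (d * P.L * P.M * c) + 60 * (R * N * (P.L * d + c))) + 1) +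
      430 * (G * d * P.Lfin * (P.Mfin * c + R)) := by
  rw [usFFT_eq, cost_bind, cost_bind]
  have hval : (mapT (List.finRange d) fun t => do
        let A ← singleComponent Γ θ P ω f t
        charge 1 (t, A)).val =
      (List.finRange d).map fun t => (t, (singleComponent Γ θ P ω f t).val) := rfl
  have hloop := foldT_finRange_invariant (fun t => (singleComponent Γ θ P ω f t).val)
    (extend Γ s θ P ω f) Q (8 * (d * R * N) + R * N +
        P.r * G * (430 * (d * P.L * P.M * c) + 60 * (R * N * (P.L * d + c)))) hQ0
    (fun t I hI => ⟨hQ t I hI, ?_⟩)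
  · rw [hval, add_assoc]
    refine Nat.add_le_add ?_ (Nat.add_le_add hloop.2 ?_)
    · refine (cost_mapT_le (c := 470 * (P.r * G * N * c * d) + 1) fun t _ => ?_).trans ?_
      · rw [cost_bind, cost_charge]
        refine Nat.add_le_add_right ((cost_singleComponent_le θ t hd hG hr (c := c) ?_).trans ?_) _
        · exact (Nat.clog_mono_right 2 (Nat.mul_le_mul_left 2 (hN t))).trans hcN
        · gcongr
          exact hN t
      · rw [List.length_finRange]
    · refine (cost_coefficients_le _ hd hG hLfin hcMfin).trans ?_
      gcongr
      exact hlen _ _ hloop.1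
  · have hA := (length_singleComponent_le (P := P) (ω := ω) (f := f) (Γ := Γ) θ t).trans (hN t)
    have hJ : (candidates Γ t I (singleComponent Γ θ P ω f t).val).val.length ≤ R * N :=
      (length_candidates_le _ _ _).trans (Nat.mul_le_mul (hlen _ _ hI) hA)
    unfold extend
    rw [cost_bind]
    refine Nat.add_le_add (cost_candidates_le _ _ _ (hlen _ _ hI) hA (by have := hN t; omega) hd) ?_
    dsimp only
    split_ifs with h0
    · exact Nat.zero_le _
    · refine (cost_couple_le s θ t _ hd hG hr hL hcM
        ((Nat.clog_mono_right 2 hJ).trans hcJ)).trans ?_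
      gcongr

lemma cost_usFFT_le_worst {s : ℕ} {θ : ℝ} {N c : ℕ} (hs : s ≤ P.sLoc) (hs1 : 1 ≤ P.sLoc)
    (hN : ∀ t, width Γ t + 1 ≤ N) (hd : 1 ≤ d)
    (hG : 1 ≤ G) (hr : 1 ≤ P.r) (hL : 1 ≤ P.L) (hLfin : 1 ≤ P.Lfin)
    (hcN : Nat.clog 2 (2 * N) ≤ c) (hcM : Nat.clog 2 (2 * P.M) ≤ c)
    (hcMfin : Nat.clog 2 (2 * P.Mfin) ≤ c) (hcJ : Nat.clog 2 (P.r * G * P.sLoc * N) ≤ c) :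
    (usFFT Γ s θ P ω f).cost ≤ d * (470 * (P.r * G * N * c * d) + 2) +
      d * (8 * (d * (P.r * G * P.sLoc) * N) + (P.r * G * P.sLoc) * N +
        P.r * G * (430 * (d * P.L * P.M * c) +
          60 * ((P.r * G * P.sLoc) * N * (P.L * d + c))) + 1) +
      430 * (G * d * P.Lfin * (P.Mfin * c + (P.r * G * P.sLoc))) := by
  have hR : 1 ≤ P.r * G * P.sLoc := Nat.mul_pos (Nat.mul_pos hr hG) hs1
  refine cost_usFFT_le (fun n I => I.length ≤ P.r * G * P.sLoc ∧ (n = 0 → I = [0]))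
    ⟨by simpa using hR, fun _ => rfl⟩ (fun t I hI => ⟨?_, by omega⟩) (fun n I h => h.1) hN hd hG hr
    hL hLfin hcN hcM hcMfin hcJ
  unfold extend
  rw [val_bind]
  dsimp only
  split_ifs with h0
  · refine (length_candidates_le _ _ _).trans ?_
    rw [hI.2 h0]
    simpa using length_singleComponent_le_selections (Γ := Γ) (P := P) (ω := ω) (f := f) θ t
  · exact length_couple_le hs _ _ _

end USFFT

/-! ### Samples of trigonometric polynomials on lines and lattices -/

namespace USFFT

open Timed

variable {d : ℕ}

lemma fourier_div_eq_cis (m : ℤ) (a : ℝ) (c : ℤ) (ha : a = c) (n : ℕ) :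
    fourier m (((a / n : ℝ)) : UnitAddCircle) = cis (m * c) n := by
  rw [fourier_coe_apply, cis, ha]
  congr 1
  push_cast
  ring

lemma prod_cis {ι : Type*} (s : Finset ι) (a : ι → ℤ) (n : ℕ) :
    ∏ j ∈ s, cis (a j) n = cis (∑ j ∈ s, a j) n := by
  classical
  induction s using Finset.induction_on with
  | empty => simp [cis_zero]
  | insert i s hi ih => rw [Finset.prod_insert hi, Finset.sum_insert hi, cis_add, ih]

lemma mFourier_apply (k : Fin d → ℤ) (x : UnitAddTorus (Fin d)) :
    UnitAddTorus.mFourier k x = ∏ j, fourier (k j) (x j) := rfl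

lemma mFourier_coordNode (k : Fin d → ℤ) (x : UnitAddTorus (Fin d)) (t : Fin d) (K n : ℕ) :
    UnitAddTorus.mFourier k (coordNode x t K n) =
      UnitAddTorus.mFourier (Function.update k t 0) x * cis (k t * n) K := by
  rw [mFourier_apply, mFourier_apply, ← Finset.mul_prod_erase _ _ (Finset.mem_univ t),
    ← Finset.mul_prod_erase (a := t) Finset.univ (fun j => fourier _ (x j)) (Finset.mem_univ t),
    mul_comm _ (cis _ _)]
  congr 1
  · rw [coordNode, Function.update_self]
    exact fourier_div_eq_cis _ _ _ (by simp) _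
  · rw [Function.update_self, fourier_zero, one_mul]
    refine Finset.prod_congr rfl fun j hj => ?_
    have := Finset.ne_of_mem_erase hj
    rw [coordNode, Function.update_of_ne this, Function.update_of_ne this]

lemma mFourier_prefixNode {M : ℕ} (k : Fin d → ℤ) (x : UnitAddTorus (Fin d)) (t : Fin d)
    (z : Fin d → Fin M) (n : ℕ) :
    UnitAddTorus.mFourier k (prefixNode x t z n) =
      UnitAddTorus.mFourier (k - proj t k) x * cis ((∑ j, proj t k j * ((z j : ℕ) : ℤ)) * n) M := by
  rw [mFourier_apply, mFourier_apply, Finset.sum_mul, ← prod_cis, ← Finset.prod_mul_distrib]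
  refine Finset.prod_congr rfl fun j _ => ?_
  rw [prefixNode, Pi.sub_apply, proj]
  split_ifs with h
  · rw [sub_self, fourier_zero, one_mul, latticePoint,
      fourier_div_eq_cis _ _ ((n : ℤ) * ((z j : ℕ) : ℤ)) (by push_cast; ring)]
    congr 1
    ring
  · rw [zero_mul, zero_mul, cis_zero, mul_one, sub_zero]

lemma mFourier_latticePoint {M : ℕ} (k : Fin d → ℤ) (z : Fin d → Fin M) (n : ℕ) :
    UnitAddTorus.mFourier k (latticePoint z n) = cis ((∑ j, k j * ((z j : ℕ) : ℤ)) * n) M := by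
  rw [mFourier_apply, Finset.sum_mul, ← prod_cis]
  refine Finset.prod_congr rfl fun j _ => ?_
  rw [latticePoint, fourier_div_eq_cis _ _ ((n : ℤ) * ((z j : ℕ) : ℤ)) (by push_cast; ring)]
  congr 1
  ring

lemma residue_eq_iff {M : ℕ} (hM : M ≠ 0) (h k : Fin d → ℤ) (z : Fin d → Fin M) :
    residue h z = residue k z ↔
      (∑ j, h j * ((z j : ℕ) : ℤ)) % (M : ℤ) = (∑ j, k j * ((z j : ℕ) : ℤ)) % (M : ℤ) := by
  have h1 := Int.emod_nonneg (∑ j, h j * ((z j : ℕ) : ℤ)) (b := M) (by omega)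
  have h2 := Int.emod_nonneg (∑ j, k j * ((z j : ℕ) : ℤ)) (b := M) (by omega)
  unfold residue
  omega

/-- The Fourier coefficient of `x t ↦ ∑ k ∈ I, c k * exp (2 π i k · x)` for the frequency `a`, when
the other coordinates of `x` are fixed. -/
noncomputable def coordCoeff (I : Finset (Fin d → ℤ)) (c : (Fin d → ℤ) → ℂ) (t : Fin d) (a : ℤ)
    (x : UnitAddTorus (Fin d)) : ℂ :=
  ∑ k ∈ I.filter (fun k => k t = a), c k * UnitAddTorus.mFourier (Function.update k t 0) x

/-- The Fourier coefficient of `∑ k ∈ I, c k * exp (2 π i k · x)`, as a function of the coordinates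
of `x` up to `t`, for the frequency `h`, when the other coordinates of `x` are fixed. -/
noncomputable def prefixCoeff (I : Finset (Fin d → ℤ)) (c : (Fin d → ℤ) → ℂ) (t : Fin d)
    (h : Fin d → ℤ) (x : UnitAddTorus (Fin d)) : ℂ :=
  ∑ k ∈ I.filter (fun k => proj t k = h), c k * UnitAddTorus.mFourier (k - proj t k) x

variable {G : ℕ} {Γ : Finset (Fin d → ℤ)} {P : Params} {ω : Randomness d P}
  {I : Fin G → Finset (Fin d → ℤ)} {c : Fin G → (Fin d → ℤ) → ℂ} {s : ℕ} {θ : ℝ}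

/-- The one-dimensional FFTs are exact, since two frequency components in a projection of `Γ` never
alias modulo the number of nodes. -/
lemma coordEstimate_eq (hI : ∀ g, I g ⊆ Γ) (t : Fin d) (i : Fin P.r) (g : Fin G) {a : ℤ}
    (ha : a ∈ projCoord Γ t) :
    coordEstimate Γ P ω (fun g => trigPoly (I g) (c g)) t i g a =
      coordCoeff (I g) (c g) t a (ω.1 t i) := by
  unfold coordEstimate
  set K := width Γ t + 1 with hK
  rw [val_fft_of_expansion (n := K) (by omega) (I g)
    (fun k => c g k * UnitAddTorus.mFourier (Function.update k t 0) (ω.1 t i)) (fun k => k t)]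
  · refine Finset.sum_congr (Finset.filter_congr fun k hk => ?_) fun _ _ => rfl
    obtain ⟨k', hk', rfl⟩ := mem_projCoord.1 ha
    have h1 := sub_le_width hk' (hI g hk) t
    have h2 := sub_le_width (hI g hk) hk' t
    constructor
    · intro h
      obtain ⟨e, he⟩ := (Int.ModEq.dvd (h : k' t ≡ k t [ZMOD (K : ℕ)]))
      have : e = 0 := by
        by_contra hne
        rcases lt_or_gt_of_ne hne with h3 | h3
        · nlinarith
        · nlinarith
      subst this
      linarith
    · intro h
      rw [h]
  · intro n hn
    rw [val_tabulate _ _ hn, val_charge, val_tabulate _ _ hn, val_charge]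
    simp only [trigPoly]
    refine Finset.sum_congr rfl fun k _ => ?_
    rw [mFourier_coordNode, mul_assoc]

/-- The estimate of the coefficient of `h` from a single lattice is exact if `h` does not alias. -/
lemma val_fft_prefixNode (I : Finset (Fin d → ℤ)) (c : (Fin d → ℤ) → ℂ) {M : ℕ} (hM : M ≠ 0)
    (x : UnitAddTorus (Fin d)) (t : Fin d) (z : Fin d → Fin M) (y : ℕ → ℂ)
    (hy : ∀ n < M, y n = trigPoly I c (prefixNode x t z n)) (h : Fin d → ℤ)
    (hh : ∀ k ∈ I, residue h z = residue (proj t k) z → proj t k = h) :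
    (fft M y).val (residue h z) = prefixCoeff I c t h x := by
  unfold residue
  rw [val_fft_of_expansion hM I (fun k => c k * UnitAddTorus.mFourier (k - proj t k) x)
    (fun k => ∑ j, proj t k j * ((z j : ℕ) : ℤ))]
  · refine Finset.sum_congr (Finset.filter_congr fun k hk => ?_) fun _ _ => rfl
    rw [← residue_eq_iff hM]
    exact ⟨hh k hk, fun h => by rw [h]⟩
  · intro n hn
    rw [hy n hn, trigPoly]
    refine Finset.sum_congr rfl fun k _ => ?_
    rw [mFourier_prefixNode, mul_assoc]

open Classical in
lemma val_fft_latticePoint (I : Finset (Fin d → ℤ)) (c : (Fin d → ℤ) → ℂ) {M : ℕ} (hM : M ≠ 0)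
    (z : Fin d → Fin M) (y : ℕ → ℂ) (hy : ∀ n < M, y n = trigPoly I c (latticePoint z n))
    (h : Fin d → ℤ) (hh : ∀ k ∈ I, residue h z = residue k z → k = h) :
    (fft M y).val (residue h z) = if h ∈ I then c h else 0 := by
  unfold residue
  rw [val_fft_of_expansion hM I c (fun k => ∑ j, k j * ((z j : ℕ) : ℤ))]
  · rw [← Finset.sum_ite_eq' I h c, ← Finset.sum_filter]
    refine Finset.sum_congr (Finset.filter_congr fun k hk => ?_) fun _ _ => rfl
    rw [← residue_eq_iff hM]
    exact ⟨hh k hk, fun h => by rw [h]⟩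
  · intro n hn
    rw [hy n hn, trigPoly]
    refine Finset.sum_congr rfl fun k _ => ?_
    rw [mFourier_latticePoint]

/-! ### The good event and its consequences -/

/-- The first coordinates (before number `n`) of a frequency, the others being set to zero. -/
def trunc (n : ℕ) (k : Fin d → ℤ) : Fin d → ℤ := fun j => if (j : ℕ) < n then k j else 0

lemma proj_eq_trunc (t : Fin d) (k : Fin d → ℤ) : proj t k = trunc (t + 1) k := by
  funext j
  simp only [proj, trunc, Fin.le_def, Nat.lt_succ_iff]

lemma trunc_self (k : Fin d → ℤ) : trunc d k = k := by
  funext j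
  simp [trunc]

lemma trunc_zero (k : Fin d → ℤ) : trunc 0 k = 0 := by
  funext j
  simp [trunc]

lemma update_trunc (t : Fin d) (k : Fin d → ℤ) :
    Function.update (trunc t k) t (k t) = trunc (t + 1) k := by
  funext j
  rcases eq_or_ne j t with rfl | h
  · simp [trunc]
  · rw [Function.update_of_ne h]
    have : (j : ℕ) ≠ t := fun h' => h (Fin.ext h')
    simp only [trunc]
    congr 1
    apply propext
    omega

/-- The random numbers are good for the polynomials with the frequencies `I g` and the coefficients
`c g` if each frequency is visible above the threshold in at least one detection iteration of each
kind, if for all frequencies that may become candidates less than half of the lattices of each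
coupling detection alias, and if each frequency is alone in its residue class for at least one of
the final lattices. -/
structure Good (I : Fin G → Finset (Fin d → ℤ)) (c : Fin G → (Fin d → ℤ) → ℂ) (θ : ℝ)
    (P : Params) (ω : Randomness d P) : Prop where
  coord : ∀ t g, ∀ k ∈ I g, ∃ i, θ < ‖coordCoeff (I g) (c g) t (k t) (ω.1 t i)‖
  prefix_visible : ∀ t g, ∀ k ∈ I g, ∃ i,
    θ < ‖prefixCoeff (I g) (c g) t (proj t k) (ω.2.1 t i)‖
  vote : ∀ t i g, ∀ u ∈ Finset.univ.biUnion I, ∀ v ∈ Finset.univ.biUnion I,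
    2 * (Finset.univ.filter fun l : Fin P.L => ∃ k ∈ I g,
      proj t k ≠ Function.update (trunc t u) t (v t) ∧
      residue (Function.update (trunc t u) t (v t)) (ω.2.2.1 t i l) =
        residue (proj t k) (ω.2.2.1 t i l)).card < P.L
  isolated : ∀ k ∈ Finset.univ.biUnion I, ∃ l : Fin P.Lfin, ∀ k' ∈ Finset.univ.biUnion I,
    k' ≠ k → residue k' (ω.2.2.2 l) ≠ residue k (ω.2.2.2 l)

lemma coordCoeff_ne_zero {I : Finset (Fin d → ℤ)} {c : (Fin d → ℤ) → ℂ} {t : Fin d} {a : ℤ}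
    {x : UnitAddTorus (Fin d)} (h : coordCoeff I c t a x ≠ 0) : ∃ k ∈ I, k t = a := by
  obtain ⟨k, hk, -⟩ := Finset.exists_ne_zero_of_sum_ne_zero h
  exact ⟨k, Finset.mem_filter.1 hk⟩

lemma prefixCoeff_ne_zero {I : Finset (Fin d → ℤ)} {c : (Fin d → ℤ) → ℂ} {t : Fin d}
    {h : Fin d → ℤ} {x : UnitAddTorus (Fin d)} (hne : prefixCoeff I c t h x ≠ 0) :
    ∃ k ∈ I, proj t k = h := by
  obtain ⟨k, hk, -⟩ := Finset.exists_ne_zero_of_sum_ne_zero hne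
  exact ⟨k, Finset.mem_filter.1 hk⟩

lemma mem_singleComponent (hω : Good I c θ P ω) (hI : ∀ g, I g ⊆ Γ)
    (hcard : ∀ g, (I g).card ≤ P.sLoc) (hθ : 0 ≤ θ) (t : Fin d) (a : ℤ) :
    a ∈ (singleComponent Γ θ P ω (fun g => trigPoly (I g) (c g)) t).val ↔
      ∃ v ∈ Finset.univ.biUnion I, v t = a := by
  classical
  obtain ⟨fl, h1, h2⟩ := singleComponent_eq_marked (Γ := Γ) (P := P) (ω := ω)
    (f := fun g => trigPoly (I g) (c g)) θ t
  rw [h1, mem_marked (p := fun a => ∃ i g, θ < ‖coordCoeff (I g) (c g) t a (ω.1 t i)‖)]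
  · constructor
    · rintro ⟨-, i, g, h3⟩
      obtain ⟨k, hk, rfl⟩ := coordCoeff_ne_zero (norm_pos_iff.1 (hθ.trans_lt h3))
      exact ⟨k, Finset.mem_biUnion.2 ⟨g, Finset.mem_univ _, hk⟩, rfl⟩
    · rintro ⟨v, hv, rfl⟩
      obtain ⟨g, -, hv⟩ := Finset.mem_biUnion.1 hv
      obtain ⟨i, hi⟩ := hω.coord t g v hv
      exact ⟨mem_projCoord.2 ⟨v, hI g hv, rfl⟩, i, g, hi⟩
  · intro j
    rw [h2]
    have key : ∀ i g, j ∈ (largest P.sLoc θ ((projCoord Γ t).zipIdx.map fun k =>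
        (k.2, coordEstimate Γ P ω (fun g => trigPoly (I g) (c g)) t i g k.1))).val ↔
        ∃ a, (a, j) ∈ (projCoord Γ t).zipIdx ∧ θ < ‖coordCoeff (I g) (c g) t a (ω.1 t i)‖ := by
      intro i g
      rw [← mem_largest_zipIdx (m := P.sLoc) hθ (nodup_projCoord Γ t)
        (fun a => coordCoeff (I g) (c g) t a (ω.1 t i)) ((I g).image fun k => k t)
        (fun a _ ha => by simpa using coordCoeff_ne_zero ha)
        (Finset.card_image_le.trans (hcard g))]
      rw [List.map_congr_left fun k hk => ?_]
      rw [coordEstimate_eq hI t i g]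
      exact List.fst_mem_of_mem_zipIdx hk
    simp only [key]
    constructor
    · rintro ⟨i, g, a, ha, h⟩
      exact ⟨a, ha, i, g, h⟩
    · rintro ⟨a, ha, i, g, h⟩
      exact ⟨i, g, a, ha, h⟩

/-- With a non-aliasing majority of the lattices, the random rank-1 lattice method selects exactly
the candidates whose coefficient exceeds the threshold. -/
lemma mem_randomLattices {m : ℕ} (hθ : 0 ≤ θ) (t : Fin d) (i : Fin P.r) (g : Fin G)
    (hm : (I g).card ≤ m) {J : List (Fin d → ℤ)} (hJ : J.Nodup)
    (hvote : ∀ h ∈ J, 2 * (Finset.univ.filter fun l : Fin P.L => ∃ k ∈ I g, proj t k ≠ h ∧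
      residue h (ω.2.2.1 t i l) = residue (proj t k) (ω.2.2.1 t i l)).card < P.L) (j : ℕ) :
    j ∈ (randomLattices m θ J
      (latticeSamples P ω (fun g => trigPoly (I g) (c g)) t i g)).val ↔
      ∃ h, (h, j) ∈ J.zipIdx ∧ θ < ‖prefixCoeff (I g) (c g) t h (ω.2.1 t i)‖ := by
  classical
  rw [← mem_largest_zipIdx (m := m) hθ hJ (fun h => prefixCoeff (I g) (c g) t h (ω.2.1 t i))
    ((I g).image (proj t)) (fun a _ ha => by simpa using prefixCoeff_ne_zero ha)
    (Finset.card_image_le.trans hm)]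
  unfold randomLattices
  rw [val_bind, val_bind, val_mapT]
  rw [List.map_congr_left fun k hk => ?_]
  have hk' : k.1 ∈ J := List.fst_mem_of_mem_zipIdx hk
  simp only [val_bind, val_charge, val_mapT, latticeSamples, List.map_map]
  congr 1
  refine val_majority ?_
  simp only [List.length_map, List.length_finRange, List.countP_map]
  refine lt_of_le_of_lt (Nat.mul_le_mul_left 2 ?_) (hvote k.1 hk')
  rw [List.countP_eq_length_filter,
    ← List.toFinset_card_of_nodup ((List.nodup_finRange _).filter _)]
  refine Finset.card_le_card fun l hl => ?_
  simp only [List.mem_toFinset, List.mem_filter, List.mem_finRange, true_and, Function.comp_apply,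
    decide_eq_true_eq] at hl
  simp only [Finset.mem_filter, Finset.mem_univ, true_and]
  by_contra hcon
  push Not at hcon
  refine hl (val_fft_prefixNode _ _ P.M_prime.ne_zero _ t _ _ (fun n hn => ?_) _
    fun k' hk' hres => ?_)
  · rw [val_tabulate _ _ hn, val_charge, val_tabulate _ _ hn, val_charge]
  · by_contra hne
    exact hcon k' hk' hne hres

lemma nodup_candidates (t : Fin d) {I : List (Fin d → ℤ)} {A : List ℤ} (hI : I.Nodup)
    (hA : A.Nodup) (h0 : ∀ k ∈ I, k t = 0) : (candidates Γ t I A).val.Nodup := by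
  refine List.Nodup.filter _ ?_
  simp only [val_flatMapT, val_mapT, val_charge]
  refine List.nodup_flatMap.2 ⟨fun k _ => hA.map fun a b hab => ?_, ?_⟩
  · simpa using congrFun hab t
  · refine hI.imp_of_mem fun {k k'} hk hk' hne => ?_
    intro x hx hx'
    obtain ⟨a, -, rfl⟩ := List.mem_map.1 hx
    obtain ⟨b, -, hb⟩ := List.mem_map.1 hx'
    apply hne
    funext j
    rcases eq_or_ne j t with rfl | hj
    · rw [h0 k hk, h0 k' hk']
    · simpa [hj] using (congrFun hb j).symm

lemma mem_candidates (t : Fin d) (I : List (Fin d → ℤ)) (A : List ℤ) (h : Fin d → ℤ) :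
    h ∈ (candidates Γ t I A).val ↔
      (∃ k ∈ I, ∃ a ∈ A, Function.update k t a = h) ∧ ∃ k ∈ Γ, proj t k = h := by
  simp [candidates]

/-- The loop invariant of the dimension-incremental method on the good event: `L` lists, without
repetitions, the projections of the frequencies of all polynomials to the first `n` coordinates. For
`n = 0` the list consists of the empty frequency, even if all polynomials vanish. -/
def LoopInvariant (I : Fin G → Finset (Fin d → ℤ)) (n : ℕ) (L : List (Fin d → ℤ)) : Prop :=
  L.Nodup ∧ ∀ h, h ∈ L ↔ (n = 0 ∧ h = 0) ∨ ∃ u ∈ Finset.univ.biUnion I, trunc n u = h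

/-- One pass preserves the invariant: each candidate combines projections of true frequencies, so
the vote is reliable for it; it is kept only if its coefficient does not vanish identically, hence
if it is the projection of a frequency, and such a projection is kept since it is visible. -/
lemma loopInvariant_extend (hω : Good I c θ P ω) (hI : ∀ g, I g ⊆ Γ) (hs : s ≤ P.sLoc)
    (hcard : ∀ g, (I g).card ≤ s) (hθ : 0 ≤ θ) (hc : ∀ g, ∀ k ∈ I g, θ < ‖c g k‖)
    (hr : 1 ≤ P.r) (t : Fin d) {L : List (Fin d → ℤ)} (hL : LoopInvariant I t L) :
    LoopInvariant I (t + 1) (extend Γ s θ P ω (fun g => trigPoly (I g) (c g)) L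
      (t, (singleComponent Γ θ P ω (fun g => trigPoly (I g) (c g)) t).val)).val := by
  classical
  set A := (singleComponent Γ θ P ω (fun g => trigPoly (I g) (c g)) t).val with hAdef
  have hA : ∀ a, a ∈ A ↔ ∃ v ∈ Finset.univ.biUnion I, v t = a :=
    mem_singleComponent hω hI (fun g => (hcard g).trans hs) hθ t
  have hAn : A.Nodup := (marked_sublist _ _).nodup (nodup_projCoord Γ t)
  set J := (candidates Γ t L A).val with hJdef
  have hJn : J.Nodup := nodup_candidates t hL.1 hAn fun k hk => by
    rcases (hL.2 k).1 hk with ⟨-, rfl⟩ | ⟨u, -, rfl⟩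
    · rfl
    · simp [trunc]
  have hJ1 : ∀ u ∈ Finset.univ.biUnion I, trunc (t + 1) u ∈ J := by
    intro u hu
    refine (mem_candidates t L A _).2 ⟨⟨trunc t u, (hL.2 _).2 (Or.inr ⟨u, hu, rfl⟩), u t,
      (hA _).2 ⟨u, hu, rfl⟩, update_trunc t u⟩, u, ?_, proj_eq_trunc t u⟩
    obtain ⟨g, -, hg⟩ := Finset.mem_biUnion.1 hu
    exact hI g hg
  have hJ2 : ∀ h ∈ J, ∃ u ∈ Finset.univ.biUnion I, ∃ v ∈ Finset.univ.biUnion I,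
      Function.update (trunc t u) t (v t) = h := by
    intro h hh
    obtain ⟨⟨k, hk, a, ha, rfl⟩, -⟩ := (mem_candidates t L A _).1 hh
    obtain ⟨v, hv, rfl⟩ := (hA a).1 ha
    rcases (hL.2 k).1 hk with ⟨h0, rfl⟩ | ⟨u, hu, rfl⟩
    · exact ⟨v, hv, v, hv, by rw [h0, trunc_zero]⟩
    · exact ⟨u, hu, v, hv, rfl⟩
  unfold extend
  rw [val_bind]
  dsimp only
  split_ifs with h0
  · refine ⟨hJn, fun h => ⟨fun hh => Or.inr ?_, ?_⟩⟩
    · obtain ⟨u, -, v, hv, rfl⟩ := hJ2 h hh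
      refine ⟨v, hv, ?_⟩
      rw [← update_trunc, h0, trunc_zero, trunc_zero]
    · rintro (⟨h1, -⟩ | ⟨u, hu, rfl⟩)
      · omega
      · exact hJ1 u hu
  · obtain ⟨fl, h1, h2⟩ := couple_eq_marked (P := P) (ω := ω)
      (f := fun g => trigPoly (I g) (c g)) s θ t J
    refine ⟨by rw [h1]; exact (marked_sublist _ _).nodup hJn, fun h => ?_⟩
    rw [h1, mem_marked (p := fun h => ∃ i ∈ iterations P t, ∃ g,
      θ < ‖prefixCoeff (I g) (c g) t h (ω.2.1 t i)‖)]
    · constructor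
      · rintro ⟨-, i, -, g, h3⟩
        obtain ⟨k, hk, rfl⟩ := prefixCoeff_ne_zero (norm_pos_iff.1 (hθ.trans_lt h3))
        exact Or.inr ⟨k, Finset.mem_biUnion.2 ⟨g, Finset.mem_univ _, hk⟩, (proj_eq_trunc t k).symm⟩
      · rintro (⟨h1, -⟩ | ⟨u, hu, rfl⟩)
        · omega
        refine ⟨hJ1 u hu, ?_⟩
        obtain ⟨g, -, hg⟩ := Finset.mem_biUnion.1 hu
        by_cases htd : (t : ℕ) + 1 < d
        · obtain ⟨i, hi⟩ := hω.prefix_visible t g u hg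
          refine ⟨i, ?_, g, by rwa [← proj_eq_trunc]⟩
          rw [iterations, if_pos htd, List.take_of_length_le (by simp)]
          exact List.mem_finRange i
        · -- in the last pass no coordinates are left, and every coefficient is visible
          have htd' : (t : ℕ) + 1 = d := by have := t.2; omega
          have hproj : ∀ k : Fin d → ℤ, proj t k = k := fun k => by
            rw [proj_eq_trunc, htd', trunc_self]
          have hlen : 0 < (iterations P t).length := by
            rw [iterations, if_neg htd, List.length_take, List.length_finRange]
            omega
          refine ⟨(iterations P t)[0], List.getElem_mem _, g, ?_⟩
          rw [← proj_eq_trunc]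
          simp only [prefixCoeff, hproj, sub_self, UnitAddTorus.mFourier_zero]
          rw [Finset.filter_eq', if_pos hg]
          simpa using hc g u hg
    · intro j
      rw [h2]
      have hm : ∀ g, (I g).card ≤ if (t : ℕ) + 1 < d then P.sLoc else s := fun g => by
        split_ifs
        · exact (hcard g).trans hs
        · exact hcard g
      have hvote : ∀ i g, ∀ h ∈ J, 2 * (Finset.univ.filter fun l : Fin P.L => ∃ k ∈ I g,
          proj t k ≠ h ∧ residue h (ω.2.2.1 t i l) =
            residue (proj t k) (ω.2.2.1 t i l)).card < P.L := fun i g h hh => by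
        obtain ⟨u, hu, v, hv, rfl⟩ := hJ2 h hh
        exact hω.vote t i g u hu v hv
      have key := fun i g => mem_randomLattices (c := c) hθ t i g (hm g) hJn (hvote i g) j
      simp only [key]
      constructor
      · rintro ⟨i, hi, g, a, ha, h⟩
        exact ⟨a, ha, i, hi, g, h⟩
      · rintro ⟨a, ha, i, hi, g, h⟩
        exact ⟨i, hi, g, a, ha, h⟩

lemma loopInvariant_zero (I : Fin G → Finset (Fin d → ℤ)) : LoopInvariant I 0 [0] := by
  refine ⟨List.nodup_singleton _, fun h => ?_⟩
  simp only [List.mem_singleton, true_and, trunc_zero]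
  constructor
  · exact Or.inl
  · rintro (h | ⟨-, -, rfl⟩)
    · exact h
    · rfl

lemma length_le_of_loopInvariant {n : ℕ} {L : List (Fin d → ℤ)} (h : LoopInvariant I n L)
    (hcard : ∀ g, (I g).card ≤ s) (hs : 1 ≤ s) (hG : 1 ≤ G) : L.length ≤ s * G := by
  classical
  have hU : (Finset.univ.biUnion I).card ≤ s * G := by
    refine (Finset.card_biUnion_le_card_mul _ _ s fun g _ => hcard g).trans_eq ?_
    rw [Finset.card_fin, mul_comm]
  rw [← List.toFinset_card_of_nodup h.1]
  rcases Nat.eq_zero_or_pos n with rfl | hn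
  · refine (Finset.card_le_card (t := {0}) fun k hk => ?_).trans ?_
    · rcases (h.2 k).1 (List.mem_toFinset.1 hk) with ⟨-, rfl⟩ | ⟨u, -, rfl⟩
      · simp
      · simp [trunc_zero]
    · rw [Finset.card_singleton]
      exact Nat.mul_pos hs hG
  · refine (Finset.card_le_card (t := (Finset.univ.biUnion I).image (trunc n)) fun k hk => ?_).trans
      (Finset.card_image_le.trans hU)
    rcases (h.2 k).1 (List.mem_toFinset.1 hk) with ⟨h0, -⟩ | ⟨u, hu, rfl⟩
    · omega
    · exact Finset.mem_image_of_mem _ hu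

lemma foldl_ite_eq {α β : Type} {l : List α} {p : α → Prop} [DecidablePred p] {e : α → β} {w : β}
    (he : ∀ a ∈ l, p a → e a = w) (v : β) (h : (∃ a ∈ l, p a) ∨ v = w) :
    l.foldl (fun v a => if p a then e a else v) v = w := by
  induction l generalizing v with
  | nil => simpa using h
  | cons a l ih =>
    rw [List.foldl_cons]
    refine ih (fun a ha => he a (List.mem_cons_of_mem _ ha)) _ ?_
    split_ifs with hp
    · exact Or.inr (he a List.mem_cons_self hp)
    · rcases h with ⟨b, hb, hpb⟩ | h
      · rcases List.mem_cons.1 hb with rfl | hb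
        · exact absurd hpb hp
        · exact Or.inl ⟨b, hb, hpb⟩
      · exact Or.inr h

lemma foldl_update_count {α : Type} (l : List α) (ρ : α → ℕ) (cnt : ℕ → ℕ) (n : ℕ) :
    l.foldl (fun cnt k => Function.update cnt (ρ k) (cnt (ρ k) + 1)) cnt n =
      cnt n + l.countP fun k => ρ k = n := by
  induction l generalizing cnt with
  | nil => simp
  | cons a l ih =>
    rw [List.foldl_cons, ih, List.countP_cons, Function.update_apply]
    by_cases h : ρ a = n
    · simp only [h, if_true, decide_true]
      ring
    · simp only [h, Ne.symm h, if_false, decide_false]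
      simp

lemma countP_eq_one_iff {α : Type} [DecidableEq α] {l : List α} (hl : l.Nodup) (ρ : α → ℕ) {k : α}
    (hk : k ∈ l) :
    l.countP (fun k' => decide (ρ k' = ρ k)) = 1 ↔ ∀ k' ∈ l, ρ k' = ρ k → k' = k := by
  rw [List.countP_eq_length_filter]
  constructor
  · intro h k' hk' he
    obtain ⟨b, hb⟩ := List.length_eq_one_iff.1 h
    have h1 : k ∈ l.filter fun k' => decide (ρ k' = ρ k) := List.mem_filter.2 ⟨hk, by simp⟩
    have h2 : k' ∈ l.filter fun k' => decide (ρ k' = ρ k) := List.mem_filter.2 ⟨hk', by simpa⟩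
    rw [hb, List.mem_singleton] at h1 h2
    rw [h1, h2]
  · intro h
    rw [← List.toFinset_card_of_nodup (hl.filter _), Finset.card_eq_one]
    refine ⟨k, Finset.ext fun k' => ?_⟩
    simp only [List.mem_toFinset, List.mem_filter, decide_eq_true_eq, Finset.mem_singleton]
    exact ⟨fun h' => h k' h'.1 h'.2, fun h' => by subst h'; exact ⟨hk, rfl⟩⟩

open Classical in
/-- The coefficients are exact on every lattice on which the frequency is alone in its residue
class, and the good event provides such a lattice. -/
lemma val_coefficients (hω : Good I c θ P ω) {L : List (Fin d → ℤ)} (hLn : L.Nodup)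
    (hL : ∀ h, h ∈ L ↔ h ∈ Finset.univ.biUnion I) (g : Fin G) :
    (coefficients P ω (fun g => trigPoly (I g) (c g)) L).val g =
      L.map fun k => (k, if k ∈ I g then c g k else 0) := by
  have hM := P.Mfin_prime.ne_zero
  unfold coefficients
  rw [val_bind, val_tabulateFin, val_bind, val_mapT]
  refine List.map_congr_left fun k hk => ?_
  rw [val_bind, val_charge]
  congr 1
  rw [val_foldT]
  simp only [val_mapT, val_bind, val_charge, List.map_map, val_foldT]
  have hcnt : ∀ l : Fin P.Lfin, L.foldl (fun (cnt : ℕ → ℕ) k => Function.update cnt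
      (residue k (ω.2.2.2 l)) (cnt (residue k (ω.2.2.2 l)) + 1))
      (tabulate P.Mfin fun _ => charge 1 0).val (residue k (ω.2.2.2 l)) = 1 ↔
      ∀ k' ∈ L, residue k' (ω.2.2.2 l) = residue k (ω.2.2.2 l) → k' = k := by
    intro l
    have : (tabulate P.Mfin fun _ => charge 1 0).val (residue k (ω.2.2.2 l)) = 0 := by
      simp [tabulate]
    rw [← countP_eq_one_iff hLn (fun k' => residue k' (ω.2.2.2 l)) hk,
      foldl_update_count L (fun k => residue k (ω.2.2.2 l)), this, zero_add]
  refine foldl_ite_eq (fun a ha hp => ?_) _ (Or.inl ?_)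
  · obtain ⟨l, -, rfl⟩ := List.mem_map.1 ha
    simp only [Function.comp_apply] at hp ⊢
    refine val_fft_latticePoint _ _ hM _ _ (fun n hn => ?_) _ fun k' hk' hres => ?_
    · rw [val_tabulate _ _ hn, val_charge, val_tabulate _ _ hn, val_charge]
    · refine (hcnt l).1 hp k' ((hL k').2 ?_) hres.symm
      exact Finset.mem_biUnion.2 ⟨g, Finset.mem_univ _, hk'⟩
  · obtain ⟨l, hl⟩ := hω.isolated k ((hL k).1 hk)
    refine ⟨_, List.mem_map.2 ⟨l, List.mem_finRange l, rfl⟩, ?_⟩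
    simp only [Function.comp_apply]
    refine (hcnt l).2 fun k' hk' hres => ?_
    by_contra hne
    exact hl k' ((hL k').1 hk') hne hres

/-- On the good event the usFFT recovers all frequencies and coefficients. -/
lemma mem_usFFT_of_good (hω : Good I c θ P ω) (hI : ∀ g, I g ⊆ Γ) (hs : s ≤ P.sLoc)
    (hcard : ∀ g, (I g).card ≤ s) (hθ : 0 ≤ θ) (hc : ∀ g, ∀ k ∈ I g, θ < ‖c g k‖)
    (hr : 1 ≤ P.r) (hd : 1 ≤ d) (g : Fin G) (k : Fin d → ℤ) (w : ℂ) :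
    ((k, w) ∈ (usFFT Γ s θ P ω fun g => trigPoly (I g) (c g)).val g ∧ w ≠ 0) ↔
      k ∈ I g ∧ w = c g k := by
  classical
  have hinv := (foldT_finRange_invariant
    (fun t => (singleComponent Γ θ P ω (fun g => trigPoly (I g) (c g)) t).val)
    (fun L a => (⟨(extend Γ s θ P ω (fun g => trigPoly (I g) (c g)) L a).val, 0⟩ : Timed _))
    (LoopInvariant I) 0 (loopInvariant_zero I) fun t L hL =>
      ⟨loopInvariant_extend hω hI hs hcard hθ hc hr t hL, le_rfl⟩).1
  rw [val_foldT] at hinv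
  have hval : (usFFT Γ s θ P ω fun g => trigPoly (I g) (c g)).val g = (coefficients P ω
      (fun g => trigPoly (I g) (c g)) (((List.finRange d).map fun t =>
        (t, (singleComponent Γ θ P ω (fun g => trigPoly (I g) (c g)) t).val)).foldl
        (fun L a => (extend Γ s θ P ω (fun g => trigPoly (I g) (c g)) L a).val) [0])).val g := by
    rw [usFFT_eq, val_bind, val_bind, val_foldT]
    rfl
  rw [hval, val_coefficients hω hinv.1 (fun h => ?_)]
  · simp only [List.mem_map, Prod.mk.injEq]
    constructor
    · rintro ⟨⟨k', -, rfl, rfl⟩, hne⟩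
      split_ifs at hne ⊢ with hk
      · exact ⟨hk, rfl⟩
      · exact absurd rfl hne
    · rintro ⟨hk, rfl⟩
      refine ⟨⟨k, (hinv.2 k).2 (Or.inr ⟨k, ?_, trunc_self k⟩), rfl, if_pos hk⟩, ?_⟩
      · exact Finset.mem_biUnion.2 ⟨g, Finset.mem_univ _, hk⟩
      · exact norm_pos_iff.1 (hθ.trans_lt (hc g k hk))
  · rw [hinv.2 h]
    simp only [trunc_self, exists_eq_right]
    exact or_iff_right fun h' => by omega

lemma cost_usFFT_le_of_good {N C : ℕ} (hω : Good I c θ P ω) (hI : ∀ g, I g ⊆ Γ)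
    (hs : s ≤ P.sLoc) (hs1 : 1 ≤ s) (hcard : ∀ g, (I g).card ≤ s) (hθ : 0 ≤ θ)
    (hc : ∀ g, ∀ k ∈ I g, θ < ‖c g k‖) (hN : ∀ t, width Γ t + 1 ≤ N) (hd : 1 ≤ d)
    (hG : 1 ≤ G) (hr : 1 ≤ P.r) (hL : 1 ≤ P.L) (hLfin : 1 ≤ P.Lfin)
    (hcN : Nat.clog 2 (2 * N) ≤ C) (hcM : Nat.clog 2 (2 * P.M) ≤ C)
    (hcMfin : Nat.clog 2 (2 * P.Mfin) ≤ C) (hcJ : Nat.clog 2 (s * G * N) ≤ C) :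
    (usFFT Γ s θ P ω fun g => trigPoly (I g) (c g)).cost ≤ d * (470 * (P.r * G * N * C * d) + 2) +
      d * (8 * (d * (s * G) * N) + (s * G) * N +
        P.r * G * (430 * (d * P.L * P.M * C) + 60 * ((s * G) * N * (P.L * d + C))) + 1) +
      430 * (G * d * P.Lfin * (P.Mfin * C + (s * G))) :=
  cost_usFFT_le (LoopInvariant I) (loopInvariant_zero I)
    (fun t _ hL => loopInvariant_extend hω hI hs hcard hθ hc hr t hL)
    (fun _ _ h => length_le_of_loopInvariant h hcard hs1 hG) hN hd hG hr hL hLfin hcN hcM hcMfin hcJ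

end USFFT

/-! ### Visibility of frequencies at random points -/

namespace USFFT

open Timed

variable {d : ℕ}

instance (d : ℕ) : IsProbabilityMeasure (torusLaw d) := by
  unfold torusLaw
  infer_instance

lemma integral_mFourier (k : Fin d → ℤ) :
    ∫ x, UnitAddTorus.mFourier k x ∂torusLaw d = if k = 0 then 1 else 0 := by
  simp_rw [mFourier_apply]
  unfold torusLaw
  rw [integral_fintype_prod_eq_prod (f := fun j (y : UnitAddCircle) => (fourier (k j) y : ℂ))]
  have h1 : ∀ m : ℤ, ∫ y : UnitAddCircle, (fourier m y : ℂ) ∂AddCircle.haarAddCircle =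
      if m = 0 then 1 else 0 := by
    intro m
    have := congrFun (fourierCoeff_fourier (T := 1) m) 0
    simp only [fourierCoeff, neg_zero, fourier_zero, one_smul] at this
    rw [this, Pi.single_apply]
    simp only [eq_comm]
  simp_rw [h1]
  split_ifs with h
  · simp [h]
  · obtain ⟨j, hj⟩ := Function.ne_iff.1 h
    exact Finset.prod_eq_zero (Finset.mem_univ j) (if_neg hj)

lemma norm_mFourier_apply (k : Fin d → ℤ) (x : UnitAddTorus (Fin d)) :
    ‖UnitAddTorus.mFourier k x‖ = 1 := by
  rw [mFourier_apply, norm_prod]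
  exact Finset.prod_eq_one fun j _ => by rw [fourier_apply, Circle.norm_coe]

/-- A trigonometric polynomial `q` with at most `s` terms, whose coefficients are at least `3 θ`,
exceeds `θ` with probability at least `2 / (3 s)`: if `c` is a largest coefficient, then
`|c| ≤ ∫ |q| ≤ θ + s |c| μ {θ < |q|}`. -/
lemma torusLaw_norm_le_threshold {ι : Type*} (S : Finset ι) (φ : ι → Fin d → ℤ) (c : ι → ℂ) {s : ℕ}
    {θ : ℝ} (hS : S.Nonempty) (hcard : S.card ≤ s) (hφ : Set.InjOn φ S)
    (hc : ∀ k ∈ S, 0 < ‖c k‖) (hθ : ∀ k ∈ S, 3 * θ ≤ ‖c k‖) (hθ0 : 0 ≤ θ) :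
    torusLaw d {x | ‖∑ k ∈ S, c k * UnitAddTorus.mFourier (φ k) x‖ ≤ θ} ≤
      ENNReal.ofReal (1 - 2 / (3 * s)) := by
  classical
  set μ := torusLaw d
  set q : UnitAddTorus (Fin d) → ℂ := fun x => ∑ k ∈ S, c k * UnitAddTorus.mFourier (φ k) x with hq
  have hqc : Continuous q := by fun_prop
  have hint : ∀ f : UnitAddTorus (Fin d) → ℂ, Continuous f → Integrable f μ := fun f hf =>
    hf.integrable_of_hasCompactSupport (HasCompactSupport.of_compactSpace f)
  obtain ⟨k₀, hk₀, hmax⟩ := S.exists_max_image (fun k => ‖c k‖) hS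
  set A : Set (UnitAddTorus (Fin d)) := {x | ‖q x‖ ≤ θ} with hA
  have hAm : MeasurableSet A := (isClosed_le hqc.norm continuous_const).measurableSet
  have hcoef : ∫ x, q x * UnitAddTorus.mFourier (-φ k₀) x ∂μ = c k₀ := by
    have : ∀ x, q x * UnitAddTorus.mFourier (-φ k₀) x =
        ∑ k ∈ S, c k * UnitAddTorus.mFourier (φ k + -φ k₀) x := by
      intro x
      rw [hq, Finset.sum_mul]
      exact Finset.sum_congr rfl fun k _ => by rw [UnitAddTorus.mFourier_add, mul_assoc]
    simp_rw [this]
    rw [integral_finsetSum _ fun k _ => hint _ (by fun_prop)]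
    simp_rw [integral_const_mul, μ, integral_mFourier]
    rw [Finset.sum_eq_single k₀]
    · simp
    · intro k hk hne
      rw [if_neg, mul_zero]
      intro h0
      exact hne (hφ hk hk₀ (add_neg_eq_zero.1 h0))
    · exact fun h => absurd hk₀ h
  have hle : ‖c k₀‖ ≤ ∫ x, ‖q x‖ ∂μ := by
    rw [← hcoef]
    refine (norm_integral_le_integral_norm _).trans_eq (integral_congr_ae (.of_forall fun x => ?_))
    simp only [norm_mul, norm_mFourier_apply, mul_one]
  have hbound : ∀ x, ‖q x‖ ≤ θ + Aᶜ.indicator (fun _ => (s : ℝ) * ‖c k₀‖) x := by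
    intro x
    by_cases hx : x ∈ A
    · rw [Set.indicator_of_notMem (by simpa using hx), add_zero]
      exact hx
    · rw [Set.indicator_of_mem (by simpa using hx)]
      have : ‖q x‖ ≤ S.card * ‖c k₀‖ := by
        refine (norm_sum_le _ _).trans ?_
        rw [← nsmul_eq_mul]
        refine Finset.sum_le_card_nsmul _ _ _ fun k hk => ?_
        rw [norm_mul, norm_mFourier_apply, mul_one]
        exact hmax k hk
      have h2 : (S.card : ℝ) * ‖c k₀‖ ≤ s * ‖c k₀‖ := by gcongr
      linarith
  have hint2 : Integrable (Aᶜ.indicator fun _ => (s : ℝ) * ‖c k₀‖) μ :=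
    (integrable_const _).indicator hAm.compl
  have hle2 : ‖c k₀‖ ≤ θ + μ.real Aᶜ * (s * ‖c k₀‖) := by
    refine hle.trans ((integral_mono (hint _ hqc).norm ((integrable_const θ).add hint2)
      hbound).trans_eq ?_)
    rw [integral_add' (integrable_const θ) hint2, integral_const, integral_indicator hAm.compl,
      setIntegral_const]
    simp
  have hs : 0 < (s : ℝ) := by exact_mod_cast (Finset.card_pos.2 hS).trans_le hcard
  have h3 : 2 / (3 * s) ≤ μ.real Aᶜ := by
    have h4 := hθ k₀ hk₀
    have h5 := hc k₀ hk₀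
    rw [div_le_iff₀ (by positivity)]
    have : ‖c k₀‖ * 2 ≤ ‖c k₀‖ * (μ.real Aᶜ * (3 * s)) := by nlinarith
    exact le_of_mul_le_mul_left this h5
  rw [← ofReal_measureReal (measure_ne_top _ _)]
  refine ENNReal.ofReal_le_ofReal ?_
  rw [measureReal_compl hAm, probReal_univ] at h3
  linarith

/-! ### Aliasing on random rank-1 lattices -/

open ProbabilityTheory

/-- Two distinct frequencies whose components differ by less than the prime `M` have equal residues
for at most one out of `M` generating vectors. -/
lemma card_residue_eq_mul_le {M : ℕ} (hM : M.Prime) {h k : Fin d → ℤ} (hne : k ≠ h)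
    (hdiff : ∀ j, |h j - k j| < M) :
    (Finset.univ.filter fun z : Fin d → Fin M => residue h z = residue k z).card * M ≤
      Fintype.card (Fin d → Fin M) := by
  classical
  obtain ⟨j₀, hj₀⟩ := Function.ne_iff.1 hne
  have hprod : (Finset.univ.filter fun z : Fin d → Fin M => residue h z = residue k z).card * M =
      ((Finset.univ.filter fun z : Fin d → Fin M => residue h z = residue k z) ×ˢ
        (Finset.univ : Finset (Fin M))).card := by
    rw [Finset.card_product, Finset.card_univ, Fintype.card_fin]
  rw [← Finset.card_univ, hprod]
  -- a solution of the congruence is determined by its coordinates other than `j₀`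
  refine Finset.card_le_card_of_injOn (fun p => Function.update p.1 j₀ p.2)
    (fun _ _ => Finset.mem_coe.2 (Finset.mem_univ _)) ?_
  rintro ⟨z, a⟩ hz ⟨z', a'⟩ hz' heq
  simp only [Finset.coe_product, Set.mem_prod, Finset.mem_coe, Finset.mem_filter, Finset.mem_univ,
    true_and, and_true] at hz hz'
  have ha : a = a' := by simpa using congrFun heq j₀
  have hoff : ∀ j ≠ j₀, z j = z' j := fun j hj => by simpa [hj] using congrFun heq j
  have hdvd : ∀ z : Fin d → Fin M, residue h z = residue k z →
      (M : ℤ) ∣ ∑ j, (h j - k j) * ((z j : ℕ) : ℤ) := by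
    intro z hz
    have := Int.ModEq.dvd ((residue_eq_iff hM.ne_zero h k z).1 hz).symm
    simpa only [sub_mul, Finset.sum_sub_distrib] using this
  have h1 := dvd_sub (hdvd z hz) (hdvd z' hz')
  rw [← Finset.sum_sub_distrib, Finset.sum_eq_single j₀ (fun j _ hj => by
    rw [hoff j hj, sub_self]) (fun h => absurd (Finset.mem_univ _) h), ← mul_sub] at h1
  have hprime : Prime (M : ℤ) := Nat.prime_iff_prime_int.1 hM
  have h2 : ((z j₀ : ℕ) : ℤ) - ((z' j₀ : ℕ) : ℤ) = 0 := by
    rcases hprime.dvd_or_dvd h1 with h2 | h2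
    · exact absurd (Int.eq_zero_of_abs_lt_dvd h2 (hdiff j₀)) (sub_ne_zero.2 (Ne.symm hj₀))
    · refine Int.eq_zero_of_abs_lt_dvd h2 ?_
      have := (z j₀).2
      have := (z' j₀).2
      rw [abs_lt]
      omega
  have hz0 : z = z' := by
    funext j
    rcases eq_or_ne j j₀ with rfl | hj
    · exact Fin.ext (by omega)
    · exact hoff j hj
  rw [hz0, ha]

/-- On a random rank-1 lattice, a frequency aliases with one out of at most `M / 16` others with
probability at most `1 / 16`. -/
lemma uniformOn_alias_le {M : ℕ} (hM : M.Prime) (K : Finset (Fin d → ℤ)) (h : Fin d → ℤ)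
    (hK : 16 * K.card ≤ M) (hdiff : ∀ k ∈ K, ∀ j, |h j - k j| < M) :
    uniformOn (Set.univ : Set (Fin d → Fin M))
      {z | ∃ k ∈ K, k ≠ h ∧ residue h z = residue k z} ≤ 16⁻¹ := by
  classical
  set X := Fintype.card (Fin d → Fin M) with hX
  have hX0 : 0 < X := by
    have : NeZero M := ⟨hM.ne_zero⟩
    exact Fintype.card_pos
  set B : Finset (Fin d → Fin M) := (K.filter (· ≠ h)).biUnion fun k =>
    Finset.univ.filter fun z => residue h z = residue k z with hB
  have hset : {z : Fin d → Fin M | ∃ k ∈ K, k ≠ h ∧ residue h z = residue k z} = B := by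
    ext z
    simp [hB, and_assoc]
  have hcard : B.card * 16 ≤ X := by
    have h1 : B.card * M ≤ K.card * X := by
      calc B.card * M ≤ (∑ k ∈ K.filter (· ≠ h),
            (Finset.univ.filter fun z : Fin d → Fin M => residue h z = residue k z).card) * M :=
            Nat.mul_le_mul_right _ Finset.card_biUnion_le
        _ ≤ (K.filter (· ≠ h)).card * X := by
            rw [Finset.sum_mul]
            refine Finset.sum_le_card_nsmul _ _ _ fun k hk => ?_
            obtain ⟨hk1, hk2⟩ := Finset.mem_filter.1 hk
            exact card_residue_eq_mul_le hM hk2 (hdiff k hk1)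
        _ ≤ K.card * X := Nat.mul_le_mul_right _ (Finset.card_filter_le _ _)
    have h2 : B.card * 16 * M ≤ X * M := by
      calc B.card * 16 * M = 16 * (B.card * M) := by ring
        _ ≤ 16 * (K.card * X) := Nat.mul_le_mul_left _ h1
        _ = (16 * K.card) * X := by ring
        _ ≤ M * X := Nat.mul_le_mul_right _ hK
        _ = X * M := mul_comm _ _
    exact Nat.le_of_mul_le_mul_right h2 hM.pos
  rw [hset, uniformOn_univ, Measure.count_apply_finset]
  rw [ENNReal.div_le_iff (by exact_mod_cast hX0.ne') (ENNReal.natCast_ne_top _), mul_comm,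
    ← div_eq_mul_inv, ENNReal.le_div_iff_mul_le (by simp) (by simp)]
  exact_mod_cast hcard

/-! ### Products of probability measures and the union bound -/

section product
variable {ι α : Type*} [Fintype ι] [MeasurableSpace α] (μ : Measure α) [IsProbabilityMeasure μ]

lemma pi_forall_mem (S : Finset ι) (B : Set α) :
    Measure.pi (fun _ : ι => μ) {ω | ∀ i ∈ S, ω i ∈ B} = μ B ^ S.card := by
  classical
  have : {ω : ι → α | ∀ i ∈ S, ω i ∈ B} = Set.univ.pi fun i => if i ∈ S then B else Set.univ := by
    ext ω
    simp only [Set.mem_ofPred_eq, Set.mem_univ_pi]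
    refine forall_congr' fun i => ?_
    split_ifs with h <;> simp [h]
  rw [this, Measure.pi_pi]
  simp_rw [apply_ite μ, measure_univ]
  rw [Finset.prod_ite_mem, Finset.univ_inter, Finset.prod_const]

lemma pi_eval_mem (i : ι) (B : Set α) : Measure.pi (fun _ : ι => μ) {ω | ω i ∈ B} = μ B := by
  simpa using pi_forall_mem μ {i} B

/-- A vote fails with exponentially small probability, if the single votes are wrong with
probability at most `1 / 16`: each of the at most `2 ^ n` sets of at least `n / 2` votes is entirely
wrong with probability at most `16 ^ (- n / 2) = 4 ^ (- n)`. -/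
lemma pi_majority_le {B : Set α} [DecidablePred (· ∈ B)] (hB : μ B ≤ 16⁻¹) :
    Measure.pi (fun _ : ι => μ)
      {ω | Fintype.card ι ≤ 2 * (Finset.univ.filter fun i => ω i ∈ B).card} ≤
      2⁻¹ ^ Fintype.card ι := by
  classical
  set n := Fintype.card ι
  have hsub : {ω : ι → α | n ≤ 2 * (Finset.univ.filter fun i => ω i ∈ B).card} ⊆
      ⋃ S ∈ (Finset.univ : Finset (Finset ι)).filter (fun S => n ≤ 2 * S.card),
        {ω | ∀ i ∈ S, ω i ∈ B} := by
    intro ω hω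
    refine Set.mem_biUnion (x := Finset.univ.filter fun i => ω i ∈ B) ?_ ?_
    · simpa using hω
    · intro i hi
      exact (Finset.mem_filter.1 hi).2
  have h16 : (16 : ENNReal)⁻¹ = 4⁻¹ ^ 2 := by
    rw [← ENNReal.inv_pow]
    norm_num
  have h24 : (2 : ENNReal) * 4⁻¹ = 2⁻¹ := by
    rw [show (4 : ENNReal) = 2 * 2 by norm_num, ENNReal.mul_inv (by simp) (by simp), ← mul_assoc,
      ENNReal.mul_inv_cancel (by simp) (by simp), one_mul]
  calc Measure.pi (fun _ : ι => μ) {ω | n ≤ 2 * (Finset.univ.filter fun i => ω i ∈ B).card}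
      ≤ ∑ S ∈ (Finset.univ : Finset (Finset ι)).filter (fun S => n ≤ 2 * S.card),
          Measure.pi (fun _ : ι => μ) {ω | ∀ i ∈ S, ω i ∈ B} :=
        (measure_mono hsub).trans (measure_biUnion_finset_le _ _)
    _ ≤ ∑ S ∈ (Finset.univ : Finset (Finset ι)).filter (fun S => n ≤ 2 * S.card), 4⁻¹ ^ n := by
        refine Finset.sum_le_sum fun S hS => ?_
        rw [pi_forall_mem]
        calc μ B ^ S.card ≤ (16⁻¹) ^ S.card := by gcongr
          _ = 4⁻¹ ^ (2 * S.card) := by rw [h16, pow_mul]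
          _ ≤ 4⁻¹ ^ n := pow_le_pow_right_of_le_one' (by simp [ENNReal.inv_le_one])
              (Finset.mem_filter.1 hS).2
    _ ≤ ∑ S : Finset ι, 4⁻¹ ^ n :=
        Finset.sum_le_sum_of_subset (Finset.filter_subset _ _)
    _ = 2⁻¹ ^ n := by
        rw [Finset.sum_const, Finset.card_univ, Fintype.card_finset, nsmul_eq_mul, ← h24, mul_pow]
        push_cast
        rfl

end product

lemma uniformOn_univ_eq_pi {ι Ω : Type*} [Fintype ι] [Finite Ω] [MeasurableSpace Ω]
    [MeasurableSingletonClass Ω] :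
    uniformOn (Set.univ : Set (ι → Ω)) = Measure.pi fun _ => uniformOn (Set.univ : Set Ω) := by
  rw [← uniformOn_pi, Set.pi_univ]

lemma measure_exists_mem_le {Ω κ : Type*} [MeasurableSpace Ω] (μ : Measure Ω) (S : Finset κ)
    (p : κ → Ω → Prop) {b : ENNReal} (h : ∀ k ∈ S, μ {ω | p k ω} ≤ b) :
    μ {ω | ∃ k ∈ S, p k ω} ≤ S.card * b := by
  have : {ω | ∃ k ∈ S, p k ω} = ⋃ k ∈ S, {ω | p k ω} := by
    ext
    simp
  rw [this, ← nsmul_eq_mul]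
  exact (measure_biUnion_finset_le _ _).trans (Finset.sum_le_card_nsmul _ _ _ h)

lemma measure_exists_le {Ω κ : Type*} [MeasurableSpace Ω] [Fintype κ] (μ : Measure Ω)
    (p : κ → Ω → Prop) {b : ENNReal} (h : ∀ k, μ {ω | p k ω} ≤ b) :
    μ {ω | ∃ k, p k ω} ≤ Fintype.card κ * b := by
  simpa using measure_exists_mem_le μ Finset.univ p (fun k _ => h k)

end USFFT

/-! ### Probability of the good event -/

namespace USFFT

open Timed ProbabilityTheory

section marginals
variable {d : ℕ} {P : Params}

instance (P : Params) : NeZero P.M := ⟨P.M_prime.ne_zero⟩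

instance (P : Params) : NeZero P.Mfin := ⟨P.Mfin_prime.ne_zero⟩

-- instances for the factors of `law`, which the instance search finds only one by one
instance : IsProbabilityMeasure
    (uniformOn (Set.univ : Set (Fin d → Fin P.r → Fin P.L → Fin d → Fin P.M))) :=
  instIsProbabilityMeasure_uniformOn_univ

instance : IsProbabilityMeasure
    (uniformOn (Set.univ : Set (Fin P.Lfin → Fin d → Fin P.Mfin))) :=
  instIsProbabilityMeasure_uniformOn_univ

instance : IsProbabilityMeasure
    ((uniformOn (Set.univ : Set (Fin d → Fin P.r → Fin P.L → Fin d → Fin P.M))).prod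
      (uniformOn (Set.univ : Set (Fin P.Lfin → Fin d → Fin P.Mfin)))) :=
  Measure.prod.instIsProbabilityMeasure _ _

instance : IsProbabilityMeasure
    ((Measure.pi fun _ : Fin d => Measure.pi fun _ : Fin P.r => torusLaw d).prod
    ((uniformOn (Set.univ : Set (Fin d → Fin P.r → Fin P.L → Fin d → Fin P.M))).prod
      (uniformOn (Set.univ : Set (Fin P.Lfin → Fin d → Fin P.Mfin))))) :=
  Measure.prod.instIsProbabilityMeasure _ _

instance (d : ℕ) (P : Params) : IsProbabilityMeasure (law d P) :=
  Measure.prod.instIsProbabilityMeasure _ _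

lemma law_coord_mem (t : Fin d) (B : Set (Fin P.r → UnitAddTorus (Fin d))) :
    law d P {ω | ω.1 t ∈ B} = Measure.pi (fun _ => torusLaw d) B := by
  have : {ω : Randomness d P | ω.1 t ∈ B} =
      {x : Fin d → Fin P.r → UnitAddTorus (Fin d) | x t ∈ B} ×ˢ Set.univ := by
    ext
    simp
  rw [this, law, Measure.prod_prod, measure_univ, mul_one, pi_eval_mem]

lemma law_prefix_mem (t : Fin d) (B : Set (Fin P.r → UnitAddTorus (Fin d))) :
    law d P {ω | ω.2.1 t ∈ B} = Measure.pi (fun _ => torusLaw d) B := by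
  have : {ω : Randomness d P | ω.2.1 t ∈ B} = Set.univ ×ˢ
      ({x : Fin d → Fin P.r → UnitAddTorus (Fin d) | x t ∈ B} ×ˢ Set.univ) := by
    ext
    simp
  rw [this, law, Measure.prod_prod, Measure.prod_prod, measure_univ, measure_univ, mul_one, one_mul,
    pi_eval_mem]

lemma law_lattice_mem (t : Fin d) (i : Fin P.r) (B : Set (Fin P.L → Fin d → Fin P.M)) :
    law d P {ω | ω.2.2.1 t i ∈ B} =
      Measure.pi (fun _ => uniformOn (Set.univ : Set (Fin d → Fin P.M))) B := by
  have : {ω : Randomness d P | ω.2.2.1 t i ∈ B} = Set.univ ×ˢ (Set.univ ×ˢ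
      ({x : Fin d → Fin P.r → Fin P.L → Fin d → Fin P.M |
        x t ∈ {y : Fin P.r → Fin P.L → Fin d → Fin P.M | y i ∈ B}} ×ˢ Set.univ)) := by
    ext
    simp
  rw [this, law, Measure.prod_prod, Measure.prod_prod, Measure.prod_prod, measure_univ,
    measure_univ, mul_one, one_mul, one_mul, uniformOn_univ_eq_pi, pi_eval_mem,
    uniformOn_univ_eq_pi, pi_eval_mem, uniformOn_univ_eq_pi]

lemma law_final_mem (B : Set (Fin P.Lfin → Fin d → Fin P.Mfin)) :
    law d P {ω | ω.2.2.2 ∈ B} =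
      Measure.pi (fun _ => uniformOn (Set.univ : Set (Fin d → Fin P.Mfin))) B := by
  have : {ω : Randomness d P | ω.2.2.2 ∈ B} = Set.univ ×ˢ (Set.univ ×ˢ (Set.univ ×ˢ B)) := by
    ext
    simp
  rw [this, law, Measure.prod_prod, Measure.prod_prod, Measure.prod_prod, measure_univ,
    measure_univ, one_mul, one_mul, one_mul, uniformOn_univ_eq_pi]

end marginals

variable {d G : ℕ} {Γ : Finset (Fin d → ℤ)} {P : Params}
  {I : Fin G → Finset (Fin d → ℤ)} {c : Fin G → (Fin d → ℤ) → ℂ} {s : ℕ} {θ : ℝ}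

lemma abs_sub_le_width {k l : Fin d → ℤ} (hk : k ∈ Γ) (hl : l ∈ Γ) (t : Fin d) :
    |k t - l t| ≤ width Γ t :=
  abs_le'.2 ⟨sub_le_width hk hl t, by have := sub_le_width hl hk t; omega⟩

lemma abs_update_trunc_sub_proj_le {u v k : Fin d → ℤ} (hu : u ∈ Γ) (hv : v ∈ Γ) (hk : k ∈ Γ)
    (t j : Fin d) : |Function.update (trunc t u) t (v t) j - proj t k j| ≤ width Γ j := by
  rcases eq_or_ne j t with rfl | hj
  · simpa [proj] using abs_sub_le_width hv hk j
  · rw [Function.update_of_ne hj]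
    have : (j : ℕ) ≠ t := fun h' => hj (Fin.ext h')
    simp only [trunc, proj, Fin.le_def]
    split_ifs with h1 h2 h2
    · exact abs_sub_le_width hu hk j
    · omega
    · omega
    · simp

lemma law_coord_invisible_le (hcard : ∀ g, (I g).card ≤ s) (hθ0 : 0 ≤ θ)
    (hc : ∀ g, ∀ k ∈ I g, 0 < ‖c g k‖) (hθ : ∀ g, ∀ k ∈ I g, 3 * θ ≤ ‖c g k‖) :
    law d P {ω | ∃ t : Fin d, ∃ g, ∃ k ∈ I g,
      ∀ i, ‖coordCoeff (I g) (c g) t (k t) (ω.1 t i)‖ ≤ θ} ≤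
      d * (G * (s * ENNReal.ofReal (1 - 2 / (3 * s)) ^ P.r)) := by
  refine (measure_exists_le _ _ fun t => measure_exists_le _ _ fun g =>
    (le_trans (b := ((I g).card : ENNReal) * ENNReal.ofReal (1 - 2 / (3 * s)) ^ P.r)
      (measure_exists_mem_le _ (I g) _ fun k hk => ?_)
      (c := s * ENNReal.ofReal (1 - 2 / (3 * s)) ^ P.r) ?_)).trans_eq ?_
  · have h1 := law_coord_mem (P := P) t {x | ∀ i ∈ (Finset.univ : Finset (Fin P.r)),
      x i ∈ {y | ‖coordCoeff (I g) (c g) t (k t) y‖ ≤ θ}}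
    rw [pi_forall_mem, Finset.card_fin] at h1
    simp only [Finset.mem_univ, true_imp_iff, Set.mem_ofPred_eq] at h1
    rw [h1]
    gcongr
    refine torusLaw_norm_le_threshold _ (fun k => Function.update k t 0) (c g)
      ⟨k, Finset.mem_filter.2 ⟨hk, rfl⟩⟩ ((Finset.card_filter_le _ _).trans (hcard g)) ?_
      (fun k hk => hc g k (Finset.mem_filter.1 hk).1)
      (fun k hk => hθ g k (Finset.mem_filter.1 hk).1) hθ0
    intro a ha b hb hab
    have ha := (Finset.mem_filter.1 (Finset.mem_coe.1 ha)).2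
    have hb := (Finset.mem_filter.1 (Finset.mem_coe.1 hb)).2
    funext j
    rcases eq_or_ne j t with rfl | hj
    · rw [ha, hb]
    · simpa [hj] using congrFun hab j
  · gcongr
    exact hcard g
  · rw [Fintype.card_fin, Fintype.card_fin]

lemma law_prefix_invisible_le (hcard : ∀ g, (I g).card ≤ s) (hθ0 : 0 ≤ θ)
    (hc : ∀ g, ∀ k ∈ I g, 0 < ‖c g k‖) (hθ : ∀ g, ∀ k ∈ I g, 3 * θ ≤ ‖c g k‖) :
    law d P {ω | ∃ t : Fin d, ∃ g, ∃ k ∈ I g,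
      ∀ i, ‖prefixCoeff (I g) (c g) t (proj t k) (ω.2.1 t i)‖ ≤ θ} ≤
      d * (G * (s * ENNReal.ofReal (1 - 2 / (3 * s)) ^ P.r)) := by
  refine (measure_exists_le _ _ fun t => measure_exists_le _ _ fun g =>
    (le_trans (b := ((I g).card : ENNReal) * ENNReal.ofReal (1 - 2 / (3 * s)) ^ P.r)
      (measure_exists_mem_le _ (I g) _ fun k hk => ?_)
      (c := s * ENNReal.ofReal (1 - 2 / (3 * s)) ^ P.r) ?_)).trans_eq ?_
  · have h1 := law_prefix_mem (P := P) t {x | ∀ i ∈ (Finset.univ : Finset (Fin P.r)),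
      x i ∈ {y | ‖prefixCoeff (I g) (c g) t (proj t k) y‖ ≤ θ}}
    rw [pi_forall_mem, Finset.card_fin] at h1
    simp only [Finset.mem_univ, true_imp_iff, Set.mem_ofPred_eq] at h1
    rw [h1]
    gcongr
    refine torusLaw_norm_le_threshold _ (fun k => k - proj t k) (c g)
      ⟨k, Finset.mem_filter.2 ⟨hk, rfl⟩⟩ ((Finset.card_filter_le _ _).trans (hcard g)) ?_
      (fun k hk => hc g k (Finset.mem_filter.1 hk).1)
      (fun k hk => hθ g k (Finset.mem_filter.1 hk).1) hθ0
    intro a ha b hb hab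
    have ha := (Finset.mem_filter.1 (Finset.mem_coe.1 ha)).2
    have hb := (Finset.mem_filter.1 (Finset.mem_coe.1 hb)).2
    simp only [ha, hb] at hab
    exact sub_left_injective hab
  · gcongr
    exact hcard g
  · rw [Fintype.card_fin, Fintype.card_fin]

lemma card_biUnion_le (hcard : ∀ g, (I g).card ≤ s) : (Finset.univ.biUnion I).card ≤ s * G := by
  refine (Finset.card_biUnion_le_card_mul _ _ s fun g _ => hcard g).trans_eq ?_
  rw [Finset.card_fin, mul_comm]

lemma biUnion_subset (hI : ∀ g, I g ⊆ Γ) : Finset.univ.biUnion I ⊆ Γ :=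
  Finset.biUnion_subset.2 fun g _ => hI g

lemma law_vote_fails_le (hI : ∀ g, I g ⊆ Γ) (hcard : ∀ g, (I g).card ≤ s)
    (hM : 16 * s ≤ P.M) (hMw : ∀ t, width Γ t < P.M) :
    law d P {ω | ∃ t : Fin d, ∃ i, ∃ g, ∃ u ∈ Finset.univ.biUnion I, ∃ v ∈ Finset.univ.biUnion I,
      P.L ≤ 2 * (Finset.univ.filter fun l : Fin P.L => ∃ k ∈ I g,
        proj t k ≠ Function.update (trunc t u) t (v t) ∧
        residue (Function.update (trunc t u) t (v t)) (ω.2.2.1 t i l) =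
          residue (proj t k) (ω.2.2.1 t i l)).card} ≤
      d * (P.r * (G * ((s * G : ℕ) * ((s * G : ℕ) * 2⁻¹ ^ P.L)))) := by
  classical
  set U := Finset.univ.biUnion I with hU
  have hUcard : U.card ≤ s * G := card_biUnion_le hcard
  refine (measure_exists_le _ _ fun t => measure_exists_le _ _ fun i => measure_exists_le _ _
    fun g => le_trans (b := (U.card : ENNReal) * ((s * G : ℕ) * 2⁻¹ ^ P.L))
      (measure_exists_mem_le _ U _ fun u hu => le_trans (b := (U.card : ENNReal) * 2⁻¹ ^ P.L)
        (measure_exists_mem_le _ U _ fun v hv => ?_) ?_)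
      (c := (s * G : ℕ) * ((s * G : ℕ) * 2⁻¹ ^ P.L)) ?_).trans_eq ?_
  · set h := Function.update (trunc t u) t (v t) with hh
    set B : Set (Fin d → Fin P.M) := {z | ∃ k ∈ (I g).image (proj t), k ≠ h ∧
      residue h z = residue k z} with hB
    have hset : {ω : Randomness d P | P.L ≤ 2 * (Finset.univ.filter fun l : Fin P.L => ∃ k ∈ I g,
        proj t k ≠ h ∧ residue h (ω.2.2.1 t i l) = residue (proj t k) (ω.2.2.1 t i l)).card} =
        {ω | ω.2.2.1 t i ∈ {z | Fintype.card (Fin P.L) ≤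
          2 * (Finset.univ.filter fun l => z l ∈ B).card}} := by
      ext ω
      simp [hB]
    rw [hset, law_lattice_mem]
    have halias : uniformOn (Set.univ : Set (Fin d → Fin P.M)) B ≤ 16⁻¹ := by
      refine uniformOn_alias_le P.M_prime _ _ ?_ ?_
      · exact (Nat.mul_le_mul_left 16 (Finset.card_image_le.trans (hcard g))).trans hM
      · intro k hk j
        obtain ⟨k', hk', rfl⟩ := Finset.mem_image.1 hk
        refine (abs_update_trunc_sub_proj_le (biUnion_subset hI hu) (biUnion_subset hI hv)
          (hI g hk') t j).trans_lt ?_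
        exact_mod_cast hMw j
    have hvote := pi_majority_le (ι := Fin P.L) _ halias
    rw [Fintype.card_fin] at hvote ⊢
    exact hvote
  · gcongr
  · gcongr
  · simp only [Fintype.card_fin]

lemma law_not_isolated_le (hI : ∀ g, I g ⊆ Γ) (hcard : ∀ g, (I g).card ≤ s)
    (hMfin : 16 * (s * G) ≤ P.Mfin) (hMfinw : ∀ t, width Γ t < P.Mfin) :
    law d P {ω | ∃ k ∈ Finset.univ.biUnion I, ∀ l, ∃ k' ∈ Finset.univ.biUnion I,
      k' ≠ k ∧ residue k (ω.2.2.2 l) = residue k' (ω.2.2.2 l)} ≤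
      (s * G : ℕ) * 2⁻¹ ^ P.Lfin := by
  set U := Finset.univ.biUnion I with hU
  have hUcard : U.card ≤ s * G := card_biUnion_le hcard
  refine (measure_exists_mem_le _ U _ (b := 2⁻¹ ^ P.Lfin) fun k hk => ?_).trans (by gcongr)
  have h1 := law_final_mem (d := d) (P := P) {x | ∀ l ∈ (Finset.univ : Finset (Fin P.Lfin)),
      x l ∈ {z | ∃ k' ∈ U, k' ≠ k ∧ residue k z = residue k' z}}
  rw [pi_forall_mem, Finset.card_fin] at h1
  simp only [Finset.mem_univ, true_imp_iff, Set.mem_ofPred_eq] at h1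
  rw [h1]
  gcongr
  refine (uniformOn_alias_le P.Mfin_prime _ _ ?_ fun k' hk' j => ?_).trans ?_
  · exact (Nat.mul_le_mul_left 16 hUcard).trans hMfin
  · refine (abs_sub_le_width (biUnion_subset hI hk) (biUnion_subset hI hk') j).trans_lt ?_
    exact_mod_cast hMfinw j
  · exact ENNReal.inv_le_inv.2 (by norm_num)

/-- The union bound for the complement of the good event. -/
lemma law_not_good_le (hI : ∀ g, I g ⊆ Γ) (hcard : ∀ g, (I g).card ≤ s) (hθ0 : 0 ≤ θ)
    (hc : ∀ g, ∀ k ∈ I g, 0 < ‖c g k‖) (hθ : ∀ g, ∀ k ∈ I g, 3 * θ ≤ ‖c g k‖)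
    (hM : 16 * s ≤ P.M) (hMw : ∀ t, width Γ t < P.M) (hMfin : 16 * (s * G) ≤ P.Mfin)
    (hMfinw : ∀ t, width Γ t < P.Mfin) :
    law d P {ω | ¬ Good I c θ P ω} ≤
      d * (G * (s * ENNReal.ofReal (1 - 2 / (3 * s)) ^ P.r)) +
      d * (G * (s * ENNReal.ofReal (1 - 2 / (3 * s)) ^ P.r)) +
      d * (P.r * (G * ((s * G : ℕ) * ((s * G : ℕ) * 2⁻¹ ^ P.L)))) +
      (s * G : ℕ) * 2⁻¹ ^ P.Lfin := by
  refine le_trans (measure_mono fun ω hω => ?_) ((measure_union_le _ _).trans (add_le_add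
    ((measure_union_le _ _).trans (add_le_add ((measure_union_le _ _).trans (add_le_add
    (law_coord_invisible_le hcard hθ0 hc hθ) (law_prefix_invisible_le hcard hθ0 hc hθ)))
    (law_vote_fails_le hI hcard hM hMw))) (law_not_isolated_le hI hcard hMfin hMfinw)))
  by_contra hcon
  simp only [Set.mem_union, not_or] at hcon
  obtain ⟨⟨⟨h1, h2⟩, h3⟩, h4⟩ := hcon
  refine hω ⟨fun t g k hk => ?_, fun t g k hk => ?_, fun t i g u hu v hv => ?_, fun k hk => ?_⟩
  · by_contra! hcon
    exact h1 ⟨t, g, k, hk, hcon⟩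
  · by_contra! hcon
    exact h2 ⟨t, g, k, hk, hcon⟩
  · by_contra! hcon
    exact h3 ⟨t, i, g, u, hu, v, hv, hcon⟩
  · by_contra! hcon
    refine h4 ⟨k, hk, fun l => ?_⟩
    obtain ⟨k', hk', hne, he⟩ := hcon l
    exact ⟨k', hk', hne, he.symm⟩

end USFFT

/-! ### The choice of the parameters -/

namespace USFFT

open Timed ProbabilityTheory

/-- The good event contains a measurable set of at least the same probability, so that its own
measurability is not needed. -/
lemma exists_measurableSet_good {d G : ℕ} {P : Params}
    {I : Fin G → Finset (Fin d → ℤ)} {c : Fin G → (Fin d → ℤ) → ℂ} {θ δ : ℝ} (hδ : 0 ≤ δ)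
    (h : law d P {ω | ¬ Good I c θ P ω} ≤ ENNReal.ofReal δ) :
    ∃ E : Set (Randomness d P), MeasurableSet E ∧ ENNReal.ofReal (1 - δ) ≤ law d P E ∧
      ∀ ω ∈ E, Good I c θ P ω := by
  refine ⟨(toMeasurable (law d P) {ω | ¬ Good I c θ P ω})ᶜ,
    (measurableSet_toMeasurable _ _).compl, ?_, fun ω hω => ?_⟩
  · rw [prob_compl_eq_one_sub (measurableSet_toMeasurable _ _), measure_toMeasurable,
      ENNReal.ofReal_sub _ hδ, ENNReal.ofReal_one]
    exact tsub_le_tsub_left h _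
  · by_contra h
    exact hω (subset_toMeasurable _ _ h)

lemma card_samplingSet_le {d : ℕ} (Γ : Finset (Fin d → ℤ)) (P : Params) (ω : Randomness d P)
    {N : ℕ} (hN : ∀ t, width Γ t + 1 ≤ N) :
    (samplingSet Γ P ω).card ≤ d * (P.r * N) + d * (P.r * (P.L * P.M)) + P.Lfin * P.Mfin := by
  classical
  unfold samplingSet
  refine (Finset.card_union_le _ _).trans (Nat.add_le_add ((Finset.card_union_le _ _).trans
    (Nat.add_le_add ?_ ?_)) ?_)
  · refine (Finset.card_biUnion_le_card_mul _ _ (P.r * N) fun t _ =>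
      (Finset.card_biUnion_le_card_mul _ _ N fun i _ => ?_).trans_eq ?_).trans_eq ?_
    · exact Finset.card_image_le.trans (by simpa using hN t)
    · rw [Finset.card_fin]
    · rw [Finset.card_fin]
  · refine (Finset.card_biUnion_le_card_mul _ _ (P.r * (P.L * P.M)) fun t _ =>
      (Finset.card_biUnion_le_card_mul _ _ (P.L * P.M) fun i _ =>
        (Finset.card_biUnion_le_card_mul _ _ P.M fun l _ => ?_).trans_eq ?_).trans ?_).trans ?_
    · exact Finset.card_image_le.trans (by simp)
    · rw [Finset.card_fin]
    · exact Nat.mul_le_mul_right _ ((List.toFinset_card_le _).trans (length_iterations_le P t))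
    · exact Nat.mul_le_mul_right _ ((Finset.card_filter_le _ _).trans_eq (Finset.card_fin d))
  · refine (Finset.card_biUnion_le_card_mul _ _ P.Mfin fun l _ => ?_).trans_eq ?_
    · exact Finset.card_image_le.trans (by simp)
    · rw [Finset.card_fin]

/-- The polynomial arithmetic behind both cost bounds: `R` bounds the number of frequencies kept in
a pass, and is at most a constant times `S * G * μ`, with `S = s` on the good event and `S = s ^ 2`
in the worst case. -/
lemma cost_bound_arith {d s S G N R l μ M Mfin : ℕ} (hd : 1 ≤ d) (hs : 1 ≤ s) (hsS : s ≤ S)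
    (hG : 1 ≤ G) (hN : 1 ≤ N) (hl : l ≤ μ) (hμ : 1 ≤ μ) (hM : M ≤ 32 * (s * N))
    (hMfin : Mfin ≤ 32 * (s * G * N)) (hR : R ≤ 3 * (S * G * μ)) :
    d * (470 * (3 * s * l * G * (2 * N) * (10 * μ) * d) + 2) +
      d * (8 * (d * R * (2 * N)) + R * (2 * N) +
        3 * s * l * G * (430 * (d * (9 * l) * M * (10 * μ)) +
          60 * (R * (2 * N) * (9 * l * d + 10 * μ))) + 1) +
      430 * (G * d * (9 * l) * (Mfin * (10 * μ) + R)) ≤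
    10000000 * (d ^ 2 * s * S * G ^ 2 * N * μ ^ 3) := by
  have hS : 1 ≤ S := hs.trans hsS
  -- every monomial of the left-hand side is dominated by a divisor of `W`
  set W := d ^ 2 * s * S * G ^ 2 * N * μ ^ 3 with hW
  have hWpos : 0 < W := by positivity
  have key : ∀ m q : ℕ, m * q = W → m ≤ W := fun m q h =>
    Nat.le_of_dvd hWpos ⟨q, h.symm⟩
  have h1 := key (d ^ 2 * s * G * N * μ ^ 2) (S * G * μ) (by rw [hW]; ring)
  have h2 := key d (d * s * S * G ^ 2 * N * μ ^ 3) (by rw [hW]; ring)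
  have h3 := key (d ^ 2 * S * G * N * μ) (s * G * μ ^ 2) (by rw [hW]; ring)
  have h4 := key (d * S * G * N * μ) (d * s * G * μ ^ 2) (by rw [hW]; ring)
  have h5 : d ^ 2 * s * s * G * N * μ ^ 3 ≤ W := by
    refine le_trans ?_ (key (d ^ 2 * s * S * G * N * μ ^ 3) G (by rw [hW]; ring))
    gcongr
  have h6 := key (d ^ 2 * s * S * G ^ 2 * N * μ ^ 3) 1 (by rw [hW]; ring)
  have h7 := key (d * s * S * G ^ 2 * N * μ ^ 3) d (by rw [hW]; ring)
  have h8 := key (d * s * G ^ 2 * N * μ ^ 2) (d * S * μ) (by rw [hW]; ring)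
  have h9 := key (d * S * G ^ 2 * μ ^ 2) (d * s * N * μ) (by rw [hW]; ring)
  calc _ ≤ d * (470 * (3 * s * μ * G * (2 * N) * (10 * μ) * d) + 2) +
      d * (8 * (d * (3 * (S * G * μ)) * (2 * N)) + 3 * (S * G * μ) * (2 * N) +
        3 * s * μ * G * (430 * (d * (9 * μ) * (32 * (s * N)) * (10 * μ)) +
          60 * (3 * (S * G * μ) * (2 * N) * (9 * μ * d + 10 * μ))) + 1) +
      430 * (G * d * (9 * μ) * (32 * (s * G * N) * (10 * μ) + 3 * (S * G * μ))) := by gcongr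
    _ = 28200 * (d ^ 2 * s * G * N * μ ^ 2) + 3 * d + 48 * (d ^ 2 * S * G * N * μ) +
        6 * (d * S * G * N * μ) + 3715200 * (d ^ 2 * s * s * G * N * μ ^ 3) +
        9720 * (d ^ 2 * s * S * G ^ 2 * N * μ ^ 3) + 10800 * (d * s * S * G ^ 2 * N * μ ^ 3) +
        1238400 * (d * s * G ^ 2 * N * μ ^ 2) + 11610 * (d * S * G ^ 2 * μ ^ 2) := by ring
    _ ≤ 10000000 * W := by omega

lemma exp_six_le : Real.exp 6 ≤ 512 := by
  have h := Real.exp_one_lt_d9.le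
  calc Real.exp 6 = Real.exp 1 ^ 6 := by rw [← Real.exp_nat_mul]; norm_num
    _ ≤ 2.7182818286 ^ 6 := by gcongr
    _ ≤ 512 := by norm_num

/-- With `l ≥ log (3 d s G / δ)`, `3 s l` detection iterations and `9 l` lattices, the union bound
for the failure probability is at most `δ`. -/
lemma failure_bound_le {d s G l : ℕ} {δ : ℝ} (hd : 1 ≤ d) (hs : 1 ≤ s) (hG : 1 ≤ G) (hδ : 0 < δ)
    (hδ1 : δ < 1) (hl : Real.log (3 * (d * s * G) / δ) ≤ l) :
    (d * (G * (s * ENNReal.ofReal (1 - 2 / (3 * s)) ^ (3 * s * l))) +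
      d * (G * (s * ENNReal.ofReal (1 - 2 / (3 * s)) ^ (3 * s * l))) +
      d * ((3 * s * l : ℕ) * (G * ((s * G : ℕ) * ((s * G : ℕ) * 2⁻¹ ^ (9 * l))))) +
      (s * G : ℕ) * 2⁻¹ ^ (9 * l) : ENNReal) ≤ ENNReal.ofReal δ := by
  have hd' : (1 : ℝ) ≤ d := by exact_mod_cast hd
  have hs' : (1 : ℝ) ≤ s := by exact_mod_cast hs
  have hG' : (1 : ℝ) ≤ G := by exact_mod_cast hG
  -- with `e = exp (-l)`, detection fails with probability at most `e ^ 2` and a vote with at most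
  -- `e ^ 6`; one factor `d * s * G * e ≤ δ / 3` makes each term small, the other ones absorb
  -- `s * G` and `l`
  set e := Real.exp (-l) with he
  have he0 : 0 < e := Real.exp_pos _
  set A : ℝ := d * s * G with hA
  have hA1 : 1 ≤ A := one_le_mul_of_one_le_of_one_le (one_le_mul_of_one_le_of_one_le hd' hs') hG'
  have hAe : A * e ≤ δ / 3 := by
    have h1 : 3 * A / δ ≤ Real.exp l := by
      rw [← Real.exp_log (show 0 < 3 * A / δ by positivity)]
      exact Real.exp_le_exp.2 hl
    have h2 : Real.exp l * e = 1 := by rw [he, ← Real.exp_add, add_neg_cancel, Real.exp_zero]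
    have h3 : 3 * A / δ * e ≤ 1 := by rw [← h2]; gcongr
    rw [div_mul_eq_mul_div, div_le_one hδ] at h3
    linarith
  have hp : ENNReal.ofReal (1 - 2 / (3 * s)) ^ (3 * s * l) ≤ ENNReal.ofReal (e ^ 2) := by
    have h1 : 1 - 2 / (3 * (s : ℝ)) ≤ Real.exp (-(2 / (3 * s))) := by
      have := Real.add_one_le_exp (-(2 / (3 * (s : ℝ))))
      linarith
    calc ENNReal.ofReal (1 - 2 / (3 * s)) ^ (3 * s * l)
        ≤ ENNReal.ofReal (Real.exp (-(2 / (3 * s)))) ^ (3 * s * l) := by gcongr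
      _ = ENNReal.ofReal (e ^ 2) := by
        rw [← ENNReal.ofReal_pow (Real.exp_pos _).le, ← Real.exp_nat_mul, he, ← Real.exp_nat_mul]
        congr 2
        push_cast
        field_simp
  have hq : (2⁻¹ : ENNReal) ^ (9 * l) ≤ ENNReal.ofReal (e ^ 6) := by
    have h2 : (2⁻¹ : ENNReal) = ENNReal.ofReal 2⁻¹ := by
      rw [ENNReal.ofReal_inv_of_pos two_pos]
      norm_num
    rw [h2, ← ENNReal.ofReal_pow (by norm_num)]
    refine ENNReal.ofReal_le_ofReal ?_
    rw [pow_mul, he, ← Real.exp_nat_mul, show ((6 : ℕ) : ℝ) * -(l : ℝ) = (l : ℕ) * (-6 : ℝ) by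
      push_cast; ring, Real.exp_nat_mul]
    gcongr
    rw [Real.exp_neg]
    calc ((2 : ℝ)⁻¹) ^ 9 = 512⁻¹ := by norm_num
      _ ≤ (Real.exp 6)⁻¹ := inv_anti₀ (Real.exp_pos _) exp_six_le
  have hle : (l : ℝ) * e ≤ 1 := by
    have h1 : (l : ℝ) ≤ Real.exp l := by
      have := Real.add_one_le_exp (l : ℝ)
      linarith
    calc (l : ℝ) * e ≤ Real.exp l * e := by gcongr
      _ = 1 := by rw [he, ← Real.exp_add, add_neg_cancel, Real.exp_zero]
  calc _ ≤ (d * (G * (s * ENNReal.ofReal (e ^ 2))) + d * (G * (s * ENNReal.ofReal (e ^ 2))) +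
      d * ((3 * s * l : ℕ) * (G * ((s * G : ℕ) * ((s * G : ℕ) * ENNReal.ofReal (e ^ 6))))) +
      (s * G : ℕ) * ENNReal.ofReal (e ^ 6) : ENNReal) := by gcongr
    _ = ENNReal.ofReal (d * (G * (s * e ^ 2)) + d * (G * (s * e ^ 2)) +
      d * ((3 * s * l : ℕ) * (G * ((s * G : ℕ) * ((s * G : ℕ) * e ^ 6)))) +
      (s * G : ℕ) * e ^ 6) := by
      rw [ENNReal.ofReal_add (by positivity) (by positivity),
        ENNReal.ofReal_add (by positivity) (by positivity),
        ENNReal.ofReal_add (by positivity) (by positivity)]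
      simp only [ENNReal.ofReal_mul (Nat.cast_nonneg _), ENNReal.ofReal_natCast]
    _ ≤ ENNReal.ofReal δ := by
      refine ENNReal.ofReal_le_ofReal ?_
      push_cast
      have hsG : (s * G : ℝ) ≤ A := by
        rw [hA, mul_assoc]
        exact le_mul_of_one_le_left (by positivity) hd'
      have h0 : 0 ≤ (s * G : ℝ) := by positivity
      have he1 : e ≤ 1 / 3 := by
        have : e ≤ A * e := le_mul_of_one_le_left he0.le hA1
        linarith
      have e1 : d * (G * (s * e ^ 2)) = (A * e) * e := by rw [hA]; ring
      have e2 : d * (3 * s * l * (G * (s * G * (s * G * e ^ 6)))) =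
          3 * (A * e) * ((s * G * e) * (s * G * e)) * ((l * e) * e * e) := by rw [hA]; ring
      have e3 : s * G * e ^ 6 = (s * G * e) * e ^ 5 := by ring
      rw [e1, e2, e3]
      have hx0 : 0 ≤ s * G * e := by positivity
      have hx : s * G * e ≤ δ / 3 := (mul_le_mul_of_nonneg_right hsG he0.le).trans hAe
      have hl0 : 0 ≤ (l : ℝ) * e := by positivity
      have f1 : A * e * e ≤ δ / 3 * (1 / 3) := by gcongr
      have f2 : 3 * (A * e) * ((s * G * e) * (s * G * e)) * ((l * e) * e * e) ≤
          3 * (δ / 3) * (1 * 1) * (1 * (1 / 3) * (1 / 3)) := by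
        have : s * G * e ≤ 1 := by linarith
        gcongr
      have f3 : s * G * e * e ^ 5 ≤ δ / 3 * 1 := by
        have : e ^ 5 ≤ 1 := pow_le_one₀ he0.le (by linarith)
        gcongr
      linarith

lemma clog_le_of_le_four_pow {n a μ : ℕ} (h : n ≤ 2 ^ a * 4 ^ μ) (ha : a ≤ 8 * μ) :
    Nat.clog 2 n ≤ 10 * μ := by
  refine Nat.clog_le_of_le_pow (h.trans ?_)
  rw [show 4 = 2 ^ 2 by norm_num, ← pow_mul, ← pow_add]
  exact Nat.pow_le_pow_right two_pos (by omega)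

lemma nat_le_four_pow (n : ℕ) : n ≤ 4 ^ n := (Nat.lt_pow_self (by norm_num)).le

/-- The parameters used for sparsity `s`, `G` polynomials and maximal width `N` of the search space,
where `l` is the logarithmic oversampling: `3 s l` detection iterations make a frequency, which is
visible with probability `2 / (3 s)` in each of them, be missed with probability `exp (-2 l)`, and
the lattice sizes make aliasing on a single lattice have probability at most `1 / 16`. -/
structure Admissible (P : Params) (s G N l : ℕ) : Prop where
  sLoc_eq : P.sLoc = s
  r_eq : P.r = 3 * s * l
  L_eq : P.L = 9 * l
  lt_M : 16 * max s N < P.M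
  M_le : P.M ≤ 32 * max s N
  Lfin_eq : P.Lfin = 9 * l
  lt_Mfin : 16 * max (s * G) N < P.Mfin
  Mfin_le : P.Mfin ≤ 32 * max (s * G) N

/-- Bertrand's postulate provides the prime lattice sizes. -/
lemma exists_admissible {s G N : ℕ} (l : ℕ) (hN : 1 ≤ N) : ∃ P : Params, Admissible P s G N l := by
  obtain ⟨M, hMp, hM1, hM2⟩ := Nat.exists_prime_lt_and_le_two_mul (16 * max s N) (by
    have := le_max_right s N; omega)
  obtain ⟨M', hMp', hM1', hM2'⟩ :=
    Nat.exists_prime_lt_and_le_two_mul (16 * max (s * G) N) (by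
      have := le_max_right (s * G) N; omega)
  exact ⟨⟨s, 3 * s * l, 9 * l, M, hMp, 9 * l, M', hMp'⟩, rfl, rfl, rfl, hM1, by dsimp only; omega,
    rfl, hM1', by dsimp only; omega⟩

namespace Admissible

variable {d s G N l μ : ℕ} {Γ : Finset (Fin d → ℤ)} {P : Params} {ω : Randomness d P}
  {I : Fin G → Finset (Fin d → ℤ)} {c : Fin G → (Fin d → ℤ) → ℂ} {θ δ : ℝ}

lemma card_samplingSet_le (hP : Admissible P s G N l) (hN : 1 ≤ N) (hl : 1 ≤ l)
    (hwN : ∀ t, width Γ t ≤ N) (ω : Randomness d P) :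
    (samplingSet Γ P ω).card ≤ 870 * (d * s * max s N * l ^ 2) + 288 * (max (s * G) N * l) := by
  refine (USFFT.card_samplingSet_le Γ P ω (N := 2 * N) fun t => ?_).trans ?_
  · have := hwN t
    omega
  rw [hP.r_eq, hP.L_eq, hP.Lfin_eq]
  calc _ ≤ d * (3 * s * (l * l) * (2 * max s N)) +
        d * (3 * s * l * (9 * l * (32 * max s N))) + 9 * l * (32 * max (s * G) N) := by
        gcongr
        · exact Nat.le_mul_of_pos_left _ hl
        · exact le_max_right _ _
        · exact hP.M_le
        · exact hP.Mfin_le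
    _ = _ := by ring

lemma law_not_good_le (hP : Admissible P s G N l) (hd : 1 ≤ d) (hs : 1 ≤ s) (hG : 1 ≤ G)
    (hwN : ∀ t, width Γ t ≤ N) (hδ : 0 < δ) (hδ1 : δ < 1)
    (hl : Real.log (3 * (d * s * G) / δ) ≤ l)
    (hI : ∀ g, I g ⊆ Γ) (hcard : ∀ g, (I g).card ≤ s) (hθ0 : 0 ≤ θ)
    (hc : ∀ g, ∀ k ∈ I g, 0 < ‖c g k‖) (hθ : ∀ g, ∀ k ∈ I g, 3 * θ ≤ ‖c g k‖) :
    law d P {ω | ¬ Good I c θ P ω} ≤ ENNReal.ofReal δ := by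
  have h1 := le_max_left s N
  have h2 := le_max_right s N
  have h3 := le_max_left (s * G) N
  have h4 := le_max_right (s * G) N
  have h5 := hP.lt_M
  have h6 := hP.lt_Mfin
  refine (USFFT.law_not_good_le hI hcard hθ0 hc hθ (by omega) (fun t => ?_) (by omega)
    fun t => ?_).trans ?_
  · have := hwN t
    omega
  · have := hwN t
    omega
  · rw [hP.r_eq, hP.L_eq, hP.Lfin_eq]
    exact failure_bound_le hd hs hG hδ hδ1 hl

/-- The logarithms of all array and list lengths are at most a multiple of `μ`. -/
lemma clog_le (hP : Admissible P s G N l) (hs : 1 ≤ s) (hG : 1 ≤ G) (hN : 1 ≤ N) (hlμ : l ≤ μ)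
    (hμ : 1 ≤ μ) (hX : s * G * N ≤ 4 ^ μ) :
    Nat.clog 2 (2 * (2 * N)) ≤ 10 * μ ∧ Nat.clog 2 (2 * P.M) ≤ 10 * μ ∧
      Nat.clog 2 (2 * P.Mfin) ≤ 10 * μ ∧ Nat.clog 2 (s * G * (2 * N)) ≤ 10 * μ ∧
      Nat.clog 2 (P.r * G * P.sLoc * (2 * N)) ≤ 10 * μ := by
  have hsG : s * G ≤ s * G * N := Nat.le_mul_of_pos_right _ hN
  have hsX : s ≤ s * G * N := (Nat.le_mul_of_pos_right _ hG).trans hsG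
  have hNX : N ≤ s * G * N := Nat.le_mul_of_pos_left _ (Nat.mul_pos hs hG)
  have h1 : max s N ≤ s * G * N := max_le hsX hNX
  have h2 : max (s * G) N ≤ s * G * N := max_le hsG hNX
  have h3 := hP.M_le
  have h4 := hP.Mfin_le
  refine ⟨clog_le_of_le_four_pow (a := 2) (by omega) (by omega),
    clog_le_of_le_four_pow (a := 6) (by omega) (by omega),
    clog_le_of_le_four_pow (a := 6) (by omega) (by omega),
    clog_le_of_le_four_pow (a := 1) ?_ (by omega),
    clog_le_of_le_four_pow (a := 3 + 4 * μ) ?_ (by omega)⟩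
  · rw [show s * G * (2 * N) = 2 * (s * G * N) by ring]
    omega
  · rw [hP.r_eq, hP.sLoc_eq]
    calc 3 * s * l * G * s * (2 * N) = 6 * (s * l * (s * G * N)) := by ring
      _ ≤ 8 * (4 ^ μ * 4 ^ μ * 4 ^ μ) := by
        gcongr
        · norm_num
        · exact hsX.trans hX
        · exact hlμ.trans (nat_le_four_pow μ)
      _ = 2 ^ (3 + 4 * μ) * 4 ^ μ := by
        rw [pow_add, pow_mul 2 4, show 2 ^ 4 = 4 * 4 by norm_num, mul_pow]
        ring

lemma M_le_mul (hP : Admissible P s G N l) (hs : 1 ≤ s) (hN : 1 ≤ N) : P.M ≤ 32 * (s * N) :=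
  hP.M_le.trans (Nat.mul_le_mul_left _
    (max_le (Nat.le_mul_of_pos_right _ hN) (Nat.le_mul_of_pos_left _ hs)))

lemma Mfin_le_mul (hP : Admissible P s G N l) (hs : 1 ≤ s) (hG : 1 ≤ G) (hN : 1 ≤ N) :
    P.Mfin ≤ 32 * (s * G * N) :=
  hP.Mfin_le.trans (Nat.mul_le_mul_left _
    (max_le (Nat.le_mul_of_pos_right _ hN) (Nat.le_mul_of_pos_left _ (Nat.mul_pos hs hG))))

lemma pos (hP : Admissible P s G N l) (hs : 1 ≤ s) (hl : 1 ≤ l) :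
    1 ≤ P.r ∧ 1 ≤ P.L ∧ 1 ≤ P.Lfin := by
  rw [hP.r_eq, hP.L_eq, hP.Lfin_eq]
  exact ⟨Nat.mul_pos (Nat.mul_pos three_pos hs) hl, by omega, by omega⟩

lemma cost_usFFT_le_of_good (hP : Admissible P s G N l) (hd : 1 ≤ d) (hs : 1 ≤ s) (hG : 1 ≤ G)
    (hN : 1 ≤ N) (hwN : ∀ t, width Γ t ≤ N) (hl : 1 ≤ l) (hlμ : l ≤ μ) (hX : s * G * N ≤ 4 ^ μ)
    (hω : Good I c θ P ω) (hI : ∀ g, I g ⊆ Γ) (hcard : ∀ g, (I g).card ≤ s) (hθ : 0 ≤ θ)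
    (hc : ∀ g, ∀ k ∈ I g, θ < ‖c g k‖) :
    (usFFT Γ s θ P ω fun g => trigPoly (I g) (c g)).cost ≤
      10000000 * (d ^ 2 * s ^ 2 * G ^ 2 * N * μ ^ 3) := by
  have hμ : 1 ≤ μ := hl.trans hlμ
  obtain ⟨h1, h2, h3, h4, -⟩ := hP.clog_le hs hG hN hlμ hμ hX
  obtain ⟨hr, hL, hLfin⟩ := hP.pos hs hl
  have hcost := USFFT.cost_usFFT_le_of_good (N := 2 * N) hω hI hP.sLoc_eq.ge hs hcard hθ hc
    (fun t => by have := hwN t; omega) hd hG hr hL hLfin h1 h2 h3 h4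
  rw [hP.r_eq, hP.L_eq, hP.Lfin_eq] at hcost
  refine hcost.trans ((cost_bound_arith (S := s) hd hs le_rfl hG hN hlμ hμ (hP.M_le_mul hs hN)
    (hP.Mfin_le_mul hs hG hN) ?_).trans_eq (by ring))
  calc s * G ≤ s * G * μ := Nat.le_mul_of_pos_right _ hμ
    _ ≤ 3 * (s * G * μ) := Nat.le_mul_of_pos_left _ three_pos

lemma cost_usFFT_le_worst {f : Fin G → UnitAddTorus (Fin d) → ℂ} (hP : Admissible P s G N l)
    (hd : 1 ≤ d) (hs : 1 ≤ s) (hG : 1 ≤ G) (hN : 1 ≤ N) (hwN : ∀ t, width Γ t ≤ N) (hl : 1 ≤ l)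
    (hlμ : l ≤ μ) (hX : s * G * N ≤ 4 ^ μ) :
    (usFFT Γ s θ P ω f).cost ≤ 10000000 * (d ^ 2 * s ^ 3 * G ^ 2 * N * μ ^ 3) := by
  have hμ : 1 ≤ μ := hl.trans hlμ
  obtain ⟨h1, h2, h3, -, h4⟩ := hP.clog_le hs hG hN hlμ hμ hX
  obtain ⟨hr, hL, hLfin⟩ := hP.pos hs hl
  have hcost := USFFT.cost_usFFT_le_worst (Γ := Γ) (f := f) (θ := θ) (ω := ω) (N := 2 * N)
    hP.sLoc_eq.ge (hs.trans_eq hP.sLoc_eq.symm) (fun t => by have := hwN t; omega) hd hG hr hL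
    hLfin h1 h2 h3 h4
  rw [hP.r_eq, hP.L_eq, hP.Lfin_eq, hP.sLoc_eq] at hcost
  refine hcost.trans ((cost_bound_arith (S := s ^ 2) hd hs (Nat.le_self_pow two_ne_zero s) hG hN
    hlμ hμ (hP.M_le_mul hs hN) (hP.Mfin_le_mul hs hG hN) ?_).trans_eq (by ring))
  calc 3 * s * l * G * s ≤ 3 * s * μ * G * s := by gcongr
    _ = 3 * (s ^ 2 * G * μ) := by ring

end Admissible

/-- If `X ≥ 3` then `⌈log X⌉` lies between `1` and `2 log X`. -/
lemma ceil_log_bounds {x : ℝ} (hx : 3 ≤ x) :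
    1 ≤ ⌈Real.log x⌉₊ ∧ (⌈Real.log x⌉₊ : ℝ) ≤ 2 * Real.log x ∧ x ≤ 4 ^ ⌈Real.log x⌉₊ := by
  have hexp := Real.exp_one_lt_d9
  have h1 : 1 ≤ Real.log x := by
    rw [Real.le_log_iff_exp_le (by linarith)]
    linarith
  refine ⟨Nat.one_le_iff_ne_zero.2 (Nat.ceil_pos.2 (by linarith)).ne', ?_, ?_⟩
  · have := Nat.ceil_lt_add_one (show 0 ≤ Real.log x by linarith)
    linarith
  · calc x = Real.exp (Real.log x) := (Real.exp_log (by linarith)).symm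
      _ ≤ Real.exp ⌈Real.log x⌉₊ := Real.exp_le_exp.2 (Nat.le_ceil _)
      _ = Real.exp 1 ^ ⌈Real.log x⌉₊ := by rw [← Real.exp_nat_mul, mul_one]
      _ ≤ 4 ^ ⌈Real.log x⌉₊ := by
        gcongr
        linarith

end USFFT

/-! ### Recovery, sampling and cost bounds -/

open MeasureTheory in
theorem theorem1p1 :
    ∃ C : ℝ, 0 < C ∧
      ∀ (d s G : ℕ) (Γ : Finset (Fin d → ℤ)) (δ : ℝ),
        1 ≤ d → 1 ≤ s → 1 ≤ G → 0 < δ → δ < 1 →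
        ∀ N : ℕ, N = max 1 (USFFT.maxWidth Γ) →
        ∃ P : USFFT.Params,
          s ≤ P.sLoc ∧
          -- number of sampling locations
          (∀ ω : USFFT.Randomness d P,
            ((USFFT.samplingSet Γ P ω).card : ℝ) ≤
              C * ((d * s * max s N : ℕ) * Real.log (3 * (d * s * G * N) / δ) ^ 2 +
                (max (s * G) N : ℕ) * Real.log (3 * (d * s * G) / δ))) ∧
          -- the method uses only the values at the sampling locations
          (∀ (ω : USFFT.Randomness d P) (θ : ℝ) (f f' : Fin G → UnitAddTorus (Fin d) → ℂ),
            (∀ g, ∀ x ∈ USFFT.samplingSet Γ P ω, f g x = f' g x) →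
            USFFT.usFFT Γ s θ P ω f = USFFT.usFFT Γ s θ P ω f') ∧
          ∀ (I : Fin G → Finset (Fin d → ℤ)) (phat : Fin G → (Fin d → ℤ) → ℂ) (θ : ℝ),
            (∀ g, I g ⊆ Γ) → (∀ g, (I g).card ≤ s) → (∀ g, ∀ k ∈ I g, 0 < ‖phat g k‖) →
            0 ≤ θ → (∀ g, ∀ k ∈ I g, 3 * θ ≤ ‖phat g k‖) →
            -- recovery and arithmetic cost with high probability
            (∃ E : Set (USFFT.Randomness d P), MeasurableSet E ∧
              ENNReal.ofReal (1 - δ) ≤ USFFT.law d P E ∧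
              ∀ ω ∈ E,
                (∀ (g : Fin G) (k : Fin d → ℤ) (c : ℂ),
                  ((k, c) ∈ (USFFT.usFFT Γ s θ P ω
                      (fun g => USFFT.trigPoly (I g) (phat g))).val g ∧ c ≠ 0) ↔
                    (k ∈ I g ∧ c = phat g k)) ∧
                ((USFFT.usFFT Γ s θ P ω
                    (fun g => USFFT.trigPoly (I g) (phat g))).cost : ℝ) ≤
                  C * ((d ^ 2 * s ^ 2 * G ^ 2 * N : ℕ) *
                    Real.log (3 * (d * s * G * N) / δ) ^ 3)) ∧
            -- arithmetic cost in the worst case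
            ∀ ω : USFFT.Randomness d P,
              ((USFFT.usFFT Γ s θ P ω
                  (fun g => USFFT.trigPoly (I g) (phat g))).cost : ℝ) ≤
                C * ((d ^ 2 * s ^ 3 * G ^ 2 * N : ℕ) *
                  Real.log (3 * (d * s * G * N) / δ) ^ 3) := by
  -- `10000000 * 2 ^ 3`, since the logarithm is rounded up to `μ ≤ 2 * Λ`
  refine ⟨80000000, by norm_num, ?_⟩
  intro d s G Γ δ hd hs hG hδ hδ1 N hNdef
  have hN : 1 ≤ N := hNdef ▸ le_max_left _ _
  have hwN : ∀ t, USFFT.width Γ t ≤ N := fun t =>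
    (USFFT.width_le_maxWidth Γ t).trans (hNdef ▸ le_max_right _ _)
  have hA1 : (1 : ℝ) ≤ d * s * G := by exact_mod_cast Nat.mul_pos (Nat.mul_pos hd hs) hG
  have hN' : (1 : ℝ) ≤ N := by exact_mod_cast hN
  have hAN : (d * s * G : ℝ) ≤ d * s * G * N := le_mul_of_one_le_right (by positivity) hN'
  have hX₀ : (3 : ℝ) ≤ 3 * (d * s * G) / δ := by
    rw [le_div_iff₀ hδ]
    nlinarith
  have hXX : (3 * (d * s * G) / δ : ℝ) ≤ 3 * (d * s * G * N) / δ := by gcongr 3 * ?_ / _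
  obtain ⟨hl, hlΛ, -⟩ := USFFT.ceil_log_bounds hX₀
  obtain ⟨-, hμΛ, hμX⟩ := USFFT.ceil_log_bounds (hX₀.trans hXX)
  have hΛΛ := Real.log_le_log (by positivity) hXX
  have hlμ := Nat.ceil_mono hΛΛ
  have hllog := Nat.le_ceil (Real.log (3 * (d * s * G) / δ))
  have hΛ₀ : 0 ≤ Real.log (3 * (d * s * G) / δ) := Real.log_nonneg (by linarith)
  have hX : ((s * G * N : ℕ) : ℝ) ≤ 3 * (d * s * G * N) / δ := by
    rw [le_div_iff₀ hδ]
    have h1 : (1 : ℝ) ≤ d := by exact_mod_cast hd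
    have h2 : (0 : ℝ) ≤ s * G * N := by positivity
    push_cast
    calc (s * G * N * δ : ℝ) ≤ s * G * N * 1 := by gcongr
      _ ≤ 3 * (d * (s * G * N)) := by nlinarith
      _ = 3 * (d * s * G * N) := by ring
  have hX4 : s * G * N ≤ 4 ^ ⌈Real.log (3 * (d * s * G * N) / δ)⌉₊ := by
    exact_mod_cast hX.trans hμX
  generalize Real.log (3 * (d * s * G * N) / δ) = Λ at *
  generalize ⌈Λ⌉₊ = μ at *
  generalize hl₀ : ⌈Real.log (3 * (d * s * G) / δ)⌉₊ = l at *
  have hlog : ∀ S T : ℕ, T ≤ 10000000 * (S * μ ^ 3) →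
      (T : ℝ) ≤ 80000000 * ((S : ℝ) * Λ ^ 3) := by
    intro S T hT
    calc (T : ℝ) ≤ ((10000000 * (S * μ ^ 3) : ℕ) : ℝ) := by exact_mod_cast hT
      _ = 10000000 * (S * (μ : ℝ) ^ 3) := by push_cast; ring
      _ ≤ 10000000 * (S * (2 * Λ) ^ 3) := by gcongr
      _ = 80000000 * ((S : ℝ) * Λ ^ 3) := by ring
  obtain ⟨P, hP⟩ := USFFT.exists_admissible (s := s) (G := G) l hN
  refine ⟨P, hP.sLoc_eq.ge, fun ω => ?_, fun ω θ f f' h => USFFT.usFFT_congr s θ h, ?_⟩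
  · calc ((USFFT.samplingSet Γ P ω).card : ℝ) ≤ ((870 * (d * s * max s N * l ^ 2) +
          288 * (max (s * G) N * l) : ℕ) : ℝ) := by
          exact_mod_cast hP.card_samplingSet_le hN hl hwN ω
      _ = 870 * ((d * s * max s N : ℕ) * (l : ℝ) ^ 2) + 288 * ((max (s * G) N : ℕ) * (l : ℝ)) := by
        push_cast; ring
      _ ≤ 870 * ((d * s * max s N : ℕ) * (2 * Λ) ^ 2) +
          288 * ((max (s * G) N : ℕ) * (2 * Real.log (3 * (d * s * G) / δ))) := by
        gcongr
        linarith
      _ ≤ _ := by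
        have h2 : 0 ≤ ((d * s * max s N : ℕ) : ℝ) * Λ ^ 2 := by positivity
        have h3 : 0 ≤ ((max (s * G) N : ℕ) : ℝ) * Real.log (3 * (d * s * G) / δ) := by positivity
        nlinarith
  · intro I phat θ hI hcard hpos hθ hθp
    have hlarge : ∀ g, ∀ k ∈ I g, θ < ‖phat g k‖ := fun g k hk => by
      have h1 := hpos g k hk
      have h2 := hθp g k hk
      linarith
    obtain ⟨E, hEm, hEp, hE⟩ := USFFT.exists_measurableSet_good hδ.le
      (hP.law_not_good_le hd hs hG hwN hδ hδ1 hllog hI hcard hθ hpos hθp)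
    exact ⟨⟨E, hEm, hEp, fun ω hω => ⟨fun g k w => USFFT.mem_usFFT_of_good (hE ω hω) hI
      hP.sLoc_eq.ge hcard hθ hlarge (hP.pos hs hl).1 hd g k w,
      hlog _ _ (hP.cost_usFFT_le_of_good hd hs hG hN hwN
        hl hlμ hX4 (hE ω hω) hI hcard hθ hlarge)⟩⟩,
      fun ω => hlog _ _ (hP.cost_usFFT_le_worst hd hs hG hN hwN hl hlμ hX4)⟩
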